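/- Let $(T,d)$ be a pseudo-metric space that admits an isometric embedding into a real Hilbert space, and put $\Gamma(t_1,t_2)=d^2(t_1,t_2)$. Let $\{U_i, i\in\mathbb N\}$ be a Poisson point process on $\mathbb R$ with intensity $e^{-u}\,du$ and, independently of it, let $W_i$, $i\in\mathbb N$, be independent copies of a zero-mean Gaussian process $\{W(t),t\in T\}$ with incremental variance $\mathrm{Var}(W(t_1)-W(t_2))=\Gamma(t_1,t_2)$. Let $\sigma^2(t)=\mathrm{Var}\,W(t)$ and $\mathcal U_i(t)=U_i+W_i(t)-\sigma^2(t)/2$. Such families $(U_i,W_i)_{i\in\mathbb N}$ exist for every such space $(T,d)$. For $\alpha\in(0,2)$ and $i\ge 1$ let $$b_i^{(\alpha)}=\begin{cases}0,&0<\alpha<1,\\ \int_{1/i}^{1/(i-1)}x^{-2}\sin x\,dx,&\alpha=1,\\ \frac{\alpha}{\alpha-1}\left(i^{\frac{\alpha-1}{\alpha}}-(i-1)^{\frac{\alpha-1}{\alpha}}\right),&1<\alpha<2,\end{cases}$$ where $1/0=\infty$. For every $t\in T$, almost surely, the numbers $\mathcal U_i(t)$, $i\in\mathbb N$, can be listed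 in decreasing order as $\mathcal U_{(1)}(t)\ge \mathcal U_{(2)}(t)\ge\dots$, and the series $$S_{\Gamma,\alpha}(t)=\sum_{i=1}^\infty\left(e^{\mathcal U_{(i)}(t)/\alpha}-b_i^{(\alpha)}\right)$$ converges. The process $\{S_{\Gamma,\alpha}(t),t\in T\}$ so defined is an $\alpha$-stable process (all its finite-dimensional distributions are $\alpha$-stable) that is totally skewed to the right: for all $t_1,\dots,t_k\in T$ and all $a_1,\dots,a_k\ge 0$ that are not all zero, $\sum_j a_jS_{\Gamma,\alpha}(t_j)$ has a non-degenerate $\alpha$-stable law $S_\alpha(\sigma,\beta,\mu)$ with skewness $\beta=1$. The law of $S_{\Gamma,\alpha}$ on $\mathbb R^T$ (with the product $\sigma$-algebra) depends only on $\Gamma$ and $\alpha$; in particular it is the same for all zero-mean Gaussian processes $W$ with incremental variance $\Gamma$. -/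

import Mathlib

open MeasureTheory ProbabilityTheory Filter Topology

universe u v w z

noncomputable section

/-- `N(B) = #{i : U_i ∈ B}`, the number of points (with multiplicity) of the random family
`(U_i)` lying in `B`, a random element of `{0, 1, 2, …, ∞}`. -/
def pointCount {Ω : Type*} (U : ℕ → Ω → ℝ) (B : Set ℝ) (ω : Ω) : ℕ∞ :=
  Set.encard {i : ℕ | U i ω ∈ B}

/-- The random family `(U_i)` of real points, enumerated in any measurable way, is a Poisson point
process with intensity measure `ν`: the number of points in a Borel set of finite `ν`-measure is
Poisson distributed with parameter the `ν`-measure of the set, and the numbers of points in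
pairwise disjoint Borel sets are independent. -/
structure IsPoissonPointProcess {Ω : Type*} [MeasurableSpace Ω] (U : ℕ → Ω → ℝ)
    (ν : Measure ℝ) (P : Measure Ω) : Prop where
  measurable : ∀ i, Measurable (U i)
  law_count : ∀ B : Set ℝ, MeasurableSet B → ν B ≠ ⊤ → ∀ k : ℕ,
    P {ω | pointCount U B ω = k} = poissonMeasure (ν B).toNNReal {k}
  indep_count : ∀ (n : ℕ) (B : Fin n → Set ℝ), (∀ j, MeasurableSet (B j)) →
    Pairwise (fun j k => Disjoint (B j) (B k)) →
    iIndepFun (fun j => pointCount U (B j)) P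

/-- The measure `e^{-u} du` on the real line. -/
def expIntensity : Measure ℝ :=
  volume.withDensity (fun u => ENNReal.ofReal (Real.exp (-u)))

/-- `(U_i)` is a Poisson point process on `ℝ` with intensity `e^{-u} du`, the `W_i` are independent
copies of a zero-mean Gaussian process on `T` with incremental variance `Γ`, and the sequence
`(W_i)` is independent of `(U_i)`. -/
structure IsGaussPoissonFamily {T Ω : Type*} [MeasurableSpace Ω] (Γ : T → T → ℝ)
    (U : ℕ → Ω → ℝ) (W : ℕ → T → Ω → ℝ) (P : Measure Ω) : Prop where
  isProbabilityMeasure : IsProbabilityMeasure P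
  poisson : IsPoissonPointProcess U expIntensity P
  measurable : ∀ i t, Measurable (W i t)
  gaussian : ∀ i, IsGaussianProcess (W i) P
  mean_zero : ∀ i t, ∫ ω, W i t ω ∂P = 0
  incrementalVariance : ∀ i s t, variance (fun ω => W i s ω - W i t ω) P = Γ s t
  identDistrib : ∀ i, IdentDistrib (fun ω t => W i t ω) (fun ω t => W 0 t ω) P P
  indep_copies : iIndepFun (fun i ω t => W i t ω) P
  indep_points : IndepFun (fun ω i => U i ω) (fun ω i t => W i t ω) P

/-- The value `exp((U_i + W_i(t) - σ²(t)/2)/α)`, where `σ²(t)` is the variance of `W(t)`. -/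
def seriesTerm {T Ω : Type*} [MeasurableSpace Ω] (α : ℝ) (U : ℕ → Ω → ℝ) (W : ℕ → T → Ω → ℝ)
    (P : Measure Ω) (t : T) (ω : Ω) (i : ℕ) : ℝ :=
  Real.exp ((U i ω + W i t ω - variance (W 0 t) P / 2) / α)

/-- The centering constants `b_i^{(α)}`, `i ≥ 1`. For `i = 1` the upper limit `1/(i-1)` of the
integral is `∞`. -/
def centering (α : ℝ) (i : ℕ) : ℝ :=
  if α < 1 then 0
  else if α = 1 then
    if i = 1 then ∫ x in Set.Ioi (1 : ℝ), Real.sin x / x ^ 2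
    else ∫ x in (1 / (i : ℝ))..(1 / ((i : ℝ) - 1)), Real.sin x / x ^ 2
  else α / (α - 1) * ((i : ℝ) ^ ((α - 1) / α) - ((i : ℝ) - 1) ^ ((α - 1) / α))

/-- `∑_{i ≥ 1} (x_(i) - b_i) = s`, where `x_(1) ≥ x_(2) ≥ …` are all the terms of the family `x`
in decreasing order (with multiplicity). The decreasing rearrangement is unique, so `s` is. -/
def HasDecreasingCenteredSum (b : ℕ → ℝ) (x : ℕ → ℝ) (s : ℝ) : Prop :=
  ∃ τ : Equiv.Perm ℕ, Antitone (fun i => x (τ i)) ∧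
    Tendsto (fun n => ∑ i ∈ Finset.range n, (x (τ i) - b (i + 1))) atTop (𝓝 s)

/-- `S` is (a version of) the process given, for every `t`, almost surely by
`S(t) = ∑_i (exp((U_i + W_i(t) - σ²(t)/2)/α) - b_i^{(α)})`, the exponentials being enumerated in
decreasing order for the given `t`. -/
structure IsCenteredSeries {T Ω : Type*} [MeasurableSpace Ω] (α : ℝ) (U : ℕ → Ω → ℝ)
    (W : ℕ → T → Ω → ℝ) (P : Measure Ω) (S : T → Ω → ℝ) : Prop where
  measurable : ∀ t, Measurable (S t)
  hasSum : ∀ t, ∀ᵐ ω ∂P, HasDecreasingCenteredSum (centering α) (seriesTerm α U W P t ω) (S t ω)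

/-- A probability law `Q` on `ℝ^ι` is `α`-stable: if `X`, `X'` are independent with law `Q` and
`A, B > 0`, then `A X + B X'` has the law of `(A^α + B^α)^{1/α} X + D` for some vector `D`. -/
def IsStableLaw {ι : Type*} [Fintype ι] (α : ℝ) (Q : Measure (ι → ℝ)) : Prop :=
  IsProbabilityMeasure Q ∧
    ∀ A B : ℝ, 0 < A → 0 < B → ∃ D : ι → ℝ,
      (Q.prod Q).map (fun p => A • p.1 + B • p.2) =
        Q.map (fun x => ((A ^ α + B ^ α) ^ (1 / α) : ℝ) • x + D)

/-- A process is `α`-stable if all its finite-dimensional distributions are. -/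
def IsStableProcess {T Ω : Type*} [MeasurableSpace Ω] (α : ℝ) (S : T → Ω → ℝ)
    (P : Measure Ω) : Prop :=
  ∀ I : Finset T, IsStableLaw α (P.map (fun ω (t : I) => S t ω))

/-- The characteristic function of the one-dimensional stable law `S_α(σ, β, μ)` with index `α`,
scale `σ`, skewness `β` and shift `μ`. -/
def stableCharFun (α σ β μ θ : ℝ) : ℂ :=
  if α = 1 then
    Complex.exp (-((σ * |θ| : ℝ) : ℂ) *
        (1 + Complex.I * ((β * (2 / Real.pi) * Real.sign θ * Real.log |θ| : ℝ) : ℂ))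
      + Complex.I * ((μ * θ : ℝ) : ℂ))
  else
    Complex.exp (-((σ ^ α * |θ| ^ α : ℝ) : ℂ) *
        (1 - Complex.I * ((β * Real.sign θ * Real.tan (Real.pi * α / 2) : ℝ) : ℂ))
      + Complex.I * ((μ * θ : ℝ) : ℂ))

/-- The process is totally skewed to the right: every linear combination of its values with
nonnegative, not all vanishing coefficients (in particular every `S(t)`) has a law
`S_α(σ, β, μ)` with `σ > 0` and skewness `β = 1`. -/
def IsTotallySkewedRight {T Ω : Type*} [MeasurableSpace Ω] (α : ℝ) (S : T → Ω → ℝ)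
    (P : Measure Ω) : Prop :=
  ∀ (I : Finset T) (a : T → ℝ), (∀ t ∈ I, 0 ≤ a t) → (∃ t ∈ I, 0 < a t) →
    ∃ σ μ : ℝ, 0 < σ ∧ ∀ θ : ℝ,
      charFun (P.map (fun ω => ∑ t ∈ I, a t * S t ω)) θ = stableCharFun α σ 1 μ θ

end

open scoped ENNReal NNReal


/-! ### Poisson point processes: Campbell's formula and the probability generating functional -/

section PoissonPointProcess

variable {Ω : Type*} [MeasurableSpace Ω] {U : ℕ → Ω → ℝ} {ν : Measure ℝ} {P : Measure Ω}

/-! The pairs (U_i, W_i) form a Poisson process with intensity e^{-u} du times the law of W. Because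
exp(W(t) - σ²(t)/2) has mean one, the locations 𝒰_i(t) at a fixed t again have intensity e^{-u} du
(`map_logPoint`), so the number of z_i = exp(-𝒰_i(t)) below n is Poisson with mean n (`map_count`).
Chernoff's bound and Borel–Cantelli keep this number within n^b of n for large n, where 1/2 < b <
min(1, 1/α); such b exists because α < 2. A deterministic argument,
`hasDecreasingCenteredSum_iff_tendsto_truncatedSum`, then shows that the ordered centered series
converges and equals the limit of the sums over z_i < n minus the first n constants. Truncation at a
level involves no ordering, and the constants are exactly its compensators
(`centering_eq_integral`).

The characteristic functional of a marked Poisson process (`integral_exp_tsum_marks`) and dominated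
convergence now give `integral_exp_centeredSeries`: the finite-dimensional laws have as
Lévy–Khintchine exponent the integral of `levyIntegrand` against the intensity of the joint
locations, `logIntensity`. The remaining claims about the law are properties of this intensity.

Dependence on Γ only: taking the location at one site as the new u tilts the mark law and splits the
intensity into e^{-u} du times a law of increments (`logIntensity_eq_map_prod`). The exponential
moments of that law have exponents -∑∑ c_s c_t Γ(s,t)/4 with ∑ c = 1, so the variances σ² drop out
(`tiltedIncrementLaw_eq`).

Stability: shifting all locations by α log r multiplies the summands by r and the intensity by r^α;
only the compensator is not homogeneous, and its defect is a drift (`integral_levyIntegrand_smul`).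

Skewness: a nonnegative combination of the summands of one point is again of the form e^{y/α}, with
y of intensity m e^{-u} du. Its exponent is m `laplaceExponent α (-iθ)` plus a drift, and the
Laplace exponent is computed by scaling on the positive half-line and continued analytically up to
the imaginary axis.

Existence: independent Poisson(1) numbers of points in cells of intensity one give U, and an
isometry from the Hilbert space into a Gaussian L² space gives W. -/

theorem toENNReal_pointCount {Ω : Type*} (U : ℕ → Ω → ℝ) (B : Set ℝ) (ω : Ω) :
    ((pointCount U B ω : ℕ∞) : ℝ≥0∞) = ∑' i, B.indicator (fun _ => (1 : ℝ≥0∞)) (U i ω) := by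
  have h : ∀ i, B.indicator (fun _ => (1 : ℝ≥0∞)) (U i ω)
      = Set.indicator {i : ℕ | U i ω ∈ B} (fun _ => (1 : ℝ≥0∞)) i := fun i => rfl
  simp_rw [h]
  rw [← tsum_subtype, ENNReal.tsum_set_one]
  rfl

theorem measurable_pointCount (hU : ∀ i, Measurable (U i)) {B : Set ℝ} (hB : MeasurableSet B) :
    Measurable (pointCount U B) := by
  have h : Measurable (fun ω => ((pointCount U B ω : ℕ∞) : ℝ≥0∞)) := by
    simp_rw [toENNReal_pointCount]
    exact Measurable.tsum fun i => (measurable_const.indicator hB).comp (hU i)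
  refine measurable_to_countable' fun k => ?_
  have : pointCount U B ⁻¹' {k} = (fun ω => ((pointCount U B ω : ℕ∞) : ℝ≥0∞)) ⁻¹' {(k : ℝ≥0∞)} := by
    ext ω
    simp
  rw [this]
  exact h (measurableSet_singleton _)

/-- Total mass one determines the atom at `⊤` from the finite ones. This is needed because
`law_count` speaks of finite values only. -/
theorem measure_eq_of_natCast_singleton {μ μ' : Measure ℕ∞} [IsProbabilityMeasure μ]
    [IsProbabilityMeasure μ'] (h : ∀ k : ℕ, μ {(k : ℕ∞)} = μ' {(k : ℕ∞)}) : μ = μ' := by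
  have htop : ∀ ρ : Measure ℕ∞, IsProbabilityMeasure ρ →
      ρ {⊤} = 1 - ∑' k : ℕ, ρ {(k : ℕ∞)} := by
    intro ρ _
    have h1 : ({⊤} : Set ℕ∞) = (Set.range ((↑) : ℕ → ℕ∞))ᶜ := by
      ext x
      induction x using ENat.recTopCoe <;> simp
    rw [h1, prob_compl_eq_one_sub (Set.to_countable _).measurableSet, ← Set.iUnion_singleton_eq_range,
      measure_iUnion _ (fun _ => measurableSet_singleton _)]
    intro i j hij
    simpa using hij
  refine Measure.ext_of_singleton fun x => ?_
  induction x using ENat.recTopCoe with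
  | top => rw [htop μ inferInstance, htop μ' inferInstance]; simp_rw [h]
  | coe k => exact h k

theorem lintegral_natCast_poissonMeasure (r : ℝ≥0) :
    ∫⁻ k, (k : ℝ≥0∞) ∂poissonMeasure r = r := by
  have hs : HasSum (fun k : ℕ => Real.exp (-r) * r ^ k / k.factorial * k) (r : ℝ) := by
    rw [← hasSum_nat_add_iff' 1]
    have := (hasSum_one_poissonMeasure r).mul_left (r : ℝ)
    simp only [Finset.range_one, Finset.sum_singleton, Nat.cast_zero, mul_zero, sub_zero]
    convert! this using 1
    · funext k
      rw [Nat.factorial_succ]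
      have : (k.factorial : ℝ) ≠ 0 := by positivity
      have : ((k : ℝ) + 1) ≠ 0 := by positivity
      push_cast
      field_simp
      ring
    · simp
  rw [poissonMeasure, lintegral_sum_measure]
  simp only [lintegral_smul_measure, lintegral_dirac, smul_eq_mul]
  have : ∀ k : ℕ, ENNReal.ofReal (Real.exp (-r) * r ^ k / k.factorial) * (k : ℝ≥0∞)
      = ENNReal.ofReal (Real.exp (-r) * r ^ k / k.factorial * k) := fun k => by
    rw [ENNReal.ofReal_mul (by positivity), ENNReal.ofReal_natCast]
  simp_rw [this]
  rw [← ENNReal.ofReal_tsum_of_nonneg (fun k => by positivity) hs.summable, hs.tsum_eq]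
  simp

theorem integral_pow_poissonMeasure (r : ℝ≥0) (c : ℂ) :
    ∫ k, c ^ k ∂poissonMeasure r = Complex.exp (r * (c - 1)) := by
  rw [integral_poissonMeasure]
  have h := (NormedSpace.expSeries_div_hasSum_exp ((r : ℂ) * c)).mul_left (Complex.exp (-r))
  rw [← Complex.exp_eq_exp_ℂ, ← Complex.exp_add] at h
  rw [show (r : ℂ) * (c - 1) = -r + r * c by ring, ← h.tsum_eq]
  congr with k
  rw [Complex.real_smul]
  push_cast
  rw [mul_pow]
  ring

namespace IsPoissonPointProcess

variable [IsProbabilityMeasure P]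

theorem map_pointCount (h : IsPoissonPointProcess U ν P) {B : Set ℝ} (hB : MeasurableSet B)
    (hν : ν B ≠ ⊤) :
    P.map (pointCount U B) = (poissonMeasure (ν B).toNNReal).map ((↑) : ℕ → ℕ∞) := by
  have hm := measurable_pointCount h.measurable hB
  have := Measure.isProbabilityMeasure_map (μ := P) hm.aemeasurable
  have := Measure.isProbabilityMeasure_map (μ := poissonMeasure (ν B).toNNReal)
    (f := ((↑) : ℕ → ℕ∞)) (by fun_prop)
  refine measure_eq_of_natCast_singleton fun k => ?_
  rw [Measure.map_apply hm (measurableSet_singleton _),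
    Measure.map_apply .of_discrete (measurableSet_singleton _)]
  have h2 : ((↑) : ℕ → ℕ∞) ⁻¹' {(k : ℕ∞)} = {k} := by ext; simp
  rw [h2, ← h.law_count B hB hν k]
  rfl

theorem ae_pointCount_ne_top (h : IsPoissonPointProcess U ν P) {B : Set ℝ} (hB : MeasurableSet B)
    (hν : ν B ≠ ⊤) : ∀ᵐ ω ∂P, pointCount U B ω ≠ ⊤ := by
  have hm := measurable_pointCount h.measurable hB
  have h2 : ∀ᵐ x ∂(P.map (pointCount U B)), x ≠ ⊤ := by
    rw [h.map_pointCount hB hν, ae_map_iff .of_discrete .of_discrete]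
    simp
  exact ae_of_ae_map hm.aemeasurable h2

/-- Two evaluations of the mean number of points in `B`: as the mean of a Poisson variable, and term
by term. -/
theorem sum_measure_preimage (h : IsPoissonPointProcess U ν P) {B : Set ℝ} (hB : MeasurableSet B)
    (hν : ν B ≠ ⊤) : ∑' i, P (U i ⁻¹' B) = ν B := by
  have hm := measurable_pointCount h.measurable hB
  have h1 : ∫⁻ ω, ((pointCount U B ω : ℕ∞) : ℝ≥0∞) ∂P = ν B := by
    rw [← lintegral_map (f := fun x : ℕ∞ => (x : ℝ≥0∞)) .of_discrete hm, h.map_pointCount hB hν,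
      lintegral_map .of_discrete .of_discrete]
    simp only [ENat.toENNReal_coe]
    rw [lintegral_natCast_poissonMeasure, ENNReal.coe_toNNReal hν]
  rw [← h1]
  simp_rw [toENNReal_pointCount]
  have hmi : ∀ i, Measurable (fun ω => B.indicator (fun _ => (1 : ℝ≥0∞)) (U i ω)) := fun i =>
    (measurable_const.indicator hB).comp (h.measurable i)
  rw [lintegral_tsum fun i => (hmi i).aemeasurable]
  congr with i
  rw [← lintegral_map (f := B.indicator (fun _ => (1 : ℝ≥0∞))) (measurable_const.indicator hB)
    (h.measurable i), lintegral_indicator_const hB, one_mul, Measure.map_apply (h.measurable i) hB]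

/-- Campbell's formula. -/
theorem sum_map [SigmaFinite ν] (h : IsPoissonPointProcess U ν P) :
    Measure.sum (fun i => P.map (U i)) = ν := by
  have key : ∀ B, MeasurableSet B → ν B ≠ ⊤ → Measure.sum (fun i => P.map (U i)) B = ν B := by
    intro B hB hν
    rw [Measure.sum_apply _ hB, ← h.sum_measure_preimage hB hν]
    congr with i
    rw [Measure.map_apply (h.measurable i) hB]
  ext B hB
  -- The counts are only described on sets of finite measure, so a general set is exhausted by such
  -- sets.
  have hS : ∀ ρ : Measure ℝ, ρ B = ⨆ n, ρ (B ∩ spanningSets ν n) := fun ρ => by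
    rw [← (monotone_const.inter (monotone_spanningSets ν)).measure_iUnion,
      ← Set.inter_iUnion, iUnion_spanningSets, Set.inter_univ]
  rw [hS, hS ν]
  congr with n
  exact key _ (hB.inter (measurableSet_spanningSets ν n))
    ((measure_mono Set.inter_subset_right).trans_lt (measure_spanningSets_lt_top ν n)).ne

theorem integral_pow_pointCount (h : IsPoissonPointProcess U ν P) {B : Set ℝ}
    (hB : MeasurableSet B) (hν : ν B ≠ ⊤) (c : ℂ) :
    ∫ ω, c ^ (pointCount U B ω).toNat ∂P = Complex.exp (ν.real B * (c - 1)) := by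
  have hm := measurable_pointCount h.measurable hB
  rw [← integral_map (f := fun x : ℕ∞ => c ^ x.toNat) hm.aemeasurable .of_discrete,
    h.map_pointCount hB hν, integral_map .of_discrete .of_discrete]
  simp only [ENat.toNat_natCast]
  rw [integral_pow_poissonMeasure]
  rfl

/-- Grouping the factors by the nonzero value c of `f` gives powers of 1 + c with the numbers of
points in the level sets as exponents. Integrability makes these level sets of finite measure, so
the exponents are independent Poisson variables, and almost surely the partial products are
eventually constant. -/
theorem tendsto_integral_prod_simpleFunc (h : IsPoissonPointProcess U ν P)
    (f : SimpleFunc ℝ ℂ) (hf : Integrable f ν) (hf1 : ∀ x, ‖1 + f x‖ ≤ 1) :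
    Tendsto (fun n => ∫ ω, ∏ i ∈ Finset.range n, (1 + f (U i ω)) ∂P) atTop
      (𝓝 (Complex.exp (∫ x, f x ∂ν))) := by
  classical
  set s : Finset ℂ := f.range.filter (· ≠ 0) with hs
  have hsB : ∀ c ∈ s, ν (f ⁻¹' {c}) ≠ ⊤ := fun c hc =>
    (SimpleFunc.integrable_iff.mp hf c (Finset.mem_filter.mp hc).2).ne
  have hmB : ∀ c : ℂ, MeasurableSet (f ⁻¹' {c}) := fun c => f.measurableSet_preimage _
  have hlim : Complex.exp (∫ x, f x ∂ν)
      = ∫ ω, ∏ c ∈ s, (1 + c) ^ (pointCount U (f ⁻¹' {c}) ω).toNat ∂P := by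
    have hind : iIndepFun (fun c : s => pointCount U (f ⁻¹' {(c : ℂ)})) P := by
      have h0 := h.indep_count s.card (fun j => f ⁻¹' {((s.equivFin.symm j : s) : ℂ)})
        (fun j => hmB _) (by
          intro i j hij
          refine Disjoint.preimage _ ?_
          simpa [Set.disjoint_singleton, Subtype.ext_iff] using hij)
      have := h0.precomp s.equivFin.injective
      simpa using this
    have hprod := hind.integral_fun_prod_comp (f := fun (c : s) (x : ℕ∞) => (1 + (c : ℂ)) ^ x.toNat)
      (fun c => (measurable_pointCount h.measurable (hmB _)).aemeasurable)
      (fun c => .of_discrete)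
    have h3 : ∀ ω, ∏ c ∈ s, (1 + c) ^ (pointCount U (f ⁻¹' {c}) ω).toNat
      = ∏ c : s, (1 + (c : ℂ)) ^ (pointCount U (f ⁻¹' {(c : ℂ)}) ω).toNat := fun ω =>
        (Finset.prod_coe_sort s
          (fun c => (1 + c) ^ (pointCount U (f ⁻¹' {c}) ω).toNat)).symm
    simp_rw [h3]
    rw [hprod]
    simp_rw [fun c : s => h.integral_pow_pointCount (hmB c) (hsB c c.2) (1 + (c : ℂ))]
    rw [← Complex.exp_sum, ← SimpleFunc.integral_eq_integral f hf,
      SimpleFunc.integral_eq_sum_of_subset (s := s) hs.ge]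
    congr 1
    rw [← Finset.sum_coe_sort s (fun x => ν.real (f ⁻¹' {x}) • x)]
    refine Finset.sum_congr rfl fun c _ => ?_
    simp
  rw [hlim]
  refine tendsto_integral_of_dominated_convergence (fun _ => 1) ?_ (by simp) ?_ ?_
  · intro n
    refine Measurable.aestronglyMeasurable ?_
    refine Finset.measurable_prod _ fun i _ => ?_
    exact measurable_const.add (f.measurable.comp (h.measurable i))
  · intro n
    refine ae_of_all _ fun ω => ?_
    rw [norm_prod]
    exact Finset.prod_le_one (fun _ _ => norm_nonneg _) fun _ _ => hf1 _
  · have hfin : ∀ᵐ ω ∂P, ∀ c ∈ s, pointCount U (f ⁻¹' {c}) ω ≠ ⊤ := by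
      rw [Finset.eventually_all]
      exact fun c hc => h.ae_pointCount_ne_top (hmB c) (hsB c hc)
    filter_upwards [hfin] with ω hω
    have hp : ∀ n, ∏ i ∈ Finset.range n, (1 + f (U i ω))
        = ∏ c ∈ s, (1 + c) ^ ((Finset.range n).filter (fun i => f (U i ω) = c)).card := by
      intro n
      have h1 : ∀ i, 1 + f (U i ω) = ∏ c ∈ s, if f (U i ω) = c then 1 + c else 1 := by
        intro i
        rw [Finset.prod_ite_eq]
        split_ifs with hi
        · rfl
        · have : f (U i ω) = 0 := by
            by_contra hne
            exact hi (Finset.mem_filter.mpr ⟨f.mem_range_self _, hne⟩)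
          simp [this]
      simp_rw [h1]
      rw [Finset.prod_comm]
      refine Finset.prod_congr rfl fun c _ => ?_
      rw [Finset.prod_ite, Finset.prod_const, Finset.prod_const_one, mul_one]
    simp_rw [hp]
    refine tendsto_finsetProd _ fun c hc => ?_
    refine tendsto_const_nhds.congr' ?_
    have hF : {i : ℕ | U i ω ∈ f ⁻¹' {c}}.Finite := by
      rw [← Set.encard_ne_top_iff]
      exact hω c hc
    obtain ⟨M, hM⟩ := hF.bddAbove
    filter_upwards [eventually_gt_atTop M] with n hn
    congr 1
    have : {i : ℕ | U i ω ∈ f ⁻¹' {c}}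
        = (((Finset.range n).filter (fun i => f (U i ω) = c) : Finset ℕ) : Set ℕ) := by
      ext i
      simp only [Set.mem_preimage, Set.mem_singleton_iff, Set.mem_ofPred_eq, Finset.coe_filter,
        Finset.mem_range]
      exact ⟨fun hi => ⟨(hM hi).trans_lt hn, hi⟩, fun hi => hi.2⟩
    rw [pointCount, this, Set.encard_coe_eq_coe_finsetCard, ENat.toNat_natCast]

/-- Exchange one factor at a time; all the others have modulus at most one. The bound makes
approximation by simple functions uniform in the number of factors. -/
theorem norm_prod_sub_prod_le {ι : Type*} (s : Finset ι) (a b : ι → ℂ) (ha : ∀ i, ‖a i‖ ≤ 1)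
    (hb : ∀ i, ‖b i‖ ≤ 1) : ‖∏ i ∈ s, a i - ∏ i ∈ s, b i‖ ≤ ∑ i ∈ s, ‖a i - b i‖ := by
  classical
  induction s using Finset.induction_on with
  | empty => simp
  | insert i s hi ih =>
    rw [Finset.prod_insert hi, Finset.prod_insert hi, Finset.sum_insert hi]
    have h1 : a i * ∏ i ∈ s, a i - b i * ∏ i ∈ s, b i
      = (a i - b i) * ∏ i ∈ s, a i + b i * (∏ i ∈ s, a i - ∏ i ∈ s, b i) := by ring
    have h2 : ‖∏ i ∈ s, a i‖ ≤ 1 := by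
      rw [norm_prod]
      exact Finset.prod_le_one (fun _ _ => norm_nonneg _) fun _ _ => ha _
    rw [h1]
    refine (norm_add_le _ _).trans ?_
    rw [norm_mul, norm_mul]
    refine add_le_add (mul_le_of_le_one_right (norm_nonneg _) h2) ?_
    exact (mul_le_of_le_one_left (norm_nonneg _) (hb i)).trans ih

/-- The probability generating functional of a Poisson point process. -/
theorem tendsto_integral_prod [SigmaFinite ν] (h : IsPoissonPointProcess U ν P)
    {φ : ℝ → ℂ} (hφ : Measurable φ) (hφ1 : ∀ x, ‖φ x‖ ≤ 1)
    (hint : Integrable (fun x => φ x - 1) ν) :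
    Tendsto (fun n => ∫ ω, ∏ i ∈ Finset.range n, φ (U i ω) ∂P) atTop
      (𝓝 (Complex.exp (∫ x, (φ x - 1) ∂ν))) := by
  -- Approximating within this disc keeps every factor 1 + F k of modulus at most one.
  set s : Set ℂ := {z | ‖1 + z‖ ≤ 1} with hs
  have h0 : (0 : ℂ) ∈ s := by simp [hs]
  have hg : Measurable (fun x => φ x - 1) := hφ.sub_const 1
  set F := fun k => SimpleFunc.approxOn (fun x => φ x - 1) hg s 0 h0 k with hF
  have hFs : ∀ k x, ‖1 + F k x‖ ≤ 1 := fun k x => SimpleFunc.approxOn_mem hg h0 k x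
  have hFi : ∀ k, Integrable (F k) ν := fun k =>
    SimpleFunc.integrable_approxOn hg hint h0 (integrable_zero _ _ _) k
  have hFt : Tendsto (fun k => ∫⁻ x, ‖F k x - (φ x - 1)‖ₑ ∂ν) atTop (𝓝 0) := by
    refine SimpleFunc.tendsto_approxOn_L1_enorm hg h0 (ae_of_all _ fun x => subset_closure ?_) ?_
    · simpa [hs] using hφ1 x
    · simpa using hint.2
  -- The error is independent of `n`: by Campbell's formula the sum of all single-factor errors is
  -- the L¹ distance with respect to `ν`. This uniformity allows the limits in `k` and `n` to be
  -- exchanged.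
  have hbound : ∀ k n, ‖∫ ω, ∏ i ∈ Finset.range n, φ (U i ω) ∂P
      - ∫ ω, ∏ i ∈ Finset.range n, (1 + F k (U i ω)) ∂P‖
      ≤ (∫⁻ x, ‖F k x - (φ x - 1)‖ₑ ∂ν).toReal := by
    intro k n
    have hFU : ∀ i, Measurable (fun ω => F k (U i ω)) := fun i =>
      (F k).measurable.comp (h.measurable i)
    have hφU : ∀ i, Measurable (fun ω => φ (U i ω)) := fun i => hφ.comp (h.measurable i)
    have hi1 : Integrable (fun ω => ∏ i ∈ Finset.range n, φ (U i ω)) P := by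
      refine Integrable.of_bound (C := 1) (Finset.measurable_prod _ fun i _ =>
        hφU i).aestronglyMeasurable (ae_of_all _ fun ω => ?_)
      rw [norm_prod]
      exact Finset.prod_le_one (fun _ _ => norm_nonneg _) fun _ _ => hφ1 _
    have hi2 : Integrable (fun ω => ∏ i ∈ Finset.range n, (1 + F k (U i ω))) P := by
      refine Integrable.of_bound (C := 1) (Finset.measurable_prod _ fun i _ =>
        (hFU i).const_add 1).aestronglyMeasurable (ae_of_all _ fun ω => ?_)
      rw [norm_prod]
      exact Finset.prod_le_one (fun _ _ => norm_nonneg _) fun _ _ => hFs _ _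
    rw [← integral_sub hi1 hi2]
    have hfin : ∫⁻ x, ‖F k x - (φ x - 1)‖ₑ ∂ν ≠ ⊤ := ((hFi k).sub hint).2.ne
    rw [← ENNReal.ofReal_le_iff_le_toReal hfin, ofReal_norm]
    refine (enorm_integral_le_lintegral_enorm _).trans ?_
    calc ∫⁻ ω, ‖∏ i ∈ Finset.range n, φ (U i ω) - ∏ i ∈ Finset.range n, (1 + F k (U i ω))‖ₑ ∂P
        ≤ ∫⁻ ω, ∑ i ∈ Finset.range n, ‖F k (U i ω) - (φ (U i ω) - 1)‖ₑ ∂P := by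
          refine lintegral_mono fun ω => ?_
          have := norm_prod_sub_prod_le (Finset.range n) (fun i => φ (U i ω))
            (fun i => 1 + F k (U i ω)) (fun i => hφ1 _) (fun i => hFs _ _)
          rw [← ofReal_norm]
          refine (ENNReal.ofReal_le_ofReal this).trans ?_
          rw [ENNReal.ofReal_sum_of_nonneg fun _ _ => norm_nonneg _]
          refine Finset.sum_le_sum fun i _ => ?_
          rw [ofReal_norm, ← enorm_neg]
          apply le_of_eq
          congr 1
          ring
      _ = ∑ i ∈ Finset.range n, ∫⁻ ω, ‖F k (U i ω) - (φ (U i ω) - 1)‖ₑ ∂P :=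
          lintegral_finsetSum _ fun i _ => ((hFU i).sub ((hφU i).sub_const 1)).enorm
      _ ≤ ∑' i, ∫⁻ ω, ‖F k (U i ω) - (φ (U i ω) - 1)‖ₑ ∂P := ENNReal.sum_le_tsum _
      _ = ∑' i, ∫⁻ x, ‖F k x - (φ x - 1)‖ₑ ∂(P.map (U i)) := by
          congr with i
          rw [lintegral_map (f := fun x => ‖F k x - (φ x - 1)‖ₑ) ((F k).measurable.sub hg).enorm
            (h.measurable i)]
      _ = ∫⁻ x, ‖F k x - (φ x - 1)‖ₑ ∂ν := by
          rw [← lintegral_sum_measure, h.sum_map]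
  have hlim : Tendsto (fun k => Complex.exp (∫ x, F k x ∂ν)) atTop
      (𝓝 (Complex.exp (∫ x, (φ x - 1) ∂ν))) :=
    (Complex.continuous_exp.tendsto _).comp
      (tendsto_integral_of_L1 _ hint.1 (Eventually.of_forall hFi) hFt)
  have hunif : TendstoUniformlyOnFilter
      (fun k n => ∫ ω, ∏ i ∈ Finset.range n, (1 + F k (U i ω)) ∂P)
      (fun n => ∫ ω, ∏ i ∈ Finset.range n, φ (U i ω) ∂P) atTop atTop := by
    rw [Metric.tendstoUniformlyOnFilter_iff]
    intro ε hε
    have h2 : Tendsto (fun k => (∫⁻ x, ‖F k x - (φ x - 1)‖ₑ ∂ν).toReal) atTop (𝓝 0) := by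
      exact (ENNReal.tendsto_toReal ENNReal.zero_ne_top).comp hFt
    have h3 := h2.eventually (gt_mem_nhds hε)
    refine (h3.prod_inl atTop).mono fun p hp => ?_
    rw [dist_eq_norm]
    exact (hbound _ _).trans_lt hp
  exact hunif.tendsto_of_eventually_tendsto
    (Eventually.of_forall fun k => h.tendsto_integral_prod_simpleFunc (F k) (hFi k) (hFs k)) hlim

end IsPoissonPointProcess

end PoissonPointProcess

/-! ### Independent marks: Campbell's formula and the characteristic functional -/

section MarkedPoissonProcess

variable {Ω E : Type*} [MeasurableSpace Ω] [MeasurableSpace E] {P : Measure Ω}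
  [IsProbabilityMeasure P] {U : ℕ → Ω → ℝ} {V : ℕ → Ω → E} {ν : Measure ℝ}

theorem map_prodMk_eq_prod_of_marks (hU : ∀ i, Measurable (U i)) (hV : ∀ i, Measurable (V i))
    (hid : ∀ i, P.map (V i) = P.map (V 0))
    (hUV : IndepFun (fun ω i => U i ω) (fun ω i => V i ω) P) (i : ℕ) :
    P.map (fun ω => (U i ω, V i ω)) = (P.map (U i)).prod (P.map (V 0)) := by
  have h := hUV.comp (measurable_pi_apply i) (measurable_pi_apply (X := fun _ : ℕ => E) i)
  rw [← hid i]
  exact (indepFun_iff_map_prod_eq_prod_map_map (hU i).aemeasurable (hV i).aemeasurable).mp h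

namespace IsPoissonPointProcess

/-- Campbell's formula for an independently marked Poisson point process. -/
theorem sum_map_marks [SigmaFinite ν] (h : IsPoissonPointProcess U ν P)
    (hV : ∀ i, Measurable (V i)) (hid : ∀ i, P.map (V i) = P.map (V 0))
    (hUV : IndepFun (fun ω i => U i ω) (fun ω i => V i ω) P) :
    Measure.sum (fun i => P.map (fun ω => (U i ω, V i ω))) = ν.prod (P.map (V 0)) := by
  have := Measure.isProbabilityMeasure_map (μ := P) (hV 0).aemeasurable
  simp_rw [map_prodMk_eq_prod_of_marks h.measurable hV hid hUV]
  rw [← Measure.prod_sum_left, h.sum_map]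

theorem ae_finite_marks [SigmaFinite ν] (h : IsPoissonPointProcess U ν P)
    (hV : ∀ i, Measurable (V i)) (hid : ∀ i, P.map (V i) = P.map (V 0))
    (hUV : IndepFun (fun ω i => U i ω) (fun ω i => V i ω) P) {A : Set (ℝ × E)}
    (hA : MeasurableSet A) (hfin : (ν.prod (P.map (V 0))) A ≠ ⊤) :
    ∀ᵐ ω ∂P, {i | (U i ω, V i ω) ∈ A}.Finite := by
  refine ae_finite_setOfPred_mem (s := fun i => {ω | (U i ω, V i ω) ∈ A}) ?_
  rw [← h.sum_map_marks hV hid hUV, Measure.sum_apply _ hA] at hfin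
  simpa only [Measure.map_apply ((h.measurable _).prodMk (hV _)) hA] using! hfin

/-- Conditionally on the points the marks are independent with a common law, so each factor may be
averaged over its mark. This reduces the marked process to the unmarked one. -/
theorem integral_prod_marks (hU : ∀ i, Measurable (U i))
    (hV : ∀ i, Measurable (V i)) (hid : ∀ i, P.map (V i) = P.map (V 0)) (hVV : iIndepFun V P)
    (hUV : IndepFun (fun ω i => U i ω) (fun ω i => V i ω) P) {K : ℝ × E → ℂ} (hK : Measurable K)
    (hK1 : ∀ x, ‖K x‖ ≤ 1) (n : ℕ) :
    ∫ ω, ∏ i ∈ Finset.range n, K (U i ω, V i ω) ∂P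
      = ∫ ω, ∏ i ∈ Finset.range n, (∫ v, K (U i ω, v) ∂(P.map (V 0))) ∂P := by
  have hmU : Measurable (fun ω i => U i ω) := measurable_pi_lambda _ hU
  have hmV : Measurable (fun ω i => V i ω) := measurable_pi_lambda _ hV
  have hj := (indepFun_iff_map_prod_eq_prod_map_map hmU.aemeasurable hmV.aemeasurable).mp hUV
  have := Measure.isProbabilityMeasure_map (μ := P) hmU.aemeasurable
  have := Measure.isProbabilityMeasure_map (μ := P) hmV.aemeasurable
  have := Measure.isProbabilityMeasure_map (μ := P) (hV 0).aemeasurable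
  set F : (ℕ → ℝ) × (ℕ → E) → ℂ := fun p => ∏ i ∈ Finset.range n, K (p.1 i, p.2 i) with hF
  have hFm : Measurable F := Finset.measurable_prod _ fun i _ => hK.comp (by fun_prop)
  have hFi : Integrable F ((P.map fun ω i => U i ω).prod (P.map fun ω i => V i ω)) := by
    refine Integrable.of_bound (C := 1) hFm.aestronglyMeasurable (ae_of_all _ fun p => ?_)
    rw [hF, norm_prod]
    exact Finset.prod_le_one (fun _ _ => norm_nonneg _) fun _ _ => hK1 _
  have h1 : ∫ ω, ∏ i ∈ Finset.range n, K (U i ω, V i ω) ∂P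
      = ∫ p, F p ∂((P.map fun ω i => U i ω).prod (P.map fun ω i => V i ω)) := by
    rw [← hj, integral_map (hmU.prodMk hmV).aemeasurable hFm.aestronglyMeasurable]
  have h2 : ∀ u : ℕ → ℝ, ∫ v, F (u, v) ∂(P.map fun ω i => V i ω)
      = ∏ i ∈ Finset.range n, ∫ v, K (u i, v) ∂(P.map (V 0)) := by
    intro u
    rw [integral_map (f := fun v => F (u, v)) hmV.aemeasurable
      (hFm.comp measurable_prodMk_left).aestronglyMeasurable]
    have h3 := iIndepFun.integral_fun_prod_comp (X := fun i : Fin n => V i)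
      (f := fun (i : Fin n) v => K (u i, v)) (hVV.precomp Fin.val_injective)
      (fun i => (hV i).aemeasurable)
      (fun i => (hK.comp measurable_prodMk_left).aestronglyMeasurable)
    simp only [hF]
    simp_rw [← Fin.prod_univ_eq_prod_range (fun i => K (u i, V i _)) n]
    rw [h3, ← Fin.prod_univ_eq_prod_range (fun i => ∫ v, K (u i, v) ∂(P.map (V 0))) n]
    refine Finset.prod_congr rfl fun i _ => ?_
    rw [← hid i, integral_map (f := fun v => K (u i, v)) (hV i).aemeasurable
      (hK.comp measurable_prodMk_left).aestronglyMeasurable]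
  rw [h1, integral_prod _ hFi]
  simp_rw [h2]
  rw [integral_map hmU.aemeasurable]
  refine (Finset.measurable_prod _ fun i _ => ?_).aestronglyMeasurable
  exact (StronglyMeasurable.integral_prod_right (f := fun u v => K (u, v)) hK.stronglyMeasurable
    (ν := P.map (V 0))).measurable.comp
    (measurable_pi_apply i)

theorem tendsto_integral_prod_marks [SigmaFinite ν] (h : IsPoissonPointProcess U ν P)
    (hV : ∀ i, Measurable (V i)) (hid : ∀ i, P.map (V i) = P.map (V 0)) (hVV : iIndepFun V P)
    (hUV : IndepFun (fun ω i => U i ω) (fun ω i => V i ω) P) {K : ℝ × E → ℂ} (hK : Measurable K)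
    (hK1 : ∀ x, ‖K x‖ ≤ 1) (hint : Integrable (fun x => K x - 1) (ν.prod (P.map (V 0)))) :
    Tendsto (fun n => ∫ ω, ∏ i ∈ Finset.range n, K (U i ω, V i ω) ∂P) atTop
      (𝓝 (Complex.exp (∫ x, (K x - 1) ∂(ν.prod (P.map (V 0)))))) := by
  have := Measure.isProbabilityMeasure_map (μ := P) (hV 0).aemeasurable
  simp_rw [integral_prod_marks h.measurable hV hid hVV hUV hK hK1]
  have hKi : ∀ u, Integrable (fun v => K (u, v)) (P.map (V 0)) := fun u =>
    Integrable.of_bound (C := 1) (hK.comp measurable_prodMk_left).aestronglyMeasurable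
      (ae_of_all _ fun v => hK1 _)
  have hsub : ∀ u, ∫ v, K (u, v) ∂(P.map (V 0)) - 1 = ∫ v, (K (u, v) - 1) ∂(P.map (V 0)) := by
    intro u
    rw [integral_sub (hKi u) (integrable_const _)]
    simp
  rw [integral_prod _ hint]
  simp_rw [← hsub]
  refine h.tendsto_integral_prod
    (StronglyMeasurable.integral_prod_right (f := fun u v => K (u, v)) hK.stronglyMeasurable
    (ν := P.map (V 0))).measurable (fun u => ?_) ?_
  · refine (norm_integral_le_of_norm_le_const (C := 1) (ae_of_all _ fun v => hK1 _)).trans ?_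
    simp
  · simp_rw [hsub]
    exact hint.integral_prod_left

/-- The characteristic functional of an independently marked Poisson point process. -/
theorem integral_exp_tsum_marks [SigmaFinite ν] (h : IsPoissonPointProcess U ν P)
    (hV : ∀ i, Measurable (V i)) (hid : ∀ i, P.map (V i) = P.map (V 0)) (hVV : iIndepFun V P)
    (hUV : IndepFun (fun ω i => U i ω) (fun ω i => V i ω) P) {G : ℝ × E → ℝ} (hG : Measurable G)
    (hfin : (ν.prod (P.map (V 0))) {x | G x ≠ 0} ≠ ⊤) :
    ∫ ω, Complex.exp ((∑' i, G (U i ω, V i ω) : ℝ) * Complex.I) ∂P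
      = Complex.exp (∫ x, (Complex.exp (G x * Complex.I) - 1) ∂(ν.prod (P.map (V 0)))) := by
  have hA : MeasurableSet {x | G x ≠ 0} := (hG (measurableSet_singleton 0)).compl
  have hKm : Measurable (fun x => Complex.exp (G x * Complex.I)) := by fun_prop
  have hint : Integrable (fun x => Complex.exp (G x * Complex.I) - 1) (ν.prod (P.map (V 0))) := by
    have h1 : IntegrableOn (fun x => Complex.exp (G x * Complex.I) - 1) {x | G x ≠ 0}
        (ν.prod (P.map (V 0))) := by
      refine IntegrableOn.of_bound (lt_top_iff_ne_top.mpr hfin)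
        (hKm.sub_const 1).aestronglyMeasurable 2 (ae_of_all _ fun x => ?_)
      refine (norm_sub_le _ _).trans ?_
      rw [Complex.norm_exp_ofReal_mul_I]
      norm_num
    refine h1.integrable_of_forall_notMem_eq_zero fun x hx => ?_
    have : G x = 0 := by simpa using hx
    simp [this]
  have hlim := h.tendsto_integral_prod_marks hV hid hVV hUV hKm
    (fun x => (Complex.norm_exp_ofReal_mul_I _).le) hint
  refine tendsto_nhds_unique ?_ hlim
  refine tendsto_integral_of_dominated_convergence (fun _ => 1) ?_ (by simp) ?_ ?_
  · exact fun n => (Finset.measurable_prod _ fun i _ => hKm.comp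
      ((h.measurable i).prodMk (hV i))).aestronglyMeasurable
  · intro n
    refine ae_of_all _ fun ω => ?_
    rw [norm_prod]
    exact Finset.prod_le_one (fun _ _ => norm_nonneg _)
      fun _ _ => (Complex.norm_exp_ofReal_mul_I _).le
  · filter_upwards [h.ae_finite_marks hV hid hUV hA hfin] with ω hω
    have hs : Summable (fun i => G (U i ω, V i ω)) := summable_of_hasFiniteSupport hω
    have h1 := hs.hasSum.tendsto_sum_nat
    have h2 : Continuous fun x : ℝ => Complex.exp (x * Complex.I) := by fun_prop
    have h3 := (h2.tendsto _).comp h1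
    refine h3.congr fun n => ?_
    simp only [Function.comp]
    rw [← Complex.exp_sum]
    push_cast
    rw [Finset.sum_mul]

end IsPoissonPointProcess

end MarkedPoissonProcess

/-! ### Ordered enumerations and the size of the centering constants -/

section DecreasingRearrangement

/-- Ordering the pairs (z i, i) lexicographically breaks ties by the index. Finite sublevel sets
make the image a locally finite linear order with a least and no greatest element, which is a copy
of ℕ. -/
theorem exists_perm_monotone {z : ℕ → ℝ} (hz : ∀ n : ℕ, {i | z i < n}.Finite) :
    ∃ τ : Equiv.Perm ℕ, Monotone (fun k => z (τ k)) := by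
  classical
  let e : ℕ → ℝ ×ₗ ℕ := fun i => toLex (z i, i)
  have he : Function.Injective e := fun i j hij => by
    have := congrArg (fun q => (ofLex q).2) hij
    simpa [e] using this
  have hle : ∀ i j, e j ≤ e i → z j ≤ z i := fun i j h => by
    rcases Prod.Lex.le_iff.mp h with h | h
    · exact h.le
    · exact h.1.le
  let A := Set.range e
  have hfinA : ∀ a : A, (Set.Iic a).Finite := by
    rintro ⟨_, i, rfl⟩
    obtain ⟨n, hn⟩ := exists_nat_gt (z i)
    refine Set.Finite.of_injOn (f := fun a : A => (ofLex a.1).2) (t := {j | z j < n}) ?_ ?_ (hz n)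
    · rintro ⟨_, j, rfl⟩ hj
      exact (hle i j hj).trans_lt hn
    · rintro ⟨_, j, rfl⟩ _ ⟨_, k, rfl⟩ _ hjk
      have : j = k := hjk
      exact Subtype.ext (congrArg e this)
  let _ : LocallyFiniteOrderBot A := LocallyFiniteOrderBot.ofIic A
    (fun a => (hfinA a).toFinset) (fun a x => by simp)
  have hinf : Infinite A := (Equiv.ofInjective e he).infinite_iff.mp inferInstance
  let _ : LocallyFiniteOrder A := LocallyFiniteOrder.ofFiniteIcc fun a b =>
    (hfinA b).subset fun x hx => hx.2
  have hne : Nonempty A := inferInstance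
  obtain ⟨a0⟩ := hne
  obtain ⟨b, hb⟩ := (hfinA a0).exists_minimal ⟨a0, Set.self_mem_Iic⟩
  have hbot : ∀ x : A, b ≤ x := fun x => by
    rcases le_total b x with h | h
    · exact h
    · exact hb.2 (show x ≤ a0 from h.trans hb.1) h
  let _ : OrderBot A := { bot := b, bot_le := hbot }
  have _ : NoMaxOrder A := ⟨fun a => by
    by_contra h
    push Not at h
    exact Set.infinite_univ ((hfinA a).subset fun x _ => h x)⟩
  let _ : SuccOrder A := LinearLocallyFiniteOrder.succOrder A
  let _ : PredOrder A := LinearLocallyFiniteOrder.predOrder A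
  let o : A ≃o ℕ := orderIsoNatOfLinearSuccPredArch
  refine ⟨o.toEquiv.symm.trans (Equiv.ofInjective e he).symm, fun k l hkl => ?_⟩
  refine hle _ _ ?_
  have h2 : ∀ k, e ((o.toEquiv.symm.trans (Equiv.ofInjective e he).symm) k) = (o.symm k : A) := by
    intro k
    exact congrArg Subtype.val ((Equiv.ofInjective e he).apply_symm_apply (o.symm k))
  rw [h2, h2]
  exact o.symm.monotone hkl

/-- By monotonicity the ranks whose value lies below `c` form an initial segment of ℕ, and its
length is the number of such values. This converts counts into bounds on ordered values. -/
theorem lt_ncard_iff_of_monotone {z : ℕ → ℝ} {c : ℝ} (hz : {i | z i < c}.Finite)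
    {τ : Equiv.Perm ℕ} (hτ : Monotone (fun k => z (τ k))) (k : ℕ) :
    k < {i | z i < c}.ncard ↔ z (τ k) < c := by
  set S : Set ℕ := {k | z (τ k) < c} with hS
  have hSc : S.ncard = {i | z i < c}.ncard := by
    have : {i | z i < c} = τ '' S := by
      ext i
      simp only [Set.mem_image, hS]
      exact ⟨fun h => ⟨τ.symm i, by simpa using h, by simp⟩, by rintro ⟨k, hk, rfl⟩; exact hk⟩
    rw [this, Set.ncard_image_of_injective _ τ.injective]
  have hSf : S.Finite := Set.Finite.preimage (f := τ) τ.injective.injOn hz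
  rw [← hSc]
  change k < S.ncard ↔ k ∈ S
  constructor
  · intro hk
    by_contra hkS
    have : S ⊆ Finset.range k := by
      intro j hj
      rw [Finset.coe_range, Set.mem_Iio]
      by_contra hjk
      exact hkS ((hτ (not_lt.mp hjk)).trans_lt hj)
    have := Set.ncard_le_ncard this (Finset.finite_toSet _)
    rw [Set.ncard_coe_finset, Finset.card_range] at this
    omega
  · intro hk
    have : ((Finset.range (k + 1) : Finset ℕ) : Set ℕ) ⊆ S := by
      intro j hj
      rw [Finset.coe_range, Set.mem_Iio] at hj
      exact (hτ (Nat.lt_succ_iff.mp hj)).trans_lt hk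
    have := Set.ncard_le_ncard this hSf
    rw [Set.ncard_coe_finset, Finset.card_range] at this
    omega

theorem abs_rpow_neg_sub_rpow_neg_le {p c a b : ℝ} (hp : 0 < p) (hc : 0 < c) (ha : c ≤ a)
    (hb : c ≤ b) : |a ^ (-p) - b ^ (-p)| ≤ p * c ^ (-p - 1) * |a - b| := by
  have h := Convex.norm_image_sub_le_of_norm_hasDerivWithin_le (f := fun x : ℝ => x ^ (-p))
    (f' := fun x => -p * x ^ (-p - 1)) (s := Set.Ici c) (C := p * c ^ (-p - 1)) (x := b) (y := a)
    (fun x hx => (Real.hasDerivAt_rpow_const (Or.inl (hc.trans_le hx).ne')).hasDerivWithinAt)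
    (fun x hx => ?_) (convex_Ici c) hb ha
  · simpa using h
  · have hx0 : 0 < x := hc.trans_le hx
    rw [norm_mul, norm_neg, Real.norm_of_nonneg hp.le,
      Real.norm_of_nonneg (Real.rpow_nonneg hx0.le _)]
    exact mul_le_mul_of_nonneg_left (Real.rpow_le_rpow_of_nonpos hc hx (by linarith)) hp.le

/-- The weight x^{-2} has total mass exactly one on [1/(k+1), 1/k], and the sine increases on [0,
1], so the constant is an average of the sine over this interval. -/
theorem centering_one_add_mem {k : ℕ} (hk : 1 ≤ k) :
    centering 1 (k + 1) ∈ Set.Icc (Real.sin (1 / ((k : ℝ) + 1))) (Real.sin (1 / (k : ℝ))) := by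
  have hk0 : (0 : ℝ) < k := by exact_mod_cast hk
  have hk1 : (1 : ℝ) ≤ k := by exact_mod_cast hk
  set a : ℝ := 1 / ((k : ℝ) + 1) with ha
  set b : ℝ := 1 / (k : ℝ) with hb
  have ha0 : 0 < a := by positivity
  have hab : a ≤ b := one_div_le_one_div_of_le hk0 (by linarith)
  have hb1 : b ≤ 1 := by rw [hb, div_le_one hk0]; exact hk1
  have hc : centering 1 (k + 1) = ∫ x in a..b, Real.sin x / x ^ 2 := by
    have : k + 1 ≠ 1 := by omega
    simp [centering, ha, hb, show k ≠ 0 by omega]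
  have hne : ∀ x ∈ Set.uIcc a b, x ≠ 0 := fun x hx => by
    rw [Set.uIcc_of_le hab] at hx
    exact (ha0.trans_le hx.1).ne'
  have hint : ∀ c : ℝ, IntervalIntegrable (fun x => c / x ^ 2) volume a b := fun c =>
    (continuousOn_const.div (by fun_prop) fun x hx => pow_ne_zero 2 (hne x hx)).intervalIntegrable
  have hval : ∀ c : ℝ, ∫ x in a..b, c / x ^ 2 = c := by
    intro c
    have : ∀ x ∈ Set.uIcc a b, HasDerivAt (fun x => -c * x⁻¹) (c / x ^ 2) x := fun x hx => by
      refine ((hasDerivAt_inv (hne x hx)).const_mul (-c)).congr_deriv ?_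
      ring
    rw [intervalIntegral.integral_eq_sub_of_hasDerivAt this (hint c), ha, hb]
    simp only [one_div, inv_inv]
    ring
  have hints : IntervalIntegrable (fun x => Real.sin x / x ^ 2) volume a b :=
    (Real.continuous_sin.continuousOn.div (by fun_prop)
      fun x hx => pow_ne_zero 2 (hne x hx)).intervalIntegrable
  have hmono : ∀ x y, 0 ≤ x → x ≤ y → y ≤ 1 → Real.sin x ≤ Real.sin y := fun x y hx hxy hy =>
    Real.sin_le_sin_of_le_of_le_pi_div_two (by linarith [Real.pi_pos])
      (by linarith [Real.pi_gt_three]) hxy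
  rw [hc]
  constructor
  · rw [← hval (Real.sin a)]
    refine intervalIntegral.integral_mono_on hab (hint _) hints fun x hx => ?_
    exact div_le_div_of_nonneg_right (hmono _ _ ha0.le hx.1 (hx.2.trans hb1)) (by positivity)
  · conv_rhs => rw [← hval (Real.sin b)]
    refine intervalIntegral.integral_mono_on hab hints (hint _) fun x hx => ?_
    exact div_le_div_of_nonneg_right (hmono _ _ (ha0.le.trans hx.1) hx.2 hb1) (by positivity)

/-- The mean value theorem for x^{(α-1)/α}, whose derivative is a multiple of x^{-1/α}. -/
theorem exists_centering_eq_rpow {α : ℝ} (hα : 1 < α) {k : ℕ} (hk : 1 ≤ k) :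
    ∃ ξ : ℝ, (k : ℝ) ≤ ξ ∧ ξ ≤ k + 1 ∧ centering α (k + 1) = ξ ^ (-(1 / α)) := by
  have hk0 : (0 : ℝ) < k := by exact_mod_cast hk
  obtain ⟨ξ, hξ, h⟩ := exists_hasDerivAt_eq_slope (fun x : ℝ => x ^ ((α - 1) / α))
    (fun x => (α - 1) / α * x ^ ((α - 1) / α - 1)) (a := k) (b := k + 1) (by linarith)
    (fun x hx => (Real.continuousAt_rpow_const _ _
      (Or.inl (hk0.trans_le hx.1).ne')).continuousWithinAt)
    (fun x hx => Real.hasDerivAt_rpow_const (Or.inl (hk0.trans hx.1).ne'))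
  refine ⟨ξ, hξ.1.le, hξ.2.le, ?_⟩
  have hα0 : α - 1 ≠ 0 := by linarith
  have hα1 : α ≠ 0 := by linarith
  have he : (α - 1) / α - 1 = -(1 / α) := by field_simp; ring
  rw [he, add_sub_cancel_left, div_one] at h
  have : ¬ α < 1 := by linarith
  rw [centering, if_neg this, if_neg hα.ne']
  push_cast
  rw [add_sub_cancel_right, ← h]
  field_simp

theorem abs_centering_sub_le {α : ℝ} (hα : 1 ≤ α) {k : ℕ} (hk : 1 ≤ k) :
    |centering α (k + 1) - ((k : ℝ) + 1) ^ (-(1 / α))| ≤ 2 * (k : ℝ) ^ (-(1 / α) - 1) := by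
  have hk0 : (0 : ℝ) < k := by exact_mod_cast hk
  have hk1 : (1 : ℝ) ≤ k := by exact_mod_cast hk
  rcases hα.eq_or_lt with rfl | hα
  · have h := centering_one_add_mem hk
    set a : ℝ := 1 / ((k : ℝ) + 1) with ha
    set b : ℝ := 1 / (k : ℝ) with hb
    have ha0 : 0 < a := by positivity
    have hb0 : 0 < b := by positivity
    have hab : a ≤ b := one_div_le_one_div_of_le hk0 (by linarith)
    have hb1 : b ≤ 1 := by rw [hb, div_le_one hk0]; exact hk1
    have h1 : ((k : ℝ) + 1) ^ (-(1 / 1) : ℝ) = a := by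
      rw [div_one, Real.rpow_neg_one, ha, one_div]
    have h2 : (k : ℝ) ^ (-(1 / 1) - 1 : ℝ) = b ^ 2 := by
      rw [show (-(1 / 1) - 1 : ℝ) = -((2 : ℕ) : ℝ) by norm_num, Real.rpow_neg hk0.le,
        Real.rpow_natCast, hb]
      simp
    rw [h1, h2]
    have h3 : b - a ≤ b ^ 2 := by
      rw [ha, hb]
      rw [div_sub_div _ _ hk0.ne' (by positivity), div_pow, div_le_div_iff₀ (by positivity)
        (by positivity)]
      nlinarith
    have h4 := Real.sin_gt_sub_cube ha0
    have h5 := Real.sin_lt hb0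
    have h6 : a ^ 3 ≤ b ^ 2 := by
      calc a ^ 3 ≤ b ^ 3 := by gcongr
        _ ≤ b ^ 2 := pow_le_pow_of_le_one hb0.le hb1 (by norm_num)
    have h7 : 0 ≤ a ^ 3 := by positivity
    rw [abs_le]
    constructor
    · linarith [h.1]
    · linarith [h.2]
  · obtain ⟨ξ, h1, h2, h3⟩ := exists_centering_eq_rpow hα hk
    rw [h3]
    have hp : 0 < 1 / α := by positivity
    have hp1 : 1 / α ≤ 1 := by rw [div_le_one (by linarith)]; exact hα.le
    refine (abs_rpow_neg_sub_rpow_neg_le hp hk0 h1 (by linarith)).trans ?_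
    have h4 : |ξ - (k + 1)| ≤ 1 := by rw [abs_le]; constructor <;> linarith
    have h5 : 0 ≤ (k : ℝ) ^ (-(1 / α) - 1) := by positivity
    calc 1 / α * (k : ℝ) ^ (-(1 / α) - 1) * |ξ - (k + 1)|
        ≤ 1 / α * (k : ℝ) ^ (-(1 / α) - 1) * 1 := by gcongr
      _ ≤ 1 * (k : ℝ) ^ (-(1 / α) - 1) := by rw [mul_one]; gcongr
      _ ≤ _ := by linarith

theorem abs_centering_le {α : ℝ} (hα : 0 < α) {k : ℕ} (hk : 1 ≤ k) :
    |centering α (k + 1)| ≤ (k : ℝ) ^ (-(1 / α)) := by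
  have hk0 : (0 : ℝ) < k := by exact_mod_cast hk
  rcases lt_trichotomy α 1 with h | rfl | h
  · simp [centering, h]
    positivity
  · have h := centering_one_add_mem hk
    have hb0 : (0 : ℝ) < 1 / k := by positivity
    have h5 := Real.sin_lt hb0
    have ha1 : 1 / ((k : ℝ) + 1) ≤ 1 := by rw [div_le_one (by positivity)]; linarith
    have h6 : 0 ≤ Real.sin (1 / ((k : ℝ) + 1)) :=
      Real.sin_nonneg_of_nonneg_of_le_pi (by positivity) (by linarith [Real.pi_gt_three])
    rw [abs_of_nonneg (h6.trans h.1), div_one, Real.rpow_neg_one, ← one_div]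
    exact h.2.trans h5.le
  · obtain ⟨ξ, h1, h2, h3⟩ := exists_centering_eq_rpow h hk
    have hξ : 0 < ξ := hk0.trans_le h1
    rw [h3, abs_of_nonneg (by positivity)]
    exact Real.rpow_le_rpow_of_nonpos hk0 h1 (by rw [neg_nonpos]; positivity)

/-- For α < 1 the powers are summable and the constants vanish; for α ≥ 1 the difference is
O(k^{-1/α-1}). Hence the constants may be replaced by powers in questions of convergence. -/
theorem summable_rpow_sub_centering {α : ℝ} (hα : 0 < α) :
    Summable (fun k : ℕ => ((k : ℝ) + 1) ^ (-(1 / α)) - centering α (k + 1)) := by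
  rcases lt_or_ge α 1 with h | h
  · have : ∀ k : ℕ, ((k : ℝ) + 1) ^ (-(1 / α)) - centering α (k + 1)
        = ((k + 1 : ℕ) : ℝ) ^ (-(1 / α)) := fun k => by simp [centering, h]
    simp_rw [this]
    refine (summable_nat_add_iff 1 (f := fun k : ℕ => (k : ℝ) ^ (-(1 / α)))).mpr ?_
    rw [Real.summable_nat_rpow, neg_lt_neg_iff, lt_div_iff₀ hα]
    linarith
  · have hs : Summable (fun k : ℕ => 2 * (k : ℝ) ^ (-(1 / α) - 1)) := by
      refine Summable.mul_left _ ?_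
      rw [Real.summable_nat_rpow]
      have : 0 < 1 / α := by positivity
      linarith
    refine Summable.of_norm_bounded_eventually_nat hs ?_
    filter_upwards [eventually_ge_atTop 1] with k hk
    rw [Real.norm_eq_abs, abs_sub_comm]
    exact abs_centering_sub_le h hk

end DecreasingRearrangement

/-! ### The ordered centered sum as a limit of sums truncated at a level -/

section DecreasingRearrangement

/-- The partial sums of the family `z_i ^ (-1/α)` truncated at level `n`, centered. -/
noncomputable def truncatedSum (α : ℝ) (z : ℕ → ℝ) (n : ℕ) : ℝ :=
  ∑' i, (if z i < n then z i ^ (-(1 / α)) else 0) - ∑ j ∈ Finset.range n, centering α (j + 1)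

theorem eventually_rpow_le_mul {b c : ℝ} (hb : b < 1) (hc : 0 < c) :
    ∀ᶠ x : ℝ in atTop, x ^ b ≤ c * x := by
  filter_upwards [(tendsto_rpow_neg_atTop (sub_pos.mpr hb)).eventually_le_const hc,
    eventually_gt_atTop 0] with x hx hx0
  calc x ^ b = x ^ (-(1 - b)) * x := by
        rw [← Real.rpow_add_one hx0.ne']
        ring_nf
    _ ≤ c * x := by gcongr

theorem tendsto_natCast_of_monotone {z : ℕ → ℝ} (hz : ∀ n : ℕ, {i | z i < n}.Finite)
    {τ : Equiv.Perm ℕ} (hτ : Monotone (fun k => z (τ k))) :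
    Tendsto (fun k => z (τ k)) atTop atTop := by
  refine tendsto_atTop_mono' (f₁ := fun k => z (τ k)) atTop (Eventually.of_forall fun k => le_rfl) ?_
  rw [tendsto_atTop]
  intro c
  obtain ⟨n, hn⟩ := exists_nat_ge c
  filter_upwards [eventually_ge_atTop ({i | z i < n}.ncard)] with k hk
  have := (lt_ncard_iff_of_monotone (hz n) hτ k).not.mp (not_lt.mpr hk)
  exact hn.trans (not_lt.mp this)

/-- If the counting function of `z` is within `n ^ b` of `n`, then the increasing rearrangement of
`z` is within a multiple of `k ^ b` of `k`. -/
theorem eventually_abs_sub_le_rpow {z : ℕ → ℝ} (hz : ∀ n : ℕ, {i | z i < n}.Finite)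
    {b : ℝ} (hb0 : 0 < b) (hb1 : b < 1)
    (hN : ∀ᶠ n : ℕ in atTop, |({i | z i < n}.ncard : ℝ) - n| ≤ (n : ℝ) ^ b)
    {τ : Equiv.Perm ℕ} (hτ : Monotone (fun k => z (τ k))) :
    ∀ᶠ k : ℕ in atTop, (k : ℝ) / 2 ≤ z (τ k) ∧ |z (τ k) - (k + 1)| ≤ 9 * (k : ℝ) ^ b := by
  have hG := tendsto_natCast_of_monotone hz hτ
  obtain ⟨n0, hn0⟩ := eventually_atTop.mp hN
  -- With the factor 1/8 the error (G + 1)^b is small enough for the crude comparison k/2 ≤ G ≤ 2k +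
  -- 1, which then allows (G + 1)^b to be replaced by a multiple of k^b.
  have hsmall := (tendsto_atTop_add_const_right atTop (1 : ℝ) hG).eventually
    (eventually_rpow_le_mul hb1 (show (0 : ℝ) < 1 / 8 by norm_num))
  filter_upwards [hG.eventually (eventually_ge_atTop ((n0 : ℝ) + 1)),
    hG.eventually (eventually_ge_atTop (4 : ℝ)), hsmall, eventually_ge_atTop 1] with k h1 h2 h3 h4
  set G : ℝ := z (τ k) with hGdef
  have hk1 : (1 : ℝ) ≤ k := by exact_mod_cast h4
  have hG0 : 0 ≤ G := by linarith
  -- The counts at the integers around G enclose the rank: at most k values are below n, at least k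
  -- + 1 are below n + 1.
  set n := ⌊G⌋₊ with hn
  have hnG : (n : ℝ) ≤ G := Nat.floor_le hG0
  have hGn : G < (n : ℝ) + 1 := Nat.lt_floor_add_one G
  have hn0n : n0 ≤ n := Nat.le_floor (by linarith)
  have hA := hn0 n hn0n
  have hB := hn0 (n + 1) (by omega)
  have hlow : ({i | z i < n}.ncard : ℝ) ≤ k := by
    have := (lt_ncard_iff_of_monotone (hz n) hτ k).not.mpr (not_lt.mpr hnG)
    exact_mod_cast not_lt.mp this
  have hup : (k : ℝ) + 1 ≤ ({i | z i < (n + 1 : ℕ)}.ncard : ℝ) := by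
    have := (lt_ncard_iff_of_monotone (hz (n + 1)) hτ k).mpr (by push_cast; exact hGn)
    exact_mod_cast this
  rw [abs_le] at hA hB
  have hr1 : (n : ℝ) ^ b ≤ (G + 1) ^ b :=
    Real.rpow_le_rpow (by positivity) (by linarith) hb0.le
  have hr2 : ((n + 1 : ℕ) : ℝ) ^ b ≤ (G + 1) ^ b :=
    Real.rpow_le_rpow (by positivity) (by push_cast; linarith) hb0.le
  have hr3 : (1 : ℝ) ≤ (G + 1) ^ b := Real.one_le_rpow (by linarith) hb0.le
  push_cast at hB hr2 hup
  have hd1 : G - (k + 1) ≤ (G + 1) ^ b := by linarith [hA.1]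
  have hd2 : (k : ℝ) + 1 - G ≤ 2 * (G + 1) ^ b := by linarith [hB.2]
  have hGk : G ≤ 2 * k + 1 := by linarith
  have hkG : (k : ℝ) / 2 ≤ G := by linarith
  refine ⟨hkG, ?_⟩
  have hr4 : (G + 1) ^ b ≤ 4 * (k : ℝ) ^ b := by
    calc (G + 1) ^ b ≤ (4 * (k : ℝ)) ^ b := Real.rpow_le_rpow (by linarith) (by linarith) hb0.le
      _ = (4 : ℝ) ^ b * (k : ℝ) ^ b := Real.mul_rpow (by norm_num) (by positivity)
      _ ≤ 4 * (k : ℝ) ^ b := by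
        gcongr
        calc (4 : ℝ) ^ b ≤ (4 : ℝ) ^ (1 : ℝ) :=
              Real.rpow_le_rpow_of_exponent_le (by norm_num) hb1.le
          _ = 4 := Real.rpow_one 4
  have hkb : 0 ≤ (k : ℝ) ^ b := by positivity
  rw [abs_le]
  constructor <;> linarith

/-- The k-th ordered value is k + O(k^b) and x^{-1/α} has derivative O(k^{-1/α-1}) there, so it
differs from (k+1)^{-1/α} by O(k^{b-1/α-1}) after applying the power. This is summable because b <
1/α. -/
theorem summable_rpow_sub_centering_of_monotone {α : ℝ} (hα : 0 < α) {z : ℕ → ℝ}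
    (hz : ∀ n : ℕ, {i | z i < n}.Finite) {b : ℝ} (hb0 : 0 < b) (hb1 : b < 1) (hbα : b < 1 / α)
    (hN : ∀ᶠ n : ℕ in atTop, |({i | z i < n}.ncard : ℝ) - n| ≤ (n : ℝ) ^ b)
    {τ : Equiv.Perm ℕ} (hτ : Monotone (fun k => z (τ k))) :
    Summable (fun k : ℕ => z (τ k) ^ (-(1 / α)) - centering α (k + 1)) := by
  have hp : 0 < 1 / α := by positivity
  have h1 : Summable (fun k : ℕ => z (τ k) ^ (-(1 / α)) - ((k : ℝ) + 1) ^ (-(1 / α))) := by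
    have hs : Summable (fun k : ℕ =>
        1 / α * (2 : ℝ)⁻¹ ^ (-(1 / α) - 1) * 9 * (k : ℝ) ^ (b + (-(1 / α) - 1))) := by
      refine Summable.mul_left _ ?_
      rw [Real.summable_nat_rpow]
      linarith
    refine Summable.of_norm_bounded_eventually_nat hs ?_
    filter_upwards [eventually_abs_sub_le_rpow hz hb0 hb1 hN hτ, eventually_ge_atTop 1]
      with k hk hk1
    have hk0 : (0 : ℝ) < k := by exact_mod_cast hk1
    rw [Real.norm_eq_abs]
    refine (abs_rpow_neg_sub_rpow_neg_le hp (half_pos hk0) hk.1 (by linarith)).trans ?_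
    rw [Real.rpow_add hk0, div_eq_inv_mul (k : ℝ) 2, Real.mul_rpow (by norm_num) hk0.le]
    have := hk.2
    calc 1 / α * ((2 : ℝ)⁻¹ ^ (-(1 / α) - 1) * (k : ℝ) ^ (-(1 / α) - 1)) * |z (τ k) - (k + 1)|
        ≤ 1 / α * ((2 : ℝ)⁻¹ ^ (-(1 / α) - 1) * (k : ℝ) ^ (-(1 / α) - 1)) * (9 * (k : ℝ) ^ b) := by
          gcongr
      _ = _ := by ring
  refine (h1.add (summable_rpow_sub_centering hα)).congr fun k => ?_
  ring

theorem tsum_truncated_eq {α : ℝ} {z : ℕ → ℝ} {n : ℕ} (hz : {i | z i < n}.Finite)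
    {τ : Equiv.Perm ℕ} (hτ : Monotone (fun k => z (τ k))) :
    ∑' i, (if z i < n then z i ^ (-(1 / α)) else 0)
      = ∑ k ∈ Finset.range ({i | z i < n}.ncard), z (τ k) ^ (-(1 / α)) := by
  rw [← τ.tsum_eq, tsum_eq_sum (s := Finset.range ({i | z i < n}.ncard))]
  · refine Finset.sum_congr rfl fun k hk => ?_
    rw [if_pos ((lt_ncard_iff_of_monotone hz hτ k).mp (Finset.mem_range.mp hk))]
  · intro k hk
    rw [if_neg]
    rwa [← lt_ncard_iff_of_monotone hz hτ k, ← Finset.mem_range]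

theorem abs_sum_range_centering_sub_le {α : ℝ} (hα : 0 < α) {M N n : ℕ} (hM : 1 ≤ M)
    (hMN : M ≤ N) (hMn : M ≤ n) :
    |∑ j ∈ Finset.range N, centering α (j + 1) - ∑ j ∈ Finset.range n, centering α (j + 1)|
      ≤ |(N : ℝ) - n| * (M : ℝ) ^ (-(1 / α)) := by
  wlog h : n ≤ N generalizing N n
  · rw [abs_sub_comm, abs_sub_comm (N : ℝ)]
    exact this hMn hMN (by omega)
  have hM0 : (0 : ℝ) < M := by exact_mod_cast hM
  rw [← Finset.sum_Ico_eq_sub _ h]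
  refine (Finset.abs_sum_le_sum_abs _ _).trans ?_
  refine (Finset.sum_le_card_nsmul _ _ ((M : ℝ) ^ (-(1 / α))) fun j hj => ?_).trans ?_
  · rw [Finset.mem_Ico] at hj
    refine (abs_centering_le hα (by omega)).trans ?_
    refine Real.rpow_le_rpow_of_nonpos hM0 (by exact_mod_cast hMn.trans hj.1) ?_
    rw [neg_nonpos]
    positivity
  · rw [Nat.card_Ico, nsmul_eq_mul, Nat.cast_sub h]
    gcongr
    exact le_abs_self _

/-- Truncation at level n keeps the first N(n) ordered terms but subtracts n constants. The mismatch
consists of at most n^b constants, all with index of order n and hence of size O(n^{-1/α}); it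
vanishes in the limit because b < 1/α. -/
theorem tendsto_truncatedSum_of_monotone {α : ℝ} (hα : 0 < α) {z : ℕ → ℝ}
    (hz : ∀ n : ℕ, {i | z i < n}.Finite) {b : ℝ} (hb1 : b < 1) (hbα : b < 1 / α)
    (hN : ∀ᶠ n : ℕ in atTop, |({i | z i < n}.ncard : ℝ) - n| ≤ (n : ℝ) ^ b)
    {τ : Equiv.Perm ℕ} (hτ : Monotone (fun k => z (τ k))) {s : ℝ}
    (hs : Tendsto (fun n => ∑ k ∈ Finset.range n, (z (τ k) ^ (-(1 / α)) - centering α (k + 1)))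
      atTop (𝓝 s)) :
    Tendsto (truncatedSum α z) atTop (𝓝 s) := by
  have hsmall := (tendsto_natCast_atTop_atTop (R := ℝ)).eventually
    (eventually_rpow_le_mul hb1 (show (0 : ℝ) < 1 / 2 by norm_num))
  have hhalf : ∀ᶠ n : ℕ in atTop, n / 2 ≤ {i | z i < n}.ncard := by
    filter_upwards [hN, hsmall] with n h1 h2
    have h3 := (abs_le.mp h1).1
    have h4 : (n : ℝ) / 2 ≤ ({i | z i < n}.ncard : ℝ) := by linarith
    have h5 : ((n / 2 : ℕ) : ℝ) ≤ (n : ℝ) / 2 := Nat.cast_div_le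
    exact_mod_cast h5.trans h4
  have hNt : Tendsto (fun n : ℕ => {i | z i < n}.ncard) atTop atTop :=
    tendsto_atTop_mono' _ hhalf (Nat.tendsto_div_const_atTop (by norm_num))
  have h1 := hs.comp hNt
  have h2 : Tendsto (fun n : ℕ => ∑ j ∈ Finset.range ({i | z i < n}.ncard), centering α (j + 1)
      - ∑ j ∈ Finset.range n, centering α (j + 1)) atTop (𝓝 0) := by
    have hb' : Tendsto (fun n : ℕ => (4 : ℝ)⁻¹ ^ (-(1 / α)) * (n : ℝ) ^ (-(1 / α - b)))
        atTop (𝓝 0) := by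
      have := ((tendsto_rpow_neg_atTop (sub_pos.mpr hbα)).comp
        (tendsto_natCast_atTop_atTop (R := ℝ))).const_mul ((4 : ℝ)⁻¹ ^ (-(1 / α)))
      simpa using! this
    refine squeeze_zero_norm' ?_ hb'
    filter_upwards [hN, hhalf, eventually_ge_atTop 2] with n h1 h2 h3
    have hn0 : (0 : ℝ) < n := by positivity
    have hM1 : 1 ≤ n / 2 := by omega
    rw [Real.norm_eq_abs]
    refine (abs_sum_range_centering_sub_le hα hM1 h2 (Nat.div_le_self n 2)).trans ?_
    have h4 : ((n / 2 : ℕ) : ℝ) ^ (-(1 / α)) ≤ ((4 : ℝ)⁻¹ * n) ^ (-(1 / α)) := by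
      refine Real.rpow_le_rpow_of_nonpos (by positivity) ?_ ?_
      · have : n ≤ 4 * (n / 2) := by omega
        have : (n : ℝ) ≤ 4 * ((n / 2 : ℕ) : ℝ) := by exact_mod_cast this
        linarith
      · rw [neg_nonpos]
        positivity
    calc |({i | z i < n}.ncard : ℝ) - n| * ((n / 2 : ℕ) : ℝ) ^ (-(1 / α))
        ≤ (n : ℝ) ^ b * ((4 : ℝ)⁻¹ * n) ^ (-(1 / α)) := by gcongr
      _ = _ := by
        rw [Real.mul_rpow (by norm_num) hn0.le, mul_left_comm, ← Real.rpow_add hn0]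
        congr 2
        ring
  have h3 := h1.add h2
  rw [add_zero] at h3
  refine h3.congr fun n => ?_
  simp only [Function.comp, truncatedSum]
  rw [tsum_truncated_eq (hz n) hτ, Finset.sum_sub_distrib]
  ring

/-- If the number of `z_i < n` is `n + O(n ^ b)` with `b < 1 / α`, then the decreasing centered sum
of the family `z_i ^ (-1/α)` exists, and it is the limit of the truncated sums. -/
theorem hasDecreasingCenteredSum_iff_tendsto_truncatedSum {α : ℝ} (hα : 0 < α) {z : ℕ → ℝ}
    (hpos : ∀ i, 0 < z i)
    (hz : ∀ n : ℕ, {i | z i < n}.Finite) {b : ℝ} (hb0 : 0 < b) (hb1 : b < 1) (hbα : b < 1 / α)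
    (hN : ∀ᶠ n : ℕ in atTop, |({i | z i < n}.ncard : ℝ) - n| ≤ (n : ℝ) ^ b) :
    (∃ s, Tendsto (truncatedSum α z) atTop (𝓝 s)) ∧
    ∀ s, HasDecreasingCenteredSum (centering α) (fun i => z i ^ (-(1 / α))) s ↔
      Tendsto (truncatedSum α z) atTop (𝓝 s) := by
  have hneg : -(1 / α) < 0 := by rw [neg_lt_zero]; positivity
  obtain ⟨τ₀, hτ₀⟩ := exists_perm_monotone hz
  have hs₀ := (summable_rpow_sub_centering_of_monotone hα hz hb0 hb1 hbα hN
    hτ₀).hasSum.tendsto_sum_nat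
  have ht₀ := tendsto_truncatedSum_of_monotone hα hz hb1 hbα hN hτ₀ hs₀
  refine ⟨⟨_, ht₀⟩, fun s => ⟨?_, fun h => ?_⟩⟩
  · rintro ⟨τ, hτ, hs⟩
    refine tendsto_truncatedSum_of_monotone hα hz hb1 hbα hN (τ := τ) (fun k l hkl => ?_) hs
    exact (Real.rpow_le_rpow_iff_of_neg (hpos _) (hpos _) hneg).mp (hτ hkl)
  · refine ⟨τ₀, fun k l hkl => ?_, ?_⟩
    · exact (Real.rpow_le_rpow_iff_of_neg (hpos _) (hpos _) hneg).mpr (hτ₀ hkl)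
    · rw [tendsto_nhds_unique h ht₀]
      exact hs₀

end DecreasingRearrangement

/-! ### The measure e^{-u} du under shifts and random shifts -/

section ExpIntensity

instance : SigmaFinite expIntensity := by
  unfold expIntensity
  infer_instance

theorem lintegral_expIntensity {f : ℝ → ℝ≥0∞} (hf : Measurable f) :
    ∫⁻ u, f u ∂expIntensity = ∫⁻ u, ENNReal.ofReal (Real.exp (-u)) * f u := by
  rw [expIntensity, lintegral_withDensity_eq_lintegral_mul _ (by fun_prop) hf]
  rfl

theorem lintegral_expIntensity_add {f : ℝ → ℝ≥0∞} (hf : Measurable f) (c : ℝ) :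
    ∫⁻ u, f (u + c) ∂expIntensity = ENNReal.ofReal (Real.exp c) * ∫⁻ u, f u ∂expIntensity := by
  rw [lintegral_expIntensity (by fun_prop), lintegral_expIntensity hf,
    ← lintegral_const_mul _ (by fun_prop),
    ← lintegral_add_right_eq_self
      (fun u => ENNReal.ofReal (Real.exp c) * (ENNReal.ofReal (Real.exp (-u)) * f u)) c]
  refine lintegral_congr fun u => ?_
  rw [← mul_assoc, ← ENNReal.ofReal_mul (by positivity), ← Real.exp_add]
  congr 3
  ring

theorem expIntensity_map_add (c : ℝ) :
    expIntensity.map (fun u => u + c) = ENNReal.ofReal (Real.exp c) • expIntensity := by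
  refine Measure.ext_of_lintegral _ fun f hf => ?_
  rw [lintegral_map hf (by fun_prop), lintegral_expIntensity_add hf, lintegral_smul_measure,
    smul_eq_mul]

/-- The substitution z = e^{-u}. In this coordinate intensities are lengths, which lets the integer
truncation levels match the indices of the centering constants. -/
theorem expIntensity_map_exp_neg :
    expIntensity.map (fun u => Real.exp (-u)) = volume.restrict (Set.Ioi 0) := by
  refine Measure.ext_of_lintegral _ fun f hf => ?_
  rw [lintegral_map hf (by fun_prop), lintegral_expIntensity (by fun_prop)]
  have himg : (fun u : ℝ => Real.exp (-u)) '' Set.univ = Set.Ioi 0 := by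
    rw [Set.image_univ]
    ext x
    exact ⟨by rintro ⟨u, rfl⟩; exact Real.exp_pos _,
      fun hx => ⟨-Real.log x, by simp [Real.exp_log hx]⟩⟩
  have hd : ∀ u ∈ (Set.univ : Set ℝ), HasDerivWithinAt (fun u : ℝ => Real.exp (-u))
      (-Real.exp (-u)) Set.univ u := fun u _ => by
    exact (((hasDerivAt_neg u).exp).congr_deriv (by simp)).hasDerivWithinAt
  have := lintegral_image_eq_lintegral_abs_deriv_mul MeasurableSet.univ hd
    (fun a _ b _ h => by simpa using h) f
  rw [himg] at this
  rw [this, Measure.restrict_univ]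
  simp [abs_of_pos (Real.exp_pos _)]

theorem expIntensity_setOf_exp_neg_lt (c : ℝ) :
    expIntensity {u | Real.exp (-u) < c} = ENNReal.ofReal c := by
  have h : {u : ℝ | Real.exp (-u) < c} = (fun u : ℝ => Real.exp (-u)) ⁻¹' Set.Iio c := rfl
  rw [h, ← Measure.map_apply (by fun_prop) measurableSet_Iio, expIntensity_map_exp_neg,
    Measure.restrict_apply measurableSet_Iio, Set.Iio_inter_Ioi, Real.volume_Ioo, sub_zero]

/-- Shifting the points of a marked process with intensity `e^{-u} du ⊗ ρ(dv)` by `c(v)` tilts the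
mark distribution by `e^{c(v)}`. -/
theorem map_shift_prod {E : Type*} [MeasurableSpace E] (ρ : Measure E) [SFinite ρ] {c : E → ℝ}
    (hc : Measurable c) :
    (expIntensity.prod ρ).map (fun p => (p.1 + c p.2, p.2))
      = expIntensity.prod (ρ.withDensity fun v => ENNReal.ofReal (Real.exp (c v))) := by
  have hd : Measurable fun v => ENNReal.ofReal (Real.exp (c v)) := by fun_prop
  refine Measure.ext_of_lintegral _ fun f hf => ?_
  rw [lintegral_map hf (by fun_prop), lintegral_prod_symm _ (by fun_prop),
    lintegral_prod_symm _ (by fun_prop), lintegral_withDensity_eq_lintegral_mul _ hd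
      (Measurable.lintegral_prod_left' hf)]
  refine lintegral_congr fun v => ?_
  exact lintegral_expIntensity_add (f := fun u => f (u, v)) (hf.comp measurable_prodMk_right) (c v)

/-- The shift tilts the mark law by e^c, and mean one makes the tilted law a probability measure,
which disappears from the first marginal. -/
theorem map_add_prod {E : Type*} [MeasurableSpace E] (ρ : Measure E) [SFinite ρ] {c : E → ℝ}
    (hc : Measurable c) (hc1 : ∫⁻ v, ENNReal.ofReal (Real.exp (c v)) ∂ρ = 1) :
    (expIntensity.prod ρ).map (fun p => p.1 + c p.2) = expIntensity := by
  have h : (fun p : ℝ × E => p.1 + c p.2) = Prod.fst ∘ fun p : ℝ × E => (p.1 + c p.2, p.2) := rfl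
  rw [h, ← Measure.map_map (by fun_prop) (by fun_prop), map_shift_prod ρ hc]
  have : IsProbabilityMeasure (ρ.withDensity fun v => ENNReal.ofReal (Real.exp (c v))) :=
    ⟨by rw [withDensity_apply _ MeasurableSet.univ, Measure.restrict_univ, hc1]⟩
  exact Measure.fst_prod

end ExpIntensity

/-! ### Exponential moments of Gaussian processes -/

section Gaussian

variable {T Ω : Type*} [MeasurableSpace Ω] {P : Measure Ω} {X : T → Ω → ℝ} {Γ : T → T → ℝ}

theorem hasGaussianLaw_linearCombination (hX : IsGaussianProcess X P) (J : Finset T) (c : T → ℝ) :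
    HasGaussianLaw (fun ω => ∑ t ∈ J, c t * X t ω) P :=
  (hX.smul c).hasGaussianLaw_fun_sum

/-- Polarization expresses each covariance by two variances and Γ. When the coefficients sum to one,
the variance part is linear in c and is cancelled by the normalization -σ²/2 in the exponent. -/
theorem variance_linearCombination [IsProbabilityMeasure P] (hX : IsGaussianProcess X P)
    (hΓ : ∀ s t, variance (fun ω => X s ω - X t ω) P = Γ s t) (J : Finset T) (c : T → ℝ) :
    variance (fun ω => ∑ t ∈ J, c t * X t ω) P
      = (∑ t ∈ J, c t) * ∑ t ∈ J, c t * variance (X t) P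
        - (∑ s ∈ J, ∑ t ∈ J, c s * c t * Γ s t) / 2 := by
  have hL : ∀ t, MemLp (X t) 2 P := fun t => (hX.hasGaussianLaw_eval t).memLp_two
  have hcov : ∀ s t, cov[X s, X t; P] = (variance (X s) P + variance (X t) P - Γ s t) / 2 := by
    intro s t
    have := variance_fun_sub (hL s) (hL t)
    rw [hΓ] at this
    linarith
  rw [variance_fun_sum' fun t _ => (hL t).const_mul (c t)]
  have h : ∀ s t, cov[fun ω => c s * X s ω, fun ω => c t * X t ω; P]
      = c s * (c t * variance (X t) P) / 2 + (c s * variance (X s) P) * c t / 2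
        - c s * c t * Γ s t / 2 := by
    intro s t
    rw [covariance_const_mul_left, covariance_const_mul_right, hcov]
    ring
  simp_rw [h, Finset.sum_sub_distrib, Finset.sum_add_distrib, ← Finset.sum_div, ← Finset.mul_sum,
    ← Finset.sum_mul]
  ring

theorem integrable_exp_linearCombination (hX : IsGaussianProcess X P) (J : Finset T) (c : T → ℝ) :
    Integrable (fun ω => Real.exp (∑ t ∈ J, c t * X t ω)) P := by
  have hg := hasGaussianLaw_linearCombination hX J c
  have := integrable_exp_mul_gaussianReal (μ := P[fun ω => ∑ t ∈ J, c t * X t ω])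
    (v := (variance (fun ω => ∑ t ∈ J, c t * X t ω) P).toNNReal) 1
  rw [← hg.map_eq_gaussianReal, integrable_map_measure (by fun_prop) hg.aemeasurable] at this
  simpa [Function.comp_def] using this

/-- The exponential moments of the normalized exponentials of a Gaussian process are determined by
the incremental variance. -/
theorem integral_exp_linearCombination [IsProbabilityMeasure P] (hX : IsGaussianProcess X P)
    (h0 : ∀ t, ∫ ω, X t ω ∂P = 0)
    (hΓ : ∀ s t, variance (fun ω => X s ω - X t ω) P = Γ s t) (J : Finset T) (c : T → ℝ)
    (hc : ∑ t ∈ J, c t = 1) :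
    ∫ ω, Real.exp (∑ t ∈ J, c t * (X t ω - variance (X t) P / 2)) ∂P
      = Real.exp (-(∑ s ∈ J, ∑ t ∈ J, c s * c t * Γ s t) / 4) := by
  have hg := hasGaussianLaw_linearCombination hX J c
  have hm := mgf_gaussianReal hg.map_eq_gaussianReal 1
  have hmean : ∫ ω, ∑ t ∈ J, c t * X t ω ∂P = 0 := by
    rw [integral_finsetSum _ fun t _ => ((hX.hasGaussianLaw_eval t).integrable).const_mul (c t)]
    refine Finset.sum_eq_zero fun t _ => ?_
    rw [integral_const_mul, h0, mul_zero]
  rw [hmean, Real.coe_toNNReal _ (variance_nonneg _ _), variance_linearCombination hX hΓ, hc,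
    mgf] at hm
  have h1 : ∀ ω, ∑ t ∈ J, c t * (X t ω - variance (X t) P / 2)
      = -(∑ t ∈ J, c t * variance (X t) P) / 2 + 1 * ∑ t ∈ J, c t * X t ω := by
    intro ω
    simp_rw [mul_sub, Finset.sum_sub_distrib, mul_div_assoc', ← Finset.sum_div]
    ring
  simp_rw [h1, Real.exp_add]
  rw [integral_const_mul, hm, ← Real.exp_add]
  congr 1
  ring

theorem lintegral_exp_normalized [IsProbabilityMeasure P] (hX : IsGaussianProcess X P)
    (h0 : ∀ t, ∫ ω, X t ω ∂P = 0) (t : T) :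
    ∫⁻ ω, ENNReal.ofReal (Real.exp (X t ω - variance (X t) P / 2)) ∂P = 1 := by
  -- For a single site any incremental variance will do: only its diagonal value enters, and it is
  -- zero.
  have h1 := integral_exp_linearCombination hX h0 (fun _ _ => rfl) {t} (fun _ => 1) (by simp)
  have h2 := integrable_exp_linearCombination hX {t} (fun _ => 1)
  simp only [Finset.sum_singleton, one_mul, sub_self] at h1 h2
  have h3 : variance (fun _ : Ω => (0 : ℝ)) P = 0 := variance_zero P
  rw [h3] at h1
  rw [← ofReal_integral_eq_lintegral_ofReal, h1]
  · simp
  · simp_rw [sub_eq_add_neg, Real.exp_add]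
    exact h2.mul_const _
  · exact ae_of_all _ fun ω => (Real.exp_pos _).le

end Gaussian

/-! ### Concentration of Poisson variables -/

section PoissonConcentration

variable {Ω : Type*} [MeasurableSpace Ω] {P : Measure Ω}

theorem mgf_of_map_eq_poisson {X : Ω → ℝ} (hX : Measurable X) {r : ℝ≥0}
    (h : P.map X = (poissonMeasure r).map ((↑) : ℕ → ℝ)) (t : ℝ) :
    mgf X P t = Real.exp (r * (Real.exp t - 1)) ∧ Integrable (fun ω => Real.exp (t * X ω)) P := by
  have h1 : mgf X P t = Real.exp (r * (Real.exp t - 1)) := by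
    rw [← mgf_id_map hX.aemeasurable, h, mgf, integral_map .of_discrete (by fun_prop)]
    have h2 := integral_pow_poissonMeasure r (Complex.exp t)
    have h3 : ∀ k : ℕ, Complex.exp t ^ k = ((Real.exp (t * id (k : ℝ)) : ℝ) : ℂ) := fun k => by
      rw [← Complex.exp_nat_mul]
      push_cast
      simp [mul_comm]
    simp_rw [h3] at h2
    rw [integral_complex_ofReal] at h2
    exact_mod_cast h2
  refine ⟨h1, ?_⟩
  -- A non-integrable function would have the default integral 0, contradicting the positive value
  -- just found.
  by_contra hni
  rw [mgf, integral_undef hni] at h1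
  exact (Real.exp_pos _).ne h1

variable [IsProbabilityMeasure P]

/-- Chernoff's bound at the parameters ±l with l = n^{-1/2}. As e^x - 1 ≤ x + x² for |x| ≤ 1 and n
l² = 1, the quadratic term costs only the constant 1 in the exponent. -/
theorem measureReal_abs_sub_gt_le_of_poisson {X : Ω → ℝ} (hX : Measurable X) {n : ℕ} (hn : 1 ≤ n)
    (h : P.map X = (poissonMeasure n).map ((↑) : ℕ → ℝ)) (c : ℝ) :
    P.real {ω | c < |X ω - n|} ≤ 2 * Real.exp (1 - c * (n : ℝ) ^ (-(1 / 2) : ℝ)) := by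
  have hn0 : (0 : ℝ) < n := by exact_mod_cast hn
  set l : ℝ := (n : ℝ) ^ (-(1 / 2) : ℝ) with hl
  have hl0 : 0 < l := by positivity
  have hl1 : l ≤ 1 := Real.rpow_le_one_of_one_le_of_nonpos (by exact_mod_cast hn) (by norm_num)
  have hl2 : n * l ^ 2 = 1 := by
    rw [hl, ← Real.rpow_natCast, ← Real.rpow_mul hn0.le]
    norm_num
    rw [Real.rpow_neg_one]
    field_simp
  have hexp : ∀ x : ℝ, |x| = l → n * (Real.exp x - 1) ≤ n * x + 1 := by
    intro x hx
    have h1 := (abs_le.mp (Real.abs_exp_sub_one_sub_id_le (x := x) (by linarith))).2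
    have h2 : x ^ 2 = l ^ 2 := by rw [← sq_abs, hx]
    rw [h2] at h1
    calc n * (Real.exp x - 1) ≤ n * (x + l ^ 2) := by gcongr; linarith
      _ = n * x + 1 := by rw [mul_add, hl2]
  have hsub : {ω | c < |X ω - n|} ⊆ {ω | n + c ≤ X ω} ∪ {ω | X ω ≤ n - c} := by
    intro ω (hω : c < |X ω - n|)
    rcases lt_abs.mp hω with h | h
    · exact Or.inl (show n + c ≤ X ω by linarith)
    · exact Or.inr (show X ω ≤ n - c by linarith)
  have hup := measure_ge_le_exp_mul_mgf (n + c) hl0.le (mgf_of_map_eq_poisson hX h l).2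
  have hlo := measure_le_le_exp_mul_mgf (n - c) (neg_nonpos.mpr hl0.le)
    (mgf_of_map_eq_poisson hX h (-l)).2
  rw [(mgf_of_map_eq_poisson hX h _).1, ← Real.exp_add] at hup hlo
  have h1 : -l * (n + c) + ((n : ℝ≥0) : ℝ) * (Real.exp l - 1) ≤ 1 - c * l := by
    have := hexp l (abs_of_pos hl0)
    push_cast
    linarith
  have h2 : - -l * (n - c) + ((n : ℝ≥0) : ℝ) * (Real.exp (-l) - 1) ≤ 1 - c * l := by
    have := hexp (-l) (by rw [abs_neg, abs_of_pos hl0])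
    push_cast
    linarith
  calc P.real {ω | c < |X ω - n|} ≤ P.real ({ω | n + c ≤ X ω} ∪ {ω | X ω ≤ n - c}) :=
        measureReal_mono hsub
    _ ≤ P.real {ω | n + c ≤ X ω} + P.real {ω | X ω ≤ n - c} := measureReal_union_le _ _
    _ ≤ Real.exp (1 - c * l) + Real.exp (1 - c * l) :=
        add_le_add (hup.trans (Real.exp_le_exp.mpr h1)) (hlo.trans (Real.exp_le_exp.mpr h2))
    _ = _ := by ring

theorem summable_exp_neg_rpow {δ : ℝ} (hδ : 0 < δ) :
    Summable (fun n : ℕ => Real.exp (1 - (n : ℝ) ^ δ)) := by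
  have h1 : (fun n : ℕ => Real.exp (-1 * (n : ℝ) ^ δ)) =o[atTop]
      fun n : ℕ => ((n : ℝ) ^ δ) ^ (-2 / δ) :=
    (isLittleO_exp_neg_mul_rpow_atTop one_pos (-2 / δ)).comp_tendsto
      ((tendsto_rpow_atTop hδ).comp tendsto_natCast_atTop_atTop)
  have h2 : Summable (fun n : ℕ => ((n : ℝ) ^ δ) ^ (-2 / δ)) := by
    have : ∀ n : ℕ, ((n : ℝ) ^ δ) ^ (-2 / δ) = (n : ℝ) ^ (-2 : ℝ) := fun n => by
      rw [← Real.rpow_mul (by positivity), mul_div_cancel₀ _ hδ.ne']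
    simp_rw [this]
    rw [Real.summable_nat_rpow]
    norm_num
  have h3 := (summable_of_isBigO_nat h2 h1.isBigO).mul_left (Real.exp 1)
  refine h3.congr fun n => ?_
  rw [← Real.exp_add]
  congr 1
  ring

/-- Almost surely, a sequence of Poisson variables with means `n` deviates from `n` by at most
`n ^ b`, `b > 1/2`, eventually. -/
theorem ae_eventually_abs_sub_le_of_poisson {X : ℕ → Ω → ℝ} (hX : ∀ n, Measurable (X n))
    (h : ∀ n : ℕ, P.map (X n) = (poissonMeasure n).map ((↑) : ℕ → ℝ)) {b : ℝ} (hb : 1 / 2 < b) :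
    ∀ᵐ ω ∂P, ∀ᶠ n : ℕ in atTop, |X n ω - n| ≤ (n : ℝ) ^ b := by
  have hbound : ∀ n : ℕ, 1 ≤ n → P.real {ω | (n : ℝ) ^ b < |X n ω - n|}
      ≤ 2 * Real.exp (1 - (n : ℝ) ^ (b - 1 / 2)) := by
    intro n hn
    refine (measureReal_abs_sub_gt_le_of_poisson (hX n) hn (h n) _).trans ?_
    rw [← Real.rpow_add (by exact_mod_cast hn), ← sub_eq_add_neg]
  have hs : Summable (fun n : ℕ => P.real {ω | (n : ℝ) ^ b < |X n ω - n|}) := by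
    refine Summable.of_norm_bounded_eventually_nat
      ((summable_exp_neg_rpow (sub_pos.mpr hb)).mul_left 2) ?_
    filter_upwards [eventually_ge_atTop 1] with n hn
    rw [Real.norm_of_nonneg measureReal_nonneg]
    exact hbound n hn
  have hfin : ∑' n : ℕ, P {ω | (n : ℝ) ^ b < |X n ω - n|} ≠ ∞ := by
    have := hs.tsum_ofReal_ne_top
    simpa [measureReal_def] using this
  filter_upwards [ae_eventually_notMem hfin] with ω hω
  filter_upwards [hω] with n hn
  simpa using hn

end PoissonConcentration

/-! ### Locations at a fixed site and convergence of the series -/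

section GaussPoissonFamily

variable {T Ω : Type*} [MeasurableSpace Ω] {Γ : T → T → ℝ} {U : ℕ → Ω → ℝ} {W : ℕ → T → Ω → ℝ}
  {P : Measure Ω}

/-- The intensity measure of the points `(U_i, W_i)`. -/
noncomputable def markedIntensity (W : ℕ → T → Ω → ℝ) (P : Measure Ω) : Measure (ℝ × (T → ℝ)) :=
  expIntensity.prod (P.map fun ω t => W 0 t ω)

/-- The location `u + w(t) - σ²(t)/2` at `t` of the marked point `(u, w)`. -/
noncomputable def logPoint (W : ℕ → T → Ω → ℝ) (P : Measure Ω) (t : T) (p : ℝ × (T → ℝ)) : ℝ :=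
  p.1 + (p.2 t - variance (W 0 t) P / 2)

theorem measurable_logPoint (t : T) : Measurable (logPoint W P t) := by
  unfold logPoint
  fun_prop

theorem seriesTerm_eq_rpow (α : ℝ) (t : T) (ω : Ω) (i : ℕ) :
    seriesTerm α U W P t ω i
      = Real.exp (-logPoint W P t (U i ω, fun t => W i t ω)) ^ (-(1 / α)) := by
  rw [seriesTerm, logPoint, ← Real.exp_mul]
  congr 1
  ring

namespace IsGaussPoissonFamily

theorem measurable_path (h : IsGaussPoissonFamily Γ U W P) (i : ℕ) :
    Measurable (fun ω t => W i t ω) := measurable_pi_lambda _ (h.measurable i)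

theorem map_path_eq (h : IsGaussPoissonFamily Γ U W P) (i : ℕ) :
    P.map (fun ω t => W i t ω) = P.map (fun ω t => W 0 t ω) := (h.identDistrib i).map_eq

theorem isProbabilityMeasure_markLaw (h : IsGaussPoissonFamily Γ U W P) :
    IsProbabilityMeasure (P.map fun ω t => W 0 t ω) := by
  have := h.isProbabilityMeasure
  exact Measure.isProbabilityMeasure_map (h.measurable_path 0).aemeasurable

theorem lintegral_exp_markLaw (h : IsGaussPoissonFamily Γ U W P) (t : T) :
    ∫⁻ w, ENNReal.ofReal (Real.exp (w t - variance (W 0 t) P / 2)) ∂(P.map fun ω t => W 0 t ω)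
      = 1 := by
  have := h.isProbabilityMeasure
  rw [lintegral_map (by fun_prop) (h.measurable_path 0)]
  exact lintegral_exp_normalized (h.gaussian 0) (h.mean_zero 0) t

theorem map_logPoint (h : IsGaussPoissonFamily Γ U W P) (t : T) :
    (markedIntensity W P).map (logPoint W P t) = expIntensity := by
  have := h.isProbabilityMeasure_markLaw
  exact map_add_prod (P.map fun ω t => W 0 t ω) (c := fun w => w t - variance (W 0 t) P / 2)
    (by fun_prop) (h.lintegral_exp_markLaw t)

theorem markedIntensity_setOf_lt (h : IsGaussPoissonFamily Γ U W P) (t : T) (c : ℝ) :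
    markedIntensity W P {p | Real.exp (-logPoint W P t p) < c} = ENNReal.ofReal c := by
  have hm : MeasurableSet {u : ℝ | Real.exp (-u) < c} := measurableSet_lt (by fun_prop) (by fun_prop)
  have := Measure.map_apply (μ := markedIntensity W P) (measurable_logPoint (W := W) (P := P) t) hm
  rw [h.map_logPoint, expIntensity_setOf_exp_neg_lt] at this
  exact this.symm

theorem measurableSet_logPoint_lt (t : T) (c : ℝ) :
    MeasurableSet {p | Real.exp (-logPoint W P t p) < c} :=
  measurableSet_lt (measurable_logPoint t).neg.exp measurable_const

theorem integral_exp_tsum (h : IsGaussPoissonFamily Γ U W P) {G : ℝ × (T → ℝ) → ℝ}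
    (hG : Measurable G) (hfin : markedIntensity W P {x | G x ≠ 0} ≠ ⊤) :
    ∫ ω, Complex.exp ((∑' i, G (U i ω, fun t => W i t ω) : ℝ) * Complex.I) ∂P
      = Complex.exp (∫ x, (Complex.exp (G x * Complex.I) - 1) ∂(markedIntensity W P)) := by
  have := h.isProbabilityMeasure
  exact h.poisson.integral_exp_tsum_marks h.measurable_path h.map_path_eq h.indep_copies
    h.indep_points hG hfin

theorem ae_finite (h : IsGaussPoissonFamily Γ U W P) (t : T) (c : ℝ) :
    ∀ᵐ ω ∂P, {i | Real.exp (-logPoint W P t (U i ω, fun t => W i t ω)) < c}.Finite := by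
  have := h.isProbabilityMeasure
  refine h.poisson.ae_finite_marks h.measurable_path h.map_path_eq h.indep_points
    (measurableSet_logPoint_lt t c) ?_
  have := h.markedIntensity_setOf_lt t c
  rw [markedIntensity] at this
  rw [this]
  exact ENNReal.ofReal_ne_top

/-- The characteristic functional applied to θ times an indicator yields the Poisson characteristic
function, with the intensity n of the set as parameter. -/
theorem map_count (h : IsGaussPoissonFamily Γ U W P) (t : T) (n : ℕ) :
    P.map (fun ω => ∑' i, Set.indicator {p | Real.exp (-logPoint W P t p) < n} (fun _ => (1 : ℝ))
      (U i ω, fun t => W i t ω)) = (poissonMeasure n).map ((↑) : ℕ → ℝ) := by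
  have := h.isProbabilityMeasure
  set A : Set (ℝ × (T → ℝ)) := {p | Real.exp (-logPoint W P t p) < n} with hA
  have hAm : MeasurableSet A := measurableSet_logPoint_lt t n
  have hAi : markedIntensity W P A = n := by
    rw [hA, h.markedIntensity_setOf_lt, ENNReal.ofReal_natCast]
  have hm : Measurable (fun ω => ∑' i, A.indicator (fun _ => (1 : ℝ))
      (U i ω, fun t => W i t ω)) :=
    Measurable.tsum fun i => (measurable_const.indicator hAm).comp
      ((h.poisson.measurable i).prodMk (h.measurable_path i))
  have := Measure.isProbabilityMeasure_map (μ := P) hm.aemeasurable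
  refine Measure.ext_of_charFun (funext fun θ => ?_)
  rw [charFun_map_cast_poissonMeasure, charFun_apply_real, integral_map hm.aemeasurable (by fun_prop)]
  have h1 := h.integral_exp_tsum (G := fun p => θ * A.indicator (fun _ => (1 : ℝ)) p)
    (measurable_const.mul (measurable_const.indicator hAm)) (by
      refine ne_top_of_le_ne_top ?_ (measure_mono (t := A) fun p hp => ?_)
      · rw [hAi]; simp
      · by_contra hpA
        exact hp (by rw [Set.indicator_of_notMem hpA, mul_zero]))
  simp_rw [tsum_mul_left] at h1
  simp only [Complex.ofReal_mul] at h1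
  rw [h1]
  congr 1
  have h2 : ∀ p, Complex.exp (θ * (A.indicator (fun _ => (1 : ℝ)) p : ℝ) * Complex.I) - 1
      = A.indicator (fun _ => Complex.exp (θ * Complex.I) - 1) p := by
    intro p
    by_cases hp : p ∈ A <;> simp [hp]
  simp_rw [h2]
  rw [integral_indicator_const _ hAm, measureReal_def, hAi]
  simp

theorem ae_eventually_count (h : IsGaussPoissonFamily Γ U W P) (t : T) {b : ℝ} (hb : 1 / 2 < b) :
    ∀ᵐ ω ∂P, ∀ᶠ n : ℕ in atTop,
      |({i | Real.exp (-logPoint W P t (U i ω, fun t => W i t ω)) < n}.ncard : ℝ) - n|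
        ≤ (n : ℝ) ^ b := by
  have := h.isProbabilityMeasure
  have h1 := ae_eventually_abs_sub_le_of_poisson (fun n => Measurable.tsum fun i =>
    (measurable_const.indicator (measurableSet_logPoint_lt t n)).comp
      ((h.poisson.measurable i).prodMk (h.measurable_path i))) (h.map_count t) hb
  filter_upwards [h1, ae_all_iff.mpr fun n : ℕ => h.ae_finite t n] with ω hω hfin
  filter_upwards [hω] with n hn
  convert hn using 4
  have h2 : ∀ i, Set.indicator {p | Real.exp (-logPoint W P t p) < n} (fun _ => (1 : ℝ))
      (U i ω, fun t => W i t ω) = Set.indicator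
      {i | Real.exp (-logPoint W P t (U i ω, fun t => W i t ω)) < n} (fun _ => (1 : ℝ)) i :=
    fun i => rfl
  simp only [Function.comp, h2]
  rw [← tsum_subtype, tsum_const, nsmul_eq_mul, mul_one]
  rfl

/-- Almost surely, the centered series exists and is the limit of the truncated sums. -/
theorem ae_hasDecreasingCenteredSum_iff (h : IsGaussPoissonFamily Γ U W P) {α : ℝ}
    (hα : α ∈ Set.Ioo (0 : ℝ) 2) (t : T) :
    ∀ᵐ ω ∂P,
      (∃ s, Tendsto (truncatedSum α
        fun i => Real.exp (-logPoint W P t (U i ω, fun t => W i t ω))) atTop (𝓝 s)) ∧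
      ∀ s, HasDecreasingCenteredSum (centering α) (seriesTerm α U W P t ω) s ↔
        Tendsto (truncatedSum α
          fun i => Real.exp (-logPoint W P t (U i ω, fun t => W i t ω))) atTop (𝓝 s) := by
  -- The use of α < 2: an exponent above the Poisson fluctuation 1/2 and below 1/α has to exist.
  have hlt : (1 / 2 : ℝ) < min 1 (1 / α) :=
    lt_min (by norm_num) (one_div_lt_one_div_of_lt hα.1 hα.2)
  obtain ⟨b, hb1, hb2⟩ := exists_between hlt
  filter_upwards [h.ae_eventually_count t hb1, ae_all_iff.mpr fun n : ℕ => h.ae_finite t n]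
    with ω hω hfin
  have h1 : seriesTerm α U W P t ω
      = fun i => Real.exp (-logPoint W P t (U i ω, fun t => W i t ω)) ^ (-(1 / α)) :=
    funext fun i => seriesTerm_eq_rpow α t ω i
  rw [h1]
  exact hasDecreasingCenteredSum_iff_tendsto_truncatedSum hα.1 (fun i => Real.exp_pos _) hfin
    (by linarith) (hb2.trans_le (min_le_left _ _)) (hb2.trans_le (min_le_right _ _)) hω

theorem measurable_truncatedSum (h : IsGaussPoissonFamily Γ U W P) (α : ℝ) (t : T) (n : ℕ) :
    Measurable (fun ω => truncatedSum α
      (fun i => Real.exp (-logPoint W P t (U i ω, fun t => W i t ω))) n) := by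
  refine Measurable.sub_const (Measurable.tsum fun i => ?_) _
  have hz : Measurable (fun ω => Real.exp (-logPoint W P t (U i ω, fun t => W i t ω))) :=
    ((measurable_logPoint t).comp
      ((h.poisson.measurable i).prodMk (h.measurable_path i))).neg.exp
  exact Measurable.ite (measurableSet_lt hz measurable_const) (hz.pow_const _) measurable_const

theorem exists_isCenteredSeries (h : IsGaussPoissonFamily Γ U W P) {α : ℝ}
    (hα : α ∈ Set.Ioo (0 : ℝ) 2) : ∃ S : T → Ω → ℝ, IsCenteredSeries α U W P S := by
  have key : ∀ t, ∃ g : Ω → ℝ, Measurable g ∧ ∀ᵐ ω ∂P,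
      HasDecreasingCenteredSum (centering α) (seriesTerm α U W P t ω) (g ω) := by
    intro t
    obtain ⟨g, hg, hgt⟩ := measurable_limit_of_tendsto_metrizable_ae
      (fun n => (h.measurable_truncatedSum α t n).aemeasurable)
      ((h.ae_hasDecreasingCenteredSum_iff hα t).mono fun ω hω => hω.1)
    refine ⟨g, hg, ?_⟩
    filter_upwards [hgt, h.ae_hasDecreasingCenteredSum_iff hα t] with ω h1 h2
    exact (h2.2 _).mpr h1
  choose g hg hgs using key
  exact ⟨g, hg, hgs⟩

end IsGaussPoissonFamily

end GaussPoissonFamily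

/-! ### The centering constants as compensator integrals -/

section Compensator

/-- The compensating function: the truncated first moments of the points are integrals of it. -/
noncomputable def compensator (α x : ℝ) : ℝ :=
  if α < 1 then 0 else if α = 1 then Real.sin x else x

theorem measurable_compensator (α : ℝ) : Measurable (compensator α) := by
  unfold compensator
  split_ifs <;> fun_prop

theorem compensator_zero (α : ℝ) : compensator α 0 = 0 := by
  simp [compensator]

theorem compensator_eq_zero {α : ℝ} (h : α < 1) : compensator α = fun _ => 0 := by
  funext x; simp [compensator, h]

theorem compensator_one : compensator 1 = Real.sin := by
  funext x; simp [compensator]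

theorem compensator_eq_id {α : ℝ} (h : 1 < α) : compensator α = fun x => x := by
  funext x; simp [compensator, h.ne', not_lt.mpr h.le]

theorem intervalIntegrable_compensator_rpow {α : ℝ} (hα : 0 < α) {a b : ℝ} :
    IntervalIntegrable (fun z : ℝ => compensator α (z ^ (-(1 / α)))) volume a b := by
  rcases lt_trichotomy α 1 with h | rfl | h
  · simp [compensator_eq_zero h]
  · rw [compensator_one]
    refine (intervalIntegrable_const (c := (1 : ℝ))).mono_fun ?_ (ae_of_all _ fun z => ?_)
    · exact Measurable.aestronglyMeasurable (by fun_prop)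
    · simpa using Real.abs_sin_le_one _
  · rw [compensator_eq_id h]
    refine intervalIntegral.intervalIntegrable_rpow' ?_
    rw [neg_lt_neg_iff, div_lt_one (by linarith)]
    exact h

theorem setIntegral_sin_inv {j : ℕ} : ∫ z in Set.Ioo (j : ℝ) (j + 1), Real.sin z⁻¹
    = ∫ x in (fun z : ℝ => z⁻¹) '' Set.Ioo (j : ℝ) (j + 1), Real.sin x / x ^ 2 := by
  have hpos : ∀ z ∈ Set.Ioo (j : ℝ) (j + 1), 0 < z := fun z hz =>
    (Nat.cast_nonneg j).trans_lt hz.1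
  rw [integral_image_eq_integral_abs_deriv_smul measurableSet_Ioo
    (fun z hz => (hasDerivAt_inv (hpos z hz).ne').hasDerivWithinAt)
    (fun a _ b _ hab => inv_injective hab)]
  refine setIntegral_congr_fun measurableSet_Ioo fun z hz => ?_
  have := hpos z hz
  simp only [abs_neg, smul_eq_mul]
  rw [abs_of_pos (by positivity)]
  field_simp

/-- The substitution x = 1/z when α = 1, the integral of a power when α > 1. Summed over the first n
indices, the constants become the exact compensator of the truncation z < n. -/
theorem centering_eq_integral {α : ℝ} (hα : 0 < α) (j : ℕ) :
    centering α (j + 1) = ∫ z in (j : ℝ)..(j + 1 : ℕ), compensator α (z ^ (-(1 / α))) := by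
  rcases lt_trichotomy α 1 with h | rfl | h
  · simp [compensator_eq_zero h, centering, h]
  · have h1 : ∀ z : ℝ, compensator 1 (z ^ (-(1 / 1 : ℝ))) = Real.sin z⁻¹ := fun z => by
      rw [compensator_one, div_one, Real.rpow_neg_one]
    simp_rw [h1]
    rw [intervalIntegral.integral_of_le (by push_cast; linarith), integral_Ioc_eq_integral_Ioo]
    push_cast
    rw [setIntegral_sin_inv]
    rcases Nat.eq_zero_or_pos j with rfl | hj
    · have himg : (fun z : ℝ => z⁻¹) '' Set.Ioo ((0 : ℕ) : ℝ) ((0 : ℕ) + 1) = Set.Ioi 1 := by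
        rw [Set.image_inv_eq_inv, Nat.cast_zero, zero_add, Set.inv_Ioo_0_left one_pos, inv_one]
      rw [himg]
      simp [centering]
    · have hj0 : (0 : ℝ) < j := by exact_mod_cast hj
      have himg : (fun z : ℝ => z⁻¹) '' Set.Ioo (j : ℝ) (j + 1)
          = Set.Ioo (1 / ((j : ℝ) + 1)) (1 / (j : ℝ)) := by
        ext x
        constructor
        · rintro ⟨z, hz, rfl⟩
          have hz0 : 0 < z := hj0.trans hz.1
          simp only [Set.mem_Ioo, one_div]
          exact ⟨inv_strictAnti₀ hz0 hz.2, inv_strictAnti₀ hj0 hz.1⟩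
        · rintro ⟨h2, h3⟩
          have hx0 : 0 < x := lt_trans (by positivity) h2
          refine ⟨x⁻¹, ⟨?_, ?_⟩, inv_inv x⟩
          · rwa [lt_inv_comm₀ hj0 hx0, ← one_div]
          · rwa [inv_lt_comm₀ hx0 (by positivity), ← one_div]
      rw [himg, ← integral_Ioc_eq_integral_Ioo, ← intervalIntegral.integral_of_le
        (one_div_le_one_div_of_le hj0 (by linarith))]
      simp [centering, hj.ne']
  · have hα1 : α - 1 ≠ 0 := by linarith
    have hr : -1 < -(1 / α) := by rw [neg_lt_neg_iff, div_lt_one hα]; exact h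
    rw [compensator_eq_id h, integral_rpow (Or.inl hr), centering, if_neg (by linarith),
      if_neg h.ne']
    have he : -(1 / α) + 1 = (α - 1) / α := by field_simp; ring
    rw [he]
    push_cast
    rw [add_sub_cancel_right]
    field_simp

theorem integrableOn_Ioo_compensator_rpow {α : ℝ} (hα : 0 < α) (n : ℕ) :
    IntegrableOn (fun z : ℝ => compensator α (z ^ (-(1 / α)))) (Set.Ioo 0 (n : ℝ)) :=
  ((intervalIntegrable_iff_integrableOn_Ioc_of_le (Nat.cast_nonneg n)).mp
    (intervalIntegrable_compensator_rpow hα)).mono_set Set.Ioo_subset_Ioc_self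

theorem sum_centering_eq_setIntegral {α : ℝ} (hα : 0 < α) (n : ℕ) :
    ∑ j ∈ Finset.range n, centering α (j + 1)
      = ∫ z in Set.Ioo 0 (n : ℝ), compensator α (z ^ (-(1 / α))) := by
  simp_rw [centering_eq_integral hα]
  rw [intervalIntegral.sum_integral_adjacent_intervals (a := fun j : ℕ => (j : ℝ))
    (fun k _ => intervalIntegrable_compensator_rpow hα), ← integral_Ioc_eq_integral_Ioo,
    intervalIntegral.integral_of_le (by simp)]
  simp

/-- The weight of the marked point with logarithmic location `y`, truncated at level `n`. -/
noncomputable def truncatedWeight (α : ℝ) (n : ℕ) (y : ℝ) : ℝ :=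
  if Real.exp (-y) < n then Real.exp (-y) ^ (-(1 / α)) else 0

theorem measurable_truncatedWeight (α : ℝ) (n : ℕ) : Measurable (truncatedWeight α n) :=
  Measurable.ite (measurableSet_lt (by fun_prop) (by fun_prop)) (by fun_prop) (by fun_prop)

theorem compensator_truncatedWeight_eq (α : ℝ) (n : ℕ) (y : ℝ) :
    compensator α (truncatedWeight α n y)
      = (Set.Iio (n : ℝ)).indicator (fun z => compensator α (z ^ (-(1 / α)))) (Real.exp (-y)) := by
  rw [truncatedWeight, Set.indicator_apply]
  simp only [Set.mem_Iio]
  split_ifs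
  · rfl
  · rw [compensator_zero]

theorem measurableEmbedding_exp_neg : MeasurableEmbedding (fun u : ℝ => Real.exp (-u)) :=
  Continuous.measurableEmbedding (by fun_prop) fun a b h => by simpa using h

theorem integrable_compensator_truncatedWeight {α : ℝ} (hα : 0 < α) (n : ℕ) :
    Integrable (fun y => compensator α (truncatedWeight α n y)) expIntensity := by
  simp_rw [compensator_truncatedWeight_eq]
  refine (measurableEmbedding_exp_neg.integrable_map_iff (g := (Set.Iio (n : ℝ)).indicator
    (fun z => compensator α (z ^ (-(1 / α)))))).mp ?_
  rw [expIntensity_map_exp_neg, integrable_indicator_iff measurableSet_Iio, IntegrableOn,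
    Measure.restrict_restrict measurableSet_Iio, Set.Iio_inter_Ioi]
  exact integrableOn_Ioo_compensator_rpow hα n

theorem integral_compensator_truncatedWeight {α : ℝ} (hα : 0 < α) (n : ℕ) :
    ∫ y, compensator α (truncatedWeight α n y) ∂expIntensity
      = ∑ j ∈ Finset.range n, centering α (j + 1) := by
  simp_rw [compensator_truncatedWeight_eq]
  rw [← measurableEmbedding_exp_neg.integral_map (g := (Set.Iio (n : ℝ)).indicator
    (fun z => compensator α (z ^ (-(1 / α))))), expIntensity_map_exp_neg,
    integral_indicator measurableSet_Iio,
    Measure.restrict_restrict measurableSet_Iio, Set.Iio_inter_Ioi, sum_centering_eq_setIntegral hα]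

end Compensator

/-! ### An integrable bound for the Lévy–Khintchine integrand -/

section Majorant

/-- A majorant for the compensated exponentials, integrable with respect to `e^{-u} du` as a
function of `e^{u/α}`. -/
noncomputable def majorant (α x : ℝ) : ℝ :=
  if x ≤ 1 then x ^ (if α < 1 then 1 else 2) else x ^ (if α ≤ 1 then 0 else 1)

theorem measurable_majorant (α : ℝ) : Measurable (majorant α) :=
  Measurable.ite measurableSet_Iic (measurable_id.pow_const _) (measurable_id.pow_const _)

theorem majorant_nonneg (α : ℝ) {x : ℝ} (hx : 0 ≤ x) : 0 ≤ majorant α x := by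
  unfold majorant
  split_ifs <;> positivity

theorem majorant_zero (α : ℝ) : majorant α 0 = 0 := by
  unfold majorant
  split_ifs <;> simp_all

/-- In the coordinate z = e^{-u}, where x = z^{-1/α}, the power near z = 0 exceeds -1 and the one
near infinity is below -1. For α ≥ 1 the latter amounts to α < 2. -/
theorem integrable_majorant {α : ℝ} (hα : α ∈ Set.Ioo (0 : ℝ) 2) :
    Integrable (fun y => majorant α (Real.exp (-y) ^ (-(1 / α)))) expIntensity := by
  have hα0 := hα.1
  refine (measurableEmbedding_exp_neg.integrable_map_iff (g :=
    (fun z => majorant α (z ^ (-(1 / α)))))).mp ?_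
  rw [expIntensity_map_exp_neg]
  change IntegrableOn (fun z : ℝ => majorant α (z ^ (-(1 / α)))) (Set.Ioi 0) volume
  have hneg : -(1 / α) < 0 := by rw [neg_lt_zero]; positivity
  rw [← Set.Ioc_union_Ioi_eq_Ioi (zero_le_one (α := ℝ))]
  refine IntegrableOn.union ?_ ?_
  · have hint : IntegrableOn (fun z : ℝ => z ^ (-(1 / α) * ((if α ≤ 1 then 0 else 1 : ℕ) : ℝ)))
        (Set.Ioo 0 1) := by
      refine ((intervalIntegrable_iff_integrableOn_Ioc_of_le zero_le_one).mp
        (intervalIntegral.intervalIntegrable_rpow' ?_)).mono_set Set.Ioo_subset_Ioc_self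
      split_ifs with h
      · norm_num
      · push Not at h
        have : 1 / α < 1 := by rw [div_lt_one hα0]; exact h
        push_cast
        linarith
    rw [integrableOn_Ioc_iff_integrableOn_Ioo]
    refine hint.congr_fun (fun z hz => ?_) measurableSet_Ioo
    have h1 : 1 < z ^ (-(1 / α)) := Real.one_lt_rpow_of_pos_of_lt_one_of_neg hz.1 hz.2 hneg
    simp only [majorant]
    rw [if_neg (not_le.mpr h1), Real.rpow_mul hz.1.le, Real.rpow_natCast]
  · have hint : IntegrableOn (fun z : ℝ => z ^ (-(1 / α) * ((if α < 1 then 1 else 2 : ℕ) : ℝ)))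
        (Set.Ioi 1) := by
      refine integrableOn_Ioi_rpow_of_lt ?_ zero_lt_one
      have h2 := hα.2
      rw [neg_mul, neg_lt_neg_iff, one_div_mul_eq_div, lt_div_iff₀ hα0, one_mul]
      split_ifs with h
      · simpa using h
      · simpa using h2
    refine hint.congr_fun (fun z hz => ?_) measurableSet_Ioi
    have hz0 : (0 : ℝ) < z := zero_lt_one.trans hz
    have h1 : z ^ (-(1 / α)) ≤ 1 := Real.rpow_le_one_of_one_le_of_nonpos (le_of_lt hz) hneg.le
    simp only [majorant]
    rw [if_pos h1, Real.rpow_mul hz0.le, Real.rpow_natCast]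

theorem norm_exp_mul_I_sub_one_le (s : ℝ) : ‖Complex.exp (s * Complex.I) - 1‖ ≤ |s| := by
  rw [mul_comm]
  exact Real.norm_exp_I_mul_ofReal_sub_one_le

theorem norm_exp_mul_I_sub_one_le_two (s : ℝ) : ‖Complex.exp (s * Complex.I) - 1‖ ≤ 2 := by
  refine (norm_sub_le _ _).trans ?_
  rw [Complex.norm_exp_ofReal_mul_I]
  norm_num

theorem norm_exp_mul_I_sub_one_sub_le (s : ℝ) :
    ‖Complex.exp (s * Complex.I) - 1 - s * Complex.I‖ ≤ 2 * s ^ 2 := by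
  have hn : ‖(s : ℂ) * Complex.I‖ = |s| := by simp
  rcases le_or_gt |s| 1 with h | h
  · refine (Complex.norm_exp_sub_one_sub_id_le (by rw [hn]; exact h)).trans ?_
    rw [hn, sq_abs]
    nlinarith [sq_nonneg s]
  · refine (norm_sub_le _ _).trans ?_
    rw [hn]
    have := norm_exp_mul_I_sub_one_le s
    have : |s| ≤ s ^ 2 := by
      rw [← sq_abs]
      nlinarith
    linarith

variable {ι : Type*} [Fintype ι]

/-- The integrand of the Lévy–Khintchine exponent. -/
noncomputable def levyIntegrand (α : ℝ) (θ x : ι → ℝ) : ℂ :=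
  Complex.exp ((∑ j, θ j * x j : ℝ) * Complex.I) - 1
    - (∑ j, θ j * compensator α (x j) : ℝ) * Complex.I

theorem measurable_levyIntegrand (α : ℝ) (θ : ι → ℝ) : Measurable (levyIntegrand α θ) := by
  have := measurable_compensator α
  unfold levyIntegrand
  fun_prop

theorem abs_sum_mul_le (θ x : ι → ℝ) {X : ℝ} (hx0 : ∀ j, 0 ≤ x j) (hx : ∀ j, x j ≤ X) :
    |∑ j, θ j * x j| ≤ (∑ j, |θ j|) * X := by
  refine (Finset.abs_sum_le_sum_abs _ _).trans ?_
  rw [Finset.sum_mul]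
  refine Finset.sum_le_sum fun j _ => ?_
  rw [abs_mul, abs_of_nonneg (hx0 j)]
  exact mul_le_mul_of_nonneg_left (hx j) (abs_nonneg _)

/-- For α < 1, |e^{is} - 1| is at most |s| and at most 2; for α > 1, |e^{is} - 1 - is| is at most
2s² and at most 2|s|. For α = 1 the sine acts as the identity near 0, with a cubic error, and is
bounded at infinity. -/
theorem norm_levyIntegrand_le_majorant_max (α : ℝ) (θ x : ι → ℝ) {X : ℝ} (hx0 : ∀ j, 0 ≤ x j)
    (hx : ∀ j, x j ≤ X) (hX : 0 ≤ X) :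
    ‖levyIntegrand α θ x‖ ≤ 2 * (1 + ∑ j, |θ j|) ^ 2 * majorant α X := by
  set Θ := ∑ j, |θ j| with hΘ
  have hΘ0 : 0 ≤ Θ := Finset.sum_nonneg fun _ _ => abs_nonneg _
  set s := ∑ j, θ j * x j with hs
  have hsX : |s| ≤ Θ * X := abs_sum_mul_le θ x hx0 hx
  have hs2 : s ^ 2 ≤ (Θ * X) ^ 2 := by rw [← sq_abs]; gcongr
  rcases lt_trichotomy α 1 with h | rfl | h
  · have hF : levyIntegrand α θ x = Complex.exp (s * Complex.I) - 1 := by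
      simp [levyIntegrand, compensator_eq_zero h, hs]
    rw [hF]
    simp only [majorant, h, h.le, if_true, pow_one, pow_zero]
    split_ifs
    · refine (norm_exp_mul_I_sub_one_le s).trans (hsX.trans ?_)
      gcongr
      nlinarith
    · refine (norm_exp_mul_I_sub_one_le_two s).trans ?_
      nlinarith
  · simp only [majorant, lt_self_iff_false, le_refl, if_true, if_false, pow_zero]
    split_ifs with hX1
    · have hF : levyIntegrand 1 θ x = (Complex.exp (s * Complex.I) - 1 - s * Complex.I)
          + ((∑ j, θ j * (x j - Real.sin (x j)) : ℝ) : ℂ) * Complex.I := by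
        simp only [levyIntegrand, compensator_one, mul_sub, Finset.sum_sub_distrib, hs]
        push_cast
        ring
      rw [hF]
      have h1 : |∑ j, θ j * (x j - Real.sin (x j))| ≤ Θ * X ^ 2 := by
        refine abs_sum_mul_le θ _ (fun j => sub_nonneg.mpr (Real.sin_le (hx0 j))) fun j => ?_
        rcases (hx0 j).eq_or_lt with h0 | h0
        · rw [← h0]; simp; positivity
        · have h1 := Real.sin_gt_sub_cube h0
          have h2 : x j ^ 3 ≤ x j ^ 2 := pow_le_pow_of_le_one h0.le ((hx j).trans hX1) (by norm_num)
          have h3 : x j ^ 2 ≤ X ^ 2 := pow_le_pow_left₀ h0.le (hx j) 2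
          have : 0 ≤ x j ^ 3 := by positivity
          linarith
      refine (norm_add_le _ _).trans ?_
      have h2 := norm_exp_mul_I_sub_one_sub_le s
      have h3 : ‖((∑ j, θ j * (x j - Real.sin (x j)) : ℝ) : ℂ) * Complex.I‖ ≤ Θ * X ^ 2 := by
        rw [norm_mul, Complex.norm_I, mul_one, Complex.norm_real]
        exact h1
      have h4 : 0 ≤ Θ * X ^ 2 := by positivity
      calc _ ≤ 2 * s ^ 2 + Θ * X ^ 2 := add_le_add h2 h3
        _ ≤ 2 * (Θ * X) ^ 2 + Θ * X ^ 2 := by gcongr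
        _ ≤ 2 * (1 + Θ) ^ 2 * X ^ 2 := by nlinarith [sq_nonneg X]
    · have h1 : |∑ j, θ j * Real.sin (x j)| ≤ Θ := by
        refine (Finset.abs_sum_le_sum_abs _ _).trans (Finset.sum_le_sum fun j _ => ?_)
        rw [abs_mul]
        exact mul_le_of_le_one_right (abs_nonneg _) (Real.abs_sin_le_one _)
      rw [levyIntegrand, compensator_one]
      refine (norm_sub_le _ _).trans ?_
      rw [norm_mul, Complex.norm_I, mul_one, Complex.norm_real, Real.norm_eq_abs]
      have := norm_exp_mul_I_sub_one_le_two s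
      nlinarith
  · have hF : levyIntegrand α θ x = Complex.exp (s * Complex.I) - 1 - s * Complex.I := by
      simp [levyIntegrand, compensator_eq_id h, hs]
    rw [hF]
    simp only [majorant, not_lt.mpr h.le, not_le.mpr h, if_false, pow_one]
    split_ifs
    · refine (norm_exp_mul_I_sub_one_sub_le s).trans ?_
      calc 2 * s ^ 2 ≤ 2 * (Θ * X) ^ 2 := by gcongr
        _ ≤ 2 * (1 + Θ) ^ 2 * X ^ 2 := by nlinarith [sq_nonneg X]
    · refine (norm_sub_le _ _).trans ?_
      have h1 := norm_exp_mul_I_sub_one_le s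
      have hn : ‖(s : ℂ) * Complex.I‖ = |s| := by simp
      rw [hn]
      calc _ ≤ 2 * (Θ * X) := by linarith
        _ ≤ 2 * (1 + Θ) ^ 2 * X := by
          have : Θ ≤ (1 + Θ) ^ 2 := by nlinarith
          nlinarith [mul_le_mul_of_nonneg_right this hX]

/-- The bound in the largest coordinate is one of the summands. Each summand involves a single
coordinate, so its integrability needs only the one-dimensional image of the intensity, which is
known. -/
theorem norm_levyIntegrand_le (α : ℝ) (θ x : ι → ℝ) (hx0 : ∀ j, 0 ≤ x j) :
    ‖levyIntegrand α θ x‖ ≤ 2 * (1 + ∑ j, |θ j|) ^ 2 * ∑ j, majorant α (x j) := by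
  have hC : 0 ≤ 2 * (1 + ∑ j, |θ j|) ^ 2 := by positivity
  rcases isEmpty_or_nonempty ι with _ | _
  · simp [levyIntegrand]
  · obtain ⟨k, hk⟩ := Finite.exists_max x
    refine (norm_levyIntegrand_le_majorant_max α θ x hx0 hk (hx0 k)).trans ?_
    refine mul_le_mul_of_nonneg_left ?_ hC
    exact Finset.single_le_sum (f := fun j => majorant α (x j))
      (fun j _ => majorant_nonneg α (hx0 j)) (Finset.mem_univ k)

end Majorant

/-! ### Characteristic functions of the finite-dimensional laws -/

section CharacteristicFunction

variable {T Ω : Type*} [MeasurableSpace Ω] {Γ : T → T → ℝ} {U : ℕ → Ω → ℝ} {W : ℕ → T → Ω → ℝ}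
  {P : Measure Ω} {ι : Type*} [Fintype ι]

/-- The weight of the marked point with logarithmic location `y`. -/
noncomputable def weight (α y : ℝ) : ℝ := Real.exp (-y) ^ (-(1 / α))

theorem weight_pos (α y : ℝ) : 0 < weight α y := Real.rpow_pos_of_pos (Real.exp_pos _) _

theorem weight_eq_exp (α y : ℝ) : weight α y = Real.exp (y / α) := by
  rw [weight, ← Real.exp_mul]
  congr 1
  ring

theorem measurable_weight (α : ℝ) : Measurable (weight α) := by
  unfold weight
  fun_prop

theorem truncatedWeight_eq_ite (α : ℝ) (n : ℕ) (y : ℝ) :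
    truncatedWeight α n y = if Real.exp (-y) < n then weight α y else 0 := rfl

theorem truncatedWeight_nonneg (α : ℝ) (n : ℕ) (y : ℝ) : 0 ≤ truncatedWeight α n y := by
  rw [truncatedWeight_eq_ite]
  split_ifs
  · exact (weight_pos α y).le
  · rfl

theorem majorant_truncatedWeight_le (α : ℝ) (n : ℕ) (y : ℝ) :
    majorant α (truncatedWeight α n y) ≤ majorant α (weight α y) := by
  rw [truncatedWeight_eq_ite]
  split_ifs
  · rfl
  · rw [majorant_zero]
    exact majorant_nonneg α (weight_pos α y).le

theorem eventually_truncatedWeight_eq (α y : ℝ) :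
    ∀ᶠ n : ℕ in atTop, truncatedWeight α n y = weight α y := by
  filter_upwards [tendsto_natCast_atTop_atTop.eventually (eventually_gt_atTop (Real.exp (-y)))]
    with n hn
  rw [truncatedWeight_eq_ite, if_pos hn]

namespace IsGaussPoissonFamily

theorem integrable_comp_logPoint (h : IsGaussPoissonFamily Γ U W P) (t : T) {f : ℝ → ℝ}
    (hf : Measurable f) (hfi : Integrable f expIntensity) :
    Integrable (fun p => f (logPoint W P t p)) (markedIntensity W P) := by
  rw [← h.map_logPoint t] at hfi
  exact (integrable_map_measure hf.aestronglyMeasurable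
    (measurable_logPoint t).aemeasurable).mp hfi

theorem integral_comp_logPoint (h : IsGaussPoissonFamily Γ U W P) (t : T) {f : ℝ → ℝ}
    (hf : Measurable f) :
    ∫ p, f (logPoint W P t p) ∂(markedIntensity W P) = ∫ y, f y ∂expIntensity := by
  rw [← h.map_logPoint t, integral_map (measurable_logPoint t).aemeasurable
    hf.aestronglyMeasurable]

theorem integrable_majorant_comp_logPoint (h : IsGaussPoissonFamily Γ U W P) {α : ℝ}
    (hα : α ∈ Set.Ioo (0 : ℝ) 2) (t : T) :
    Integrable (fun p => majorant α (weight α (logPoint W P t p))) (markedIntensity W P) :=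
  h.integrable_comp_logPoint t ((measurable_majorant α).comp (measurable_weight α))
    (integrable_majorant hα)

/-- The Lévy–Khintchine exponent of the finite-dimensional distribution at the points `s j`. -/
theorem tendsto_integral_levyIntegrand (h : IsGaussPoissonFamily Γ U W P) {α : ℝ}
    (hα : α ∈ Set.Ioo (0 : ℝ) 2) (s : ι → T) (θ : ι → ℝ) :
    Tendsto (fun n => ∫ p, levyIntegrand α θ (fun j => truncatedWeight α n (logPoint W P (s j) p))
      ∂(markedIntensity W P)) atTop
      (𝓝 (∫ p, levyIntegrand α θ (fun j => weight α (logPoint W P (s j) p))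
        ∂(markedIntensity W P))) := by
  have hm : ∀ j, Measurable (logPoint W P (s j)) := fun j => measurable_logPoint (s j)
  refine tendsto_integral_of_dominated_convergence
    (fun p => 2 * (1 + ∑ j, |θ j|) ^ 2 * ∑ j, majorant α (weight α (logPoint W P (s j) p)))
    (fun n => ?_) ?_ (fun n => ae_of_all _ fun p => ?_) (ae_of_all _ fun p => ?_)
  · have := measurable_truncatedWeight α n
    exact ((measurable_levyIntegrand α θ).comp
      (measurable_pi_lambda _ fun j => this.comp (hm j))).aestronglyMeasurable
  · exact (integrable_finsetSum _ fun j _ =>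
      h.integrable_majorant_comp_logPoint hα (s j)).const_mul _
  · refine (norm_levyIntegrand_le α θ _ fun j => truncatedWeight_nonneg _ _ _).trans ?_
    gcongr
    exact majorant_truncatedWeight_le _ _ _
  · refine tendsto_const_nhds.congr' ?_
    have : ∀ᶠ n : ℕ in atTop, ∀ j, truncatedWeight α n (logPoint W P (s j) p)
        = weight α (logPoint W P (s j) p) :=
      eventually_all.mpr fun j => eventually_truncatedWeight_eq α _
    filter_upwards [this] with n hn
    simp_rw [hn]

/-- The combination of truncated weights lives on a set of finite intensity, so the characteristic
functional applies. The deterministic centering is an integral of compensators, and moving it into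
the exponent produces the compensated integrand. -/
theorem integral_exp_truncatedSum (h : IsGaussPoissonFamily Γ U W P) {α : ℝ} (hα : 0 < α)
    (s : ι → T) (θ : ι → ℝ) (n : ℕ) :
    ∫ ω, Complex.exp ((∑ j, θ j * truncatedSum α
        (fun i => Real.exp (-logPoint W P (s j) (U i ω, fun t => W i t ω))) n : ℝ) * Complex.I) ∂P
      = Complex.exp (∫ p, levyIntegrand α θ
        (fun j => truncatedWeight α n (logPoint W P (s j) p)) ∂(markedIntensity W P)) := by
  set m := markedIntensity W P with hmdef
  set G : ℝ × (T → ℝ) → ℝ := fun p => ∑ j, θ j * truncatedWeight α n (logPoint W P (s j) p) with hG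
  have hmt := measurable_truncatedWeight α n
  have hml : ∀ j, Measurable (logPoint W P (s j)) := fun j => measurable_logPoint (s j)
  have hGm : Measurable G := Finset.measurable_fun_sum _ fun j _ =>
    measurable_const.mul (hmt.comp (hml j))
  set B : ℝ := ∑ j ∈ Finset.range n, centering α (j + 1) with hB
  have hGfin : m {p | G p ≠ 0} ≠ ⊤ := by
    have hsub : {p | G p ≠ 0} ⊆ ⋃ j, {p | Real.exp (-logPoint W P (s j) p) < n} := by
      intro p hp
      by_contra hc
      simp only [Set.mem_iUnion, not_exists] at hc
      refine hp (Finset.sum_eq_zero fun j _ => ?_)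
      rw [truncatedWeight_eq_ite, if_neg (show ¬ Real.exp (-logPoint W P (s j) p) < n from hc j), mul_zero]
    refine ((measure_mono hsub).trans (measure_iUnion_le _)).trans_lt ?_ |>.ne
    rw [tsum_fintype]
    refine ENNReal.sum_lt_top.mpr fun j _ => ?_
    rw [h.markedIntensity_setOf_lt]
    exact ENNReal.ofReal_lt_top
  have h1 := h.integral_exp_tsum hGm hGfin
  -- Almost surely each series has finitely many nonzero terms. This summability is what allows the
  -- sum over `j` to pass through `tsum`.
  have hae : ∀ᵐ ω ∂P, ∑ j, θ j * truncatedSum α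
        (fun i => Real.exp (-logPoint W P (s j) (U i ω, fun t => W i t ω))) n
      = ∑' i, G (U i ω, fun t => W i t ω) - B * ∑ j, θ j := by
    have hfin : ∀ᵐ ω ∂P, ∀ j, {i | Real.exp (-logPoint W P (s j) (U i ω, fun t => W i t ω)) < n}.Finite :=
      eventually_all.mpr fun j => h.ae_finite (s j) n
    filter_upwards [hfin] with ω hω
    have hsum : ∀ j, Summable (fun i => truncatedWeight α n
        (logPoint W P (s j) (U i ω, fun t => W i t ω))) := fun j => by
      refine summable_of_hasFiniteSupport ((hω j).subset fun i hi => ?_)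
      by_contra hc
      exact hi (if_neg hc)
    rw [hG, Summable.tsum_finsetSum fun j _ => (hsum j).mul_left (θ j), Finset.mul_sum,
      ← Finset.sum_sub_distrib]
    refine Finset.sum_congr rfl fun j _ => ?_
    rw [tsum_mul_left, truncatedSum, ← hB]
    simp only [truncatedWeight]
    ring
  have hLHS : ∫ ω, Complex.exp ((∑ j, θ j * truncatedSum α
        (fun i => Real.exp (-logPoint W P (s j) (U i ω, fun t => W i t ω))) n : ℝ) * Complex.I) ∂P
      = Complex.exp (-(B * ∑ j, θ j : ℝ) * Complex.I) * ∫ ω, Complex.exp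
        ((∑' i, G (U i ω, fun t => W i t ω) : ℝ) * Complex.I) ∂P := by
    rw [← integral_const_mul]
    refine integral_congr_ae ?_
    filter_upwards [hae] with ω hω
    rw [hω, ← Complex.exp_add]
    push_cast
    congr 1
    ring
  rw [hLHS, h1, ← Complex.exp_add]
  congr 1
  have hcomp : ∀ j, Integrable (fun p => compensator α (truncatedWeight α n (logPoint W P (s j) p))) m :=
    fun j => h.integrable_comp_logPoint (s j) ((measurable_compensator α).comp hmt)
      (integrable_compensator_truncatedWeight hα n)
  have hC : Integrable (fun p => ∑ j, θ j *
      compensator α (truncatedWeight α n (logPoint W P (s j) p))) m :=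
    integrable_finsetSum _ fun j _ => (hcomp j).const_mul _
  have hC2 : ∫ p, ∑ j, θ j * compensator α (truncatedWeight α n (logPoint W P (s j) p)) ∂m
      = B * ∑ j, θ j := by
    rw [integral_finsetSum _ fun j _ => (hcomp j).const_mul _, Finset.mul_sum]
    refine Finset.sum_congr rfl fun j _ => ?_
    rw [integral_const_mul, hmdef, h.integral_comp_logPoint (s j)
      (f := fun y => compensator α (truncatedWeight α n y)) ((measurable_compensator α).comp hmt),
      integral_compensator_truncatedWeight hα, mul_comm]
  have hE : Integrable (fun p => Complex.exp (G p * Complex.I) - 1) m := by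
    have h2 : IntegrableOn (fun p => Complex.exp (G p * Complex.I) - 1) {p | G p ≠ 0} m := by
      refine IntegrableOn.of_bound (lt_top_iff_ne_top.mpr hGfin)
        (by fun_prop) 2 (ae_of_all _ fun p => ?_)
      exact norm_exp_mul_I_sub_one_le_two _
    refine h2.integrable_of_forall_notMem_eq_zero fun p hp => ?_
    have : G p = 0 := by simpa using hp
    simp [this]
  have hCc : Integrable (fun p => ((∑ j, θ j *
      compensator α (truncatedWeight α n (logPoint W P (s j) p)) : ℝ) : ℂ) * Complex.I) m :=
    hC.ofReal.mul_const _
  simp only [levyIntegrand]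
  rw [integral_sub hE hCc, integral_mul_const, integral_complex_ofReal, hC2]
  ring

/-- Both sides of the truncated identity converge: the left by almost sure convergence of the
truncated sums, the right by the integrable majorant. -/
theorem integral_exp_centeredSeries (h : IsGaussPoissonFamily Γ U W P) {α : ℝ}
    (hα : α ∈ Set.Ioo (0 : ℝ) 2) {S : T → Ω → ℝ} (hS : IsCenteredSeries α U W P S)
    (s : ι → T) (θ : ι → ℝ) :
    ∫ ω, Complex.exp ((∑ j, θ j * S (s j) ω : ℝ) * Complex.I) ∂P
      = Complex.exp (∫ p, levyIntegrand α θ (fun j => weight α (logPoint W P (s j) p))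
        ∂(markedIntensity W P)) := by
  have := h.isProbabilityMeasure
  have hlim := (Complex.continuous_exp.tendsto _).comp (h.tendsto_integral_levyIntegrand hα s θ)
  refine tendsto_nhds_unique ?_ hlim
  simp only [Function.comp_def, ← h.integral_exp_truncatedSum hα.1]
  have hmt : ∀ n j, Measurable (fun ω => truncatedSum α
      (fun i => Real.exp (-logPoint W P (s j) (U i ω, fun t => W i t ω))) n) :=
    fun n j => h.measurable_truncatedSum α (s j) n
  refine tendsto_integral_of_dominated_convergence (fun _ => 1) (fun n => ?_) (by simp)
    (fun n => ae_of_all _ fun ω => (Complex.norm_exp_ofReal_mul_I _).le) ?_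
  · have := Finset.measurable_fun_sum Finset.univ fun j _ => (hmt n j).const_mul (θ j)
    exact (Complex.measurable_exp.comp
      ((Complex.measurable_ofReal.comp this).mul_const _)).aestronglyMeasurable
  · have hae : ∀ᵐ ω ∂P, ∀ j, Tendsto (truncatedSum α
        fun i => Real.exp (-logPoint W P (s j) (U i ω, fun t => W i t ω))) atTop
        (𝓝 (S (s j) ω)) := by
      refine eventually_all.mpr fun j => ?_
      filter_upwards [h.ae_hasDecreasingCenteredSum_iff hα (s j), hS.hasSum (s j)] with ω h1 h2
      exact (h1.2 _).mp h2
    filter_upwards [hae] with ω hω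
    have hc : Continuous fun x : ℝ => Complex.exp (x * Complex.I) := by fun_prop
    exact (hc.tendsto _).comp (tendsto_finsetSum _ fun j _ => (hω j).const_mul (θ j))

end IsGaussPoissonFamily

end CharacteristicFunction

/-! ### Linear functionals in coordinates -/

section Dual

theorem dual_apply_eq_sum {ι : Type*} [Fintype ι] [DecidableEq ι] (L : StrongDual ℝ (ι → ℝ))
    (x : ι → ℝ) : L x = ∑ j, L (Pi.single j 1) * x j := by
  conv_lhs => rw [← Finset.univ_sum_single x, map_sum]
  refine Finset.sum_congr rfl fun j _ => ?_
  have : (Pi.single j (x j) : ι → ℝ) = x j • Pi.single j 1 := by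
    rw [← Pi.single_smul, smul_eq_mul, mul_one]
  rw [this, map_smul, smul_eq_mul, mul_comm]

end Dual

/-! ### The tilted law of increments is determined by the incremental variance -/

section IncrementLaw

/-- Probability measures on the line with the same, everywhere finite, moment generating function
are equal. -/
theorem map_eq_of_mgf_eq {Ω Ω' : Type*} [MeasurableSpace Ω] [MeasurableSpace Ω'] {P : Measure Ω}
    {P' : Measure Ω'} [IsProbabilityMeasure P] [IsProbabilityMeasure P'] {X : Ω → ℝ} {Y : Ω' → ℝ}
    (hX : AEMeasurable X P) (hY : AEMeasurable Y P')
    (hi : ∀ r : ℝ, Integrable (fun ω => Real.exp (r * X ω)) P) (h : mgf X P = mgf Y P') :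
    P.map X = P'.map Y := by
  -- A moment generating function finite on the whole line determines its analytic extension, which
  -- on the imaginary axis is the characteristic function.
  refine Measure.ext_of_complexMGF_eq hX hY (funext fun z => ?_)
  refine eqOn_complexMGF_of_mgf h ?_
  have : integrableExpSet X P = Set.univ := Set.eq_univ_of_forall hi
  simp [this]

variable {ι Ω Ω' : Type*} [MeasurableSpace Ω] [MeasurableSpace Ω']
  {P : Measure Ω} {P' : Measure Ω'}

/-- The joint law of the increments `V j - V j₀` of `V j = X j - Var (X j) / 2` under the
measure `exp (V j₀) • P`. -/
noncomputable def tiltedIncrementLaw (X : ι → Ω → ℝ) (P : Measure Ω) (j₀ : ι) : Measure (ι → ℝ) :=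
  (P.withDensity fun ω => ENNReal.ofReal (Real.exp (X j₀ ω - variance (X j₀) P / 2))).map
    fun ω j => (X j ω - variance (X j) P / 2) - (X j₀ ω - variance (X j₀) P / 2)

/-- Increments have coefficients summing to zero and the tilt adds one at `j₀`. The result is a
combination of normalized exponents with coefficients `c` of sum one, for which the moment depends
on Γ alone. -/
theorem integral_exp_tilted [Fintype ι] [DecidableEq ι] [IsProbabilityMeasure P] {X : ι → Ω → ℝ} {Γ : ι → ι → ℝ}
    (hm : ∀ j, Measurable (X j)) (hX : IsGaussianProcess X P) (h0 : ∀ t, ∫ ω, X t ω ∂P = 0)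
    (hΓ : ∀ s t, variance (fun ω => X s ω - X t ω) P = Γ s t) (j₀ : ι) (l : ι → ℝ) {c : ι → ℝ}
    (hc : c = fun j => l j + if j = j₀ then 1 - ∑ k, l k else 0) :
    Integrable (fun ω => Real.exp (∑ j, l j * ((X j ω - variance (X j) P / 2)
      - (X j₀ ω - variance (X j₀) P / 2))))
      (P.withDensity fun ω => ENNReal.ofReal (Real.exp (X j₀ ω - variance (X j₀) P / 2))) ∧
    ∫ ω, Real.exp (∑ j, l j * ((X j ω - variance (X j) P / 2)
      - (X j₀ ω - variance (X j₀) P / 2)))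
      ∂(P.withDensity fun ω => ENNReal.ofReal (Real.exp (X j₀ ω - variance (X j₀) P / 2)))
      = Real.exp (-(∑ s, ∑ t, c s * c t * Γ s t) / 4) := by
  have hc1 : ∑ j, c j = 1 := by simp [hc, Finset.sum_add_distrib]
  have hsum : ∀ ω, ∑ j, c j * (X j ω - variance (X j) P / 2)
      = (X j₀ ω - variance (X j₀) P / 2) + ∑ j, l j * ((X j ω - variance (X j) P / 2)
      - (X j₀ ω - variance (X j₀) P / 2)) := by
    intro ω
    simp only [hc, add_mul, Finset.sum_add_distrib, ite_mul, zero_mul, Finset.sum_ite_eq',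
      Finset.mem_univ, if_true, mul_sub _ _ (X j₀ ω - variance (X j₀) P / 2),
      Finset.sum_sub_distrib, ← Finset.sum_mul]
    ring
  have hdm : Measurable fun ω => ENNReal.ofReal (Real.exp (X j₀ ω - variance (X j₀) P / 2)) := by
    have := hm j₀
    fun_prop
  have hfin : ∀ᵐ ω ∂P, ENNReal.ofReal (Real.exp (X j₀ ω - variance (X j₀) P / 2)) < ⊤ :=
    ae_of_all _ fun _ => ENNReal.ofReal_lt_top
  have hmul : ∀ ω, (ENNReal.ofReal (Real.exp (X j₀ ω - variance (X j₀) P / 2))).toReal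
      • Real.exp (∑ j, l j * ((X j ω - variance (X j) P / 2) - (X j₀ ω - variance (X j₀) P / 2)))
      = Real.exp (∑ j, c j * (X j ω - variance (X j) P / 2)) := by
    intro ω
    rw [ENNReal.toReal_ofReal (Real.exp_pos _).le, smul_eq_mul, ← Real.exp_add, hsum]
  constructor
  · rw [integrable_withDensity_iff_integrable_smul' hdm hfin]
    simp_rw [hmul, mul_sub, Finset.sum_sub_distrib, sub_eq_add_neg, Real.exp_add]
    exact (integrable_exp_linearCombination hX _ c).mul_const _
  · rw [integral_withDensity_eq_integral_toReal_smul hdm hfin]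
    simp_rw [hmul]
    exact integral_exp_linearCombination hX h0 hΓ _ c hc1

/-- Every linear functional has the same moment generating function under both laws, by the formula
in terms of Γ. The Cramér–Wold device does the rest. -/
theorem tiltedIncrementLaw_eq [Fintype ι] [IsProbabilityMeasure P] [IsProbabilityMeasure P']
    {X : ι → Ω → ℝ} {X' : ι → Ω' → ℝ} {Γ : ι → ι → ℝ}
    (hm : ∀ j, Measurable (X j)) (hX : IsGaussianProcess X P) (h0 : ∀ t, ∫ ω, X t ω ∂P = 0)
    (hΓ : ∀ s t, variance (fun ω => X s ω - X t ω) P = Γ s t)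
    (hm' : ∀ j, Measurable (X' j)) (hX' : IsGaussianProcess X' P')
    (h0' : ∀ t, ∫ ω, X' t ω ∂P' = 0)
    (hΓ' : ∀ s t, variance (fun ω => X' s ω - X' t ω) P' = Γ s t) (j₀ : ι) :
    tiltedIncrementLaw X P j₀ = tiltedIncrementLaw X' P' j₀ := by
  classical
  unfold tiltedIncrementLaw
  set Q := P.withDensity fun ω => ENNReal.ofReal (Real.exp (X j₀ ω - variance (X j₀) P / 2))
    with hQ
  set Q' := P'.withDensity fun ω =>
    ENNReal.ofReal (Real.exp (X' j₀ ω - variance (X' j₀) P' / 2)) with hQ'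
  have : IsProbabilityMeasure Q := ⟨by
    rw [hQ, withDensity_apply _ MeasurableSet.univ, Measure.restrict_univ,
      lintegral_exp_normalized hX h0]⟩
  have : IsProbabilityMeasure Q' := ⟨by
    rw [hQ', withDensity_apply _ MeasurableSet.univ, Measure.restrict_univ,
      lintegral_exp_normalized hX' h0']⟩
  have hZ : Measurable fun ω j =>
      (X j ω - variance (X j) P / 2) - (X j₀ ω - variance (X j₀) P / 2) := by fun_prop
  have hZ' : Measurable fun ω j =>
      (X' j ω - variance (X' j) P' / 2) - (X' j₀ ω - variance (X' j₀) P' / 2) := by fun_prop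
  have := Measure.isProbabilityMeasure_map (μ := Q) hZ.aemeasurable
  have := Measure.isProbabilityMeasure_map (μ := Q') hZ'.aemeasurable
  refine Measure.ext_of_charFunDual (funext fun L => ?_)
  rw [charFunDual_eq_charFun_map_one, charFunDual_eq_charFun_map_one]
  congr 1
  rw [Measure.map_map (by fun_prop) hZ, Measure.map_map (by fun_prop) hZ']
  have hmul : ∀ (r : ℝ) (x : ι → ℝ), r * L x = ∑ j, (r * L (Pi.single j 1)) * x j := by
    intro r x
    rw [dual_apply_eq_sum, Finset.mul_sum]
    simp_rw [mul_assoc]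
  refine map_eq_of_mgf_eq ((L.measurable.comp hZ).aemeasurable)
    ((L.measurable.comp hZ').aemeasurable) (fun r => ?_) (funext fun r => ?_)
  · have h := (integral_exp_tilted hm hX h0 hΓ j₀ (fun j => r * L (Pi.single j 1)) rfl).1
    refine h.congr (ae_of_all _ fun ω => ?_)
    simp only [Function.comp_apply]
    rw [hmul]
  · simp only [mgf, Function.comp_apply]
    have h := (integral_exp_tilted hm hX h0 hΓ j₀ (fun j => r * L (Pi.single j 1)) rfl).2
    have h' := (integral_exp_tilted hm' hX' h0' hΓ' j₀ (fun j => r * L (Pi.single j 1)) rfl).2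
    refine Eq.trans ?_ ((h.trans h'.symm).trans ?_)
    · refine integral_congr_ae (ae_of_all _ fun ω => ?_)
      simp only
      rw [hmul]
    · refine integral_congr_ae (ae_of_all _ fun ω => ?_)
      simp only
      rw [hmul]

end IncrementLaw

/-! ### The intensity of the joint locations and uniqueness of the law -/

section LogPointIntensity

variable {T Ω Ω' : Type*} [MeasurableSpace Ω] [MeasurableSpace Ω'] {Γ : T → T → ℝ}
  {U : ℕ → Ω → ℝ} {W : ℕ → T → Ω → ℝ} {P : Measure Ω}
  {U' : ℕ → Ω' → ℝ} {W' : ℕ → T → Ω' → ℝ} {P' : Measure Ω'} {ι : Type*}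

/-- The intensity measure of the logarithmic locations of the points at `s j`, `j ∈ ι`. -/
noncomputable def logIntensity (W : ℕ → T → Ω → ℝ) (P : Measure Ω) (s : ι → T) :
    Measure (ι → ℝ) :=
  (markedIntensity W P).map fun p j => logPoint W P (s j) p

theorem measurable_logPoint_pi (s : ι → T) :
    Measurable fun (p : ℝ × (T → ℝ)) j => logPoint W P (s j) p :=
  measurable_pi_lambda _ fun j => measurable_logPoint (s j)

namespace IsGaussPoissonFamily

/-- The location at `s j₀` is taken as the new u. Translating e^{-u} du costs the density e^{c(w)}
on the marks, and the remaining data are the increments relative to `j₀`. -/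
theorem logIntensity_eq_map_prod (h : IsGaussPoissonFamily Γ U W P) (s : ι → T) (j₀ : ι) :
    logIntensity W P s = (expIntensity.prod (tiltedIncrementLaw (fun j => W 0 (s j)) P j₀)).map
      fun p j => p.1 + p.2 j := by
  have := h.isProbabilityMeasure
  have := h.isProbabilityMeasure_markLaw
  set ρ := P.map fun ω t => W 0 t ω with hρ
  set c : (T → ℝ) → ℝ := fun w => w (s j₀) - variance (W 0 (s j₀)) P / 2 with hcdef
  have hc : Measurable c := by fun_prop
  set Z : (T → ℝ) → ι → ℝ := fun w j => (w (s j) - variance (W 0 (s j)) P / 2) - c w with hZdef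
  have hZ : Measurable Z := by fun_prop
  have hd : Measurable fun w => ENNReal.ofReal (Real.exp (c w)) := by fun_prop
  set ρ' := ρ.withDensity fun w => ENNReal.ofReal (Real.exp (c w)) with hρ'
  have : IsProbabilityMeasure ρ' := ⟨by
    rw [hρ', withDensity_apply _ MeasurableSet.univ, Measure.restrict_univ, h.lintegral_exp_markLaw]⟩
  have htilt : tiltedIncrementLaw (fun j => W 0 (s j)) P j₀ = ρ'.map Z := by
    have hW : ∀ t, Measurable (W 0 t) := h.measurable 0
    refine Measure.ext_of_lintegral _ fun f hf => ?_
    rw [tiltedIncrementLaw, lintegral_map hf (by fun_prop), lintegral_map hf hZ, hρ',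
      lintegral_withDensity_eq_lintegral_mul _ (by fun_prop) (by fun_prop),
      lintegral_withDensity_eq_lintegral_mul _ hd (by fun_prop), hρ,
      lintegral_map (by fun_prop) (h.measurable_path 0)]
    rfl
  have hA : Measurable fun (p : ℝ × (ι → ℝ)) j => p.1 + p.2 j := by fun_prop
  rw [htilt]
  have h2 : expIntensity.prod (ρ'.map Z)
      = ((expIntensity.prod ρ).map fun p => (p.1 + c p.2, p.2)).map (Prod.map id Z) := by
    rw [map_shift_prod ρ hc, ← Measure.map_prod_map _ _ measurable_id hZ, Measure.map_id]
  rw [h2, Measure.map_map hA (by fun_prop), Measure.map_map (by fun_prop) (by fun_prop),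
    logIntensity, markedIntensity]
  congr 1
  funext p j
  simp only [logPoint, hZdef, hcdef, Function.comp_apply, Prod.map, id]
  ring

/-- The intensity of the logarithmic locations depends only on the incremental variance. -/
theorem logIntensity_eq [Finite ι] [Nonempty ι] (h : IsGaussPoissonFamily Γ U W P)
    (h' : IsGaussPoissonFamily Γ U' W' P') (s : ι → T) :
    logIntensity W P s = logIntensity W' P' s := by
  have := h.isProbabilityMeasure
  have := h'.isProbabilityMeasure
  have := Fintype.ofFinite ι
  obtain ⟨j₀⟩ := ‹Nonempty ι›
  rw [h.logIntensity_eq_map_prod s j₀, h'.logIntensity_eq_map_prod s j₀]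
  rw [tiltedIncrementLaw_eq (Γ := fun j k => Γ (s j) (s k)) (fun j => h.measurable 0 (s j))
    ((h.gaussian 0).comp_right s) (fun j => h.mean_zero 0 (s j))
    (fun j k => h.incrementalVariance 0 (s j) (s k)) (fun j => h'.measurable 0 (s j))
    ((h'.gaussian 0).comp_right s) (fun j => h'.mean_zero 0 (s j))
    (fun j k => h'.incrementalVariance 0 (s j) (s k)) j₀]

/-- A common translation affects only u, where e^{-u} du picks up the factor e^c. This is the
scaling property behind stability. -/
theorem logIntensity_map_add_const (h : IsGaussPoissonFamily Γ U W P) (s : ι → T) (c : ℝ) :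
    (logIntensity W P s).map (fun y j => y j + c)
      = ENNReal.ofReal (Real.exp c) • logIntensity W P s := by
  have := h.isProbabilityMeasure_markLaw
  have hm := measurable_logPoint_pi (W := W) (P := P) s
  rw [logIntensity, Measure.map_map (by fun_prop) hm]
  have h1 : (fun (y : ι → ℝ) j => y j + c) ∘ (fun (p : ℝ × (T → ℝ)) j => logPoint W P (s j) p)
      = (fun (p : ℝ × (T → ℝ)) j => logPoint W P (s j) p) ∘ Prod.map (fun u => u + c) id := by
    funext p j
    simp only [Function.comp_apply, logPoint, Prod.map, id]
    ring
  rw [h1, ← Measure.map_map hm (by fun_prop), markedIntensity,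
    ← Measure.map_prod_map _ _ (by fun_prop) measurable_id, expIntensity_map_add, Measure.map_id,
    Measure.prod_smul_left, Measure.map_smul]

theorem integral_exp_centeredSeries_logIntensity [Fintype ι] (h : IsGaussPoissonFamily Γ U W P)
    {α : ℝ} (hα : α ∈ Set.Ioo (0 : ℝ) 2) {S : T → Ω → ℝ} (hS : IsCenteredSeries α U W P S)
    (s : ι → T) (θ : ι → ℝ) :
    ∫ ω, Complex.exp ((∑ j, θ j * S (s j) ω : ℝ) * Complex.I) ∂P
      = Complex.exp (∫ y, levyIntegrand α θ (fun j => weight α (y j)) ∂(logIntensity W P s)) := by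
  rw [h.integral_exp_centeredSeries hα hS, logIntensity,
    integral_map (measurable_logPoint_pi s).aemeasurable]
  have := measurable_weight α
  exact ((measurable_levyIntegrand α θ).comp (by fun_prop)).aestronglyMeasurable

theorem charFunDual_centeredSeries [Fintype ι] [DecidableEq ι] (h : IsGaussPoissonFamily Γ U W P)
    {α : ℝ} (hα : α ∈ Set.Ioo (0 : ℝ) 2) {S : T → Ω → ℝ} (hS : IsCenteredSeries α U W P S)
    (s : ι → T) (L : StrongDual ℝ (ι → ℝ)) :
    charFunDual (P.map fun ω j => S (s j) ω) L
      = Complex.exp (∫ y, levyIntegrand α (fun j => L (Pi.single j 1)) (fun j => weight α (y j))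
        ∂(logIntensity W P s)) := by
  have hSm := hS.measurable
  rw [← h.integral_exp_centeredSeries_logIntensity hα hS, charFunDual_apply,
    integral_map (by fun_prop) (by fun_prop)]
  refine integral_congr_ae (ae_of_all _ fun ω => ?_)
  simp only [← dual_apply_eq_sum L fun j => S (s j) ω]

theorem map_centeredSeries_eq (h : IsGaussPoissonFamily Γ U W P)
    (h' : IsGaussPoissonFamily Γ U' W' P') {α : ℝ} (hα : α ∈ Set.Ioo (0 : ℝ) 2)
    {S : T → Ω → ℝ} (hS : IsCenteredSeries α U W P S)
    {S' : T → Ω' → ℝ} (hS' : IsCenteredSeries α U' W' P' S') :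
    P.map (fun ω t => S t ω) = P'.map (fun ω t => S' t ω) := by
  classical
  have := h.isProbabilityMeasure
  have := h'.isProbabilityMeasure
  have hSm := hS.measurable
  have hSm' := hS'.measurable
  have hfin : ∀ I : Finset T, P.map (fun ω (t : I) => S t ω) = P'.map (fun ω (t : I) => S' t ω) := by
    intro I
    have := Measure.isProbabilityMeasure_map (μ := P) (f := fun ω (t : I) => S t ω) (by fun_prop)
    have := Measure.isProbabilityMeasure_map (μ := P') (f := fun ω (t : I) => S' t ω) (by fun_prop)
    refine Measure.ext_of_charFunDual (funext fun L => ?_)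
    rw [h.charFunDual_centeredSeries hα hS (fun t : I => (t : T)),
      h'.charFunDual_centeredSeries hα hS' (fun t : I => (t : T))]
    -- Without a site there is no reference point `j₀`, but then the integrand vanishes.
    rcases isEmpty_or_nonempty I with hI | hI
    · simp [levyIntegrand]
    · rw [h.logIntensity_eq h']
  have h1 := isProjectiveLimit_map (P := P) (X := S) (measurable_pi_lambda _ hSm).aemeasurable
  have h2 := isProjectiveLimit_map (P := P') (X := S') (measurable_pi_lambda _ hSm').aemeasurable
  refine h1.unique (P := fun I : Finset T => P.map fun ω => I.restrict (S · ω)) ?_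
  intro I
  rw [h2 I]
  exact (hfin I).symm

end IsGaussPoissonFamily

end LogPointIntensity

/-! ### Scaling of the exponent and stability -/

section Stability

variable {T Ω : Type*} [MeasurableSpace Ω] {Γ : T → T → ℝ} {U : ℕ → Ω → ℝ} {W : ℕ → T → Ω → ℝ}
  {P : Measure Ω} {ι : Type*}

theorem weight_add_mul_log {α : ℝ} (hα : 0 < α) {r : ℝ} (hr : 0 < r) (y : ℝ) :
    weight α (y + α * Real.log r) = r * weight α y := by
  rw [weight_eq_exp, weight_eq_exp, add_div, mul_div_cancel_left₀ _ hα.ne', Real.exp_add,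
    Real.exp_log hr, mul_comm]

theorem exp_mul_log {α r : ℝ} (hr : 0 < r) : Real.exp (α * Real.log r) = r ^ α := by
  rw [Real.rpow_def_of_pos hr, mul_comm]

namespace IsGaussPoissonFamily

theorem integrable_levyIntegrand [Fintype ι] (h : IsGaussPoissonFamily Γ U W P) {α : ℝ}
    (hα : α ∈ Set.Ioo (0 : ℝ) 2) (s : ι → T) (θ : ι → ℝ) :
    Integrable (fun y => levyIntegrand α θ (fun j => weight α (y j))) (logIntensity W P s) := by
  have hw := measurable_weight α
  have hm : AEStronglyMeasurable (fun y : ι → ℝ => levyIntegrand α θ (fun j => weight α (y j)))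
      (logIntensity W P s) :=
    ((measurable_levyIntegrand α θ).comp (by fun_prop)).aestronglyMeasurable
  rw [logIntensity] at hm ⊢
  rw [integrable_map_measure hm (measurable_logPoint_pi s).aemeasurable]
  refine ((integrable_finsetSum Finset.univ fun j _ =>
    h.integrable_majorant_comp_logPoint hα (s j)).const_mul (2 * (1 + ∑ j, |θ j|) ^ 2)).mono'
    (hm.comp_measurable (measurable_logPoint_pi s)) (ae_of_all _ fun p => ?_)
  exact norm_levyIntegrand_le α θ _ fun j => (weight_pos _ _).le

/-- The defect of homogeneity of the compensator. -/
noncomputable def compensatorShift (α : ℝ) (M : Measure (ι → ℝ)) (r : ℝ) (j : ι) : ℝ :=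
  ∫ y, (r * compensator α (weight α (y j)) - compensator α (r * weight α (y j))) ∂M

/-- Translating the locations by α log r multiplies the weights by r and the intensity by r^α. Only
the compensator fails to scale, and its defect is linear in θ. -/
theorem integral_levyIntegrand_smul [Fintype ι] [DecidableEq ι] (h : IsGaussPoissonFamily Γ U W P)
    {α : ℝ} (hα : α ∈ Set.Ioo (0 : ℝ) 2) (s : ι → T) (θ : ι → ℝ) {r : ℝ} (hr : 0 < r) :
    ∫ y, levyIntegrand α (r • θ) (fun j => weight α (y j)) ∂(logIntensity W P s)
      = (r ^ α : ℝ) * ∫ y, levyIntegrand α θ (fun j => weight α (y j)) ∂(logIntensity W P s)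
        - (∑ j, θ j * compensatorShift α (logIntensity W P s) r j : ℝ) * Complex.I := by
  set M := logIntensity W P s with hM
  have hw := measurable_weight α
  have hmeas : ∀ θ : ι → ℝ, Measurable (fun y : ι → ℝ =>
      levyIntegrand α θ (fun j => weight α (y j))) :=
    fun θ => (measurable_levyIntegrand α θ).comp (by fun_prop)
  have hshift : Measurable fun (y : ι → ℝ) j => y j + α * Real.log r := by fun_prop
  have hmap := h.logIntensity_map_add_const s (α * Real.log r)
  rw [exp_mul_log hr, ← hM] at hmap
  have hint2 : ∀ θ : ι → ℝ, Integrable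
      (fun y => levyIntegrand α θ (fun j => r * weight α (y j))) M := by
    intro θ
    have h1 : Integrable (fun y => levyIntegrand α θ (fun j => weight α (y j)))
        (ENNReal.ofReal (r ^ α) • M) :=
      (h.integrable_levyIntegrand hα s θ).smul_measure ENNReal.ofReal_ne_top
    rw [← hmap, integrable_map_measure (hmeas θ).aestronglyMeasurable hshift.aemeasurable] at h1
    simpa only [Function.comp_def, weight_add_mul_log hα.1 hr] using h1
  have hscale : (r ^ α : ℝ) * ∫ y, levyIntegrand α θ (fun j => weight α (y j)) ∂M
      = ∫ y, levyIntegrand α θ (fun j => r * weight α (y j)) ∂M := by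
    have h1 := integral_map (μ := M) hshift.aemeasurable (hmeas θ).aestronglyMeasurable
    rw [hmap, integral_smul_measure, ENNReal.toReal_ofReal (by positivity)] at h1
    simpa only [weight_add_mul_log hα.1 hr, Complex.real_smul] using h1
  have hdiff : ∀ (θ : ι → ℝ) (x : ι → ℝ), levyIntegrand α θ (fun j => r * x j)
      = levyIntegrand α (r • θ) x
        + (∑ j, θ j * (r * compensator α (x j) - compensator α (r * x j)) : ℝ) * Complex.I := by
    intro θ x
    have h1 : ∑ j, (r • θ) j * x j = ∑ j, θ j * (r * x j) :=
      Finset.sum_congr rfl fun j _ => by simp only [Pi.smul_apply, smul_eq_mul]; ring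
    have h2 : ∑ j, (r • θ) j * compensator α (x j) = ∑ j, θ j * (r * compensator α (x j)) :=
      Finset.sum_congr rfl fun j _ => by simp only [Pi.smul_apply, smul_eq_mul]; ring
    simp only [levyIntegrand, h1, h2, mul_sub, Finset.sum_sub_distrib]
    push_cast
    ring
  -- The defect in coordinate `j` is the imaginary part of a difference of two integrable
  -- integrands, taken at the `j`-th unit vector.
  have hK : ∀ j, Integrable (fun y => r * compensator α (weight α (y j))
      - compensator α (r * weight α (y j))) M := by
    intro j
    have h1 := ((hint2 (Pi.single j 1)).sub (h.integrable_levyIntegrand hα s (r • Pi.single j 1))).im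
    refine h1.congr (ae_of_all _ fun y => ?_)
    simp only [Pi.sub_apply, hdiff, add_sub_cancel_left]
    rw [Finset.sum_eq_single j (fun k _ hk => by simp [hk]) (by simp)]
    simp
  rw [hscale]
  simp_rw [hdiff θ]
  have hKs : Integrable (fun y => ((∑ j, θ j * (r * compensator α (weight α (y j))
      - compensator α (r * weight α (y j))) : ℝ) : ℂ)) M :=
    (integrable_finsetSum Finset.univ fun j _ => (hK j).const_mul (θ j)).ofReal
  have hi : Integrable (fun y => levyIntegrand α (r • θ) (fun j => weight α (y j))) M :=
    h.integrable_levyIntegrand hα s (r • θ)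
  rw [integral_add hi (hKs.mul_const Complex.I), integral_mul_const]
  have : ∫ y, ((∑ j, θ j * (r * compensator α (weight α (y j))
      - compensator α (r * weight α (y j))) : ℝ) : ℂ) ∂M
      = ((∑ j, θ j * compensatorShift α M r j : ℝ) : ℂ) := by
    rw [integral_complex_ofReal, integral_finsetSum _ fun j _ => (hK j).const_mul (θ j)]
    simp_rw [integral_const_mul]
    rfl
  rw [this]
  ring

/-- As C^α = A^α + B^α, the homogeneous parts of the exponents agree. The terms linear in θ do not,
and their difference K(C) - K(A) - K(B) is the vector D. -/
theorem isStableProcess_centeredSeries (h : IsGaussPoissonFamily Γ U W P) {α : ℝ} (hα : α ∈ Set.Ioo (0 : ℝ) 2)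
    {S : T → Ω → ℝ} (hS : IsCenteredSeries α U W P S) : IsStableProcess α S P := by
  classical
  intro I
  have := h.isProbabilityMeasure
  have hSm := hS.measurable
  set Q := P.map (fun ω (t : I) => S t ω) with hQ
  have hQp : IsProbabilityMeasure Q :=
    Measure.isProbabilityMeasure_map (μ := P) (f := fun ω (t : I) => S t ω) (by fun_prop)
  refine ⟨hQp, fun A B hA hB => ?_⟩
  set C : ℝ := (A ^ α + B ^ α) ^ (1 / α) with hC
  have hAB : 0 < A ^ α + B ^ α := by positivity
  have hC0 : 0 < C := Real.rpow_pos_of_pos hAB _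
  have hCα : C ^ α = A ^ α + B ^ α := by
    rw [hC, ← Real.rpow_mul hAB.le, one_div_mul_cancel hα.1.ne', Real.rpow_one]
  set s : I → T := fun t => (t : T)
  set K := compensatorShift α (logIntensity W P s)
  set Φ : (I → ℝ) → ℂ := fun θ =>
    ∫ y, levyIntegrand α θ (fun j => weight α (y j)) ∂(logIntensity W P s) with hΦ
  have hscale : ∀ (r : ℝ), 0 < r → ∀ θ, Φ (r • θ)
      = (r ^ α : ℝ) * Φ θ - (∑ j, θ j * K r j : ℝ) * Complex.I :=
    fun r hr θ => h.integral_levyIntegrand_smul hα s θ hr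
  have hcf : ∀ (r : ℝ) (L : StrongDual ℝ (I → ℝ)), ∫ x, Complex.exp (L (r • x) * Complex.I) ∂Q
      = Complex.exp (Φ (r • fun j => L (Pi.single j 1))) := by
    intro r L
    have := h.charFunDual_centeredSeries hα hS s (r • L)
    rw [charFunDual_apply] at this
    simp only [map_smul]
    exact this
  refine ⟨fun j => K C j - K A j - K B j, ?_⟩
  have hm1 : Measurable fun p : (I → ℝ) × (I → ℝ) => A • p.1 + B • p.2 := by fun_prop
  have hm2 : ∀ D : I → ℝ, Measurable fun x : I → ℝ => C • x + D := fun D => by fun_prop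
  have := Measure.isProbabilityMeasure_map (μ := Q.prod Q) hm1.aemeasurable
  have := Measure.isProbabilityMeasure_map (μ := Q)
    (hm2 fun j => K C j - K A j - K B j).aemeasurable
  refine Measure.ext_of_charFunDual (funext fun L => ?_)
  rw [charFunDual_apply, charFunDual_apply, integral_map hm1.aemeasurable (by fun_prop),
    integral_map (hm2 _).aemeasurable (by fun_prop)]
  simp only [map_add, Complex.ofReal_add, add_mul, Complex.exp_add]
  rw [integral_prod_mul (fun x => Complex.exp (L (A • x) * Complex.I))
    (fun x => Complex.exp (L (B • x) * Complex.I)), integral_mul_const, hcf, hcf, hcf,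
    ← Complex.exp_add, ← Complex.exp_add, hscale A hA, hscale B hB, hscale C hC0, hCα]
  congr 1
  rw [dual_apply_eq_sum L fun j => K C j - K A j - K B j]
  simp only [mul_sub, Finset.sum_sub_distrib]
  push_cast
  ring

end IsGaussPoissonFamily

end Stability

/-! ### The Laplace exponent: analyticity and boundary values -/

section LaplaceExponent

theorem norm_exp_neg_sub_one_le {w : ℂ} (hw : 0 ≤ w.re) :
    ‖Complex.exp (-w) - 1‖ ≤ 2 ∧ ‖Complex.exp (-w) - 1‖ ≤ 2 * ‖w‖ ∧
      ‖Complex.exp (-w) - 1 + w‖ ≤ 3 * ‖w‖ ^ 2 := by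
  have h2 : ‖Complex.exp (-w) - 1‖ ≤ 2 := by
    refine (norm_sub_le _ _).trans ?_
    rw [Complex.norm_exp, norm_one]
    have : Real.exp (-w).re ≤ 1 := by simpa using hw
    linarith
  refine ⟨h2, ?_, ?_⟩
  · rcases le_or_gt ‖w‖ 1 with h | h
    · have := Complex.norm_exp_sub_one_le (x := -w) (by simpa using h)
      simpa using this
    · linarith
  · rcases le_or_gt ‖w‖ 1 with h | h
    · have := Complex.norm_exp_sub_one_sub_id_le (x := -w) (by simpa using h)
      rw [sub_neg_eq_add, norm_neg] at this
      nlinarith [sq_nonneg ‖w‖]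
    · have := norm_add_le (Complex.exp (-w) - 1) w
      nlinarith

/-- The compensated Laplace kernel. -/
noncomputable def laplaceIntegrand (α : ℝ) (z : ℂ) (x : ℝ) : ℂ :=
  Complex.exp (-(z * x)) - 1 + z * compensator α x

theorem measurable_laplaceIntegrand (α : ℝ) (z : ℂ) : Measurable (laplaceIntegrand α z) := by
  have := measurable_compensator α
  unfold laplaceIntegrand
  fun_prop

theorem norm_laplaceIntegrand_le (α : ℝ) {z : ℂ} (hz : 0 ≤ z.re) {x : ℝ} (hx : 0 ≤ x) :
    ‖laplaceIntegrand α z x‖ ≤ 4 * (1 + ‖z‖) ^ 2 * majorant α x := by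
  obtain ⟨h1, h2, h3⟩ := norm_exp_neg_sub_one_le (w := z * x) (by simpa using mul_nonneg hz hx)
  have hn : ‖z * (x : ℂ)‖ = ‖z‖ * x := by rw [norm_mul, Complex.norm_real, Real.norm_of_nonneg hx]
  rw [hn] at h2 h3
  have hz0 := norm_nonneg z
  rcases lt_trichotomy α 1 with hα | rfl | hα
  · rw [laplaceIntegrand, compensator_eq_zero hα]
    simp only [Complex.ofReal_zero, mul_zero, add_zero, majorant, if_pos hα, if_pos hα.le]
    split_ifs with h
    · rw [pow_one]
      nlinarith [mul_nonneg hz0 hx, mul_nonneg (mul_nonneg hz0 hx) hz0]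
    · rw [pow_zero]
      nlinarith
  · rw [laplaceIntegrand, compensator_one]
    simp only [majorant, lt_irrefl, if_false, le_refl, if_true, pow_zero]
    split_ifs with h
    · have hs : ‖((Real.sin x - x : ℝ) : ℂ)‖ ≤ x ^ 2 := by
        rw [Complex.norm_real, Real.norm_eq_abs, abs_sub_comm, abs_of_nonneg
          (sub_nonneg.mpr (Real.sin_le hx))]
        rcases hx.eq_or_lt with rfl | hx0
        · simp
        · have := Real.sin_gt_sub_cube hx0
          nlinarith [sq_nonneg x, mul_le_mul_of_nonneg_right h (sq_nonneg x)]
      have he : Complex.exp (-(z * x)) - 1 + z * (Real.sin x : ℝ)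
          = (Complex.exp (-(z * x)) - 1 + z * x) + z * ((Real.sin x - x : ℝ) : ℂ) := by
        push_cast
        ring
      rw [he]
      refine (norm_add_le _ _).trans ?_
      rw [norm_mul]
      nlinarith [mul_le_mul_of_nonneg_left hs hz0, sq_nonneg x, mul_nonneg hz0 (sq_nonneg x),
        mul_nonneg (mul_nonneg hz0 hz0) (sq_nonneg x)]
    · refine (norm_add_le _ _).trans ?_
      rw [norm_mul, Complex.norm_real, Real.norm_eq_abs]
      nlinarith [mul_le_mul_of_nonneg_left (Real.abs_sin_le_one x) hz0]
  · rw [laplaceIntegrand, compensator_eq_id hα]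
    simp only [majorant, if_neg hα.not_gt, if_neg hα.not_ge, pow_one]
    split_ifs with h
    · nlinarith [sq_nonneg x, mul_nonneg hz0 (sq_nonneg x),
        mul_nonneg (mul_nonneg hz0 hz0) (sq_nonneg x)]
    · push Not at h
      refine (norm_add_le _ _).trans ?_
      rw [hn]
      nlinarith [mul_nonneg hz0 hx, mul_nonneg (mul_nonneg hz0 hx) hz0]

/-- The Laplace exponent of the totally skewed stable law. -/
noncomputable def laplaceExponent (α : ℝ) (z : ℂ) : ℂ :=
  ∫ y, laplaceIntegrand α z (weight α y) ∂expIntensity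

variable {α : ℝ}

theorem integrable_laplaceIntegrand (hα : α ∈ Set.Ioo (0 : ℝ) 2) {z : ℂ} (hz : 0 ≤ z.re) :
    Integrable (fun y => laplaceIntegrand α z (weight α y)) expIntensity := by
  refine ((integrable_majorant hα).const_mul (4 * (1 + ‖z‖) ^ 2)).mono'
    ((measurable_laplaceIntegrand α z).comp (measurable_weight α)).aestronglyMeasurable
    (ae_of_all _ fun y => ?_)
  exact norm_laplaceIntegrand_le α hz (weight_pos α y).le

theorem hasDerivAt_laplaceIntegrand (α : ℝ) (z : ℂ) (x : ℝ) :
    HasDerivAt (fun z => laplaceIntegrand α z x)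
      (Complex.exp (-(z * x)) * (-x) + compensator α x) z := by
  have h1 : HasDerivAt (fun z : ℂ => -(z * x)) (-x : ℂ) z := by
    have := ((hasDerivAt_id z).mul_const (x : ℂ)).fun_neg
    simpa using this
  have h2 : HasDerivAt (fun z : ℂ => z * (compensator α x : ℂ)) (compensator α x : ℂ) z := by
    simpa using (hasDerivAt_id z).mul_const (compensator α x : ℂ)
  exact (h1.cexp.sub_const 1).add h2

/-- Differentiation under the integral. Cauchy's estimate bounds the derivative of the integrand by
the integrand itself on circles of radius Re z₀ / 2, which stay in the closed half-plane where the
majorant applies. -/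
theorem differentiableOn_laplaceExponent (hα : α ∈ Set.Ioo (0 : ℝ) 2) :
    DifferentiableOn ℂ (laplaceExponent α) {z | 0 < z.re} := by
  intro z₀ (hz₀ : 0 < z₀.re)
  set δ := z₀.re / 2 with hδ
  have hδ0 : 0 < δ := by positivity
  have hball : ∀ z ∈ Metric.ball z₀ δ, ∀ w ∈ Metric.sphere z δ,
      0 ≤ w.re ∧ ‖w‖ ≤ ‖z₀‖ + 2 * δ := by
    intro z hz w hw
    rw [Metric.mem_ball, dist_eq_norm] at hz
    rw [Metric.mem_sphere, dist_eq_norm] at hw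
    have h1 := (Complex.abs_re_le_norm (w - z₀)).trans
      ((norm_sub_le_norm_sub_add_norm_sub w z z₀))
    have h2 := neg_le_of_abs_le h1
    rw [Complex.sub_re] at h2
    refine ⟨by linarith, ?_⟩
    have h3 : ‖w‖ ≤ ‖w - z‖ + ‖z - z₀‖ + ‖z₀‖ := by
      calc ‖w‖ = ‖(w - z) + (z - z₀) + z₀‖ := by congr 1; ring
        _ ≤ _ := norm_add₃_le
    linarith
  have hw := measurable_weight α
  have hc := measurable_compensator α
  have key := hasDerivAt_integral_of_dominated_loc_of_deriv_le (μ := expIntensity) (𝕜 := ℂ)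
    (F := fun z y => laplaceIntegrand α z (weight α y)) (x₀ := z₀) (s := Metric.ball z₀ δ)
    (F' := fun z y => Complex.exp (-(z * weight α y)) * (-(weight α y : ℂ))
      + compensator α (weight α y))
    (bound := fun y => 4 * (1 + (‖z₀‖ + 2 * δ)) ^ 2 * majorant α (weight α y) / δ)
    (Metric.ball_mem_nhds z₀ hδ0)
    (Eventually.of_forall fun z =>
      ((measurable_laplaceIntegrand α z).comp (measurable_weight α)).aestronglyMeasurable)
    (integrable_laplaceIntegrand hα hz₀.le) (by fun_prop)
    (ae_of_all _ fun y z hz => ?_)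
    (((integrable_majorant hα).const_mul _).div_const δ)
    (ae_of_all _ fun y z _ => hasDerivAt_laplaceIntegrand α z _)
  · exact key.2.differentiableAt.differentiableWithinAt
  · rw [← (hasDerivAt_laplaceIntegrand α z (weight α y)).deriv]
    refine Complex.norm_deriv_le_of_forall_mem_sphere_norm_le hδ0 ?_ fun w hw => ?_
    · exact Differentiable.diffContOnCl fun w => (hasDerivAt_laplaceIntegrand α w _).differentiableAt
    · obtain ⟨h1, h2⟩ := hball z hz w hw
      refine (norm_laplaceIntegrand_le α h1 (weight_pos α y).le).trans ?_
      have := majorant_nonneg α (weight_pos α y).le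
      gcongr

theorem tendsto_laplaceExponent (hα : α ∈ Set.Ioo (0 : ℝ) 2) {z : ℂ} {u : ℕ → ℂ}
    (hu : ∀ n, 0 ≤ (u n).re) (hlim : Tendsto u atTop (𝓝 z)) :
    Tendsto (fun n => laplaceExponent α (u n)) atTop (𝓝 (laplaceExponent α z)) := by
  obtain ⟨C, hC⟩ := hlim.norm.bddAbove_range
  refine tendsto_integral_of_dominated_convergence
    (fun y => 4 * (1 + C) ^ 2 * majorant α (weight α y)) (fun n =>
      ((measurable_laplaceIntegrand α _).comp (measurable_weight α)).aestronglyMeasurable)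
    ((integrable_majorant hα).const_mul _) (fun n => ae_of_all _ fun y => ?_)
    (ae_of_all _ fun y => ?_)
  · refine (norm_laplaceIntegrand_le α (hu n) (weight_pos α y).le).trans ?_
    have := majorant_nonneg α (weight_pos α y).le
    have : ‖u n‖ ≤ C := hC ⟨n, rfl⟩
    gcongr
  · exact ((hasDerivAt_laplaceIntegrand α z (weight α y)).continuousAt.tendsto).comp hlim

/-- A function on the slit plane that agrees with the Laplace exponent on the positive half-line
agrees with it on the closed right half-plane without the origin. -/
theorem laplaceExponent_eq_of_eq_pos (hα : α ∈ Set.Ioo (0 : ℝ) 2) {G : ℂ → ℂ}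
    (hG : DifferentiableOn ℂ G Complex.slitPlane)
    (h : ∀ r : ℝ, 0 < r → laplaceExponent α r = G r) {z : ℂ} (hz : 0 ≤ z.re) (hz0 : z ≠ 0) :
    laplaceExponent α z = G z := by
  have hopen : IsOpen {z : ℂ | 0 < z.re} := isOpen_lt continuous_const Complex.continuous_re
  have hsub : {z : ℂ | 0 < z.re} ⊆ Complex.slitPlane := fun z hz => Or.inl hz
  have heq : Set.EqOn (laplaceExponent α) G {z | 0 < z.re} := by
    refine ((differentiableOn_laplaceExponent hα).analyticOnNhd hopen).eqOn_of_preconnected_of_frequently_eq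
      ((hG.mono hsub).analyticOnNhd hopen) (convex_halfSpace_re_gt 0).isPreconnected
      (z₀ := 1) (by simp) ?_
    -- Positive reals accumulating at 1, as required by the identity theorem.
    have hlim : Tendsto (fun n : ℕ => ((1 + 1 / ((n : ℝ) + 1) : ℝ) : ℂ)) atTop (𝓝[≠] 1) := by
      refine tendsto_nhdsWithin_iff.mpr ⟨?_, Eventually.of_forall fun n => ?_⟩
      · have := (tendsto_one_div_add_atTop_nhds_zero_nat (𝕜 := ℝ)).const_add 1
        rw [add_zero] at this
        exact_mod_cast (Complex.continuous_ofReal.tendsto (1 : ℝ)).comp this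
      · have : (0 : ℝ) < 1 / ((n : ℝ) + 1) := by positivity
        intro hn
        have h1 : (1 + 1 / ((n : ℝ) + 1) : ℝ) = 1 :=
          Complex.ofReal_injective (hn.trans Complex.ofReal_one.symm)
        linarith
    exact hlim.frequently (Frequently.of_forall fun n => h _ (by positivity))
  have hslit : z ∈ Complex.slitPlane := by
    rcases hz.eq_or_lt with h0 | h0
    · right
      intro him
      exact hz0 (Complex.ext h0.symm him)
    · exact Or.inl h0
  -- Points of the imaginary axis are approached from the open half-plane, where the identity is
  -- already known.
  have hlim : Tendsto (fun n : ℕ => z + ((1 / ((n : ℝ) + 1) : ℝ) : ℂ)) atTop (𝓝 z) := by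
    have := (Complex.continuous_ofReal.tendsto 0).comp
      (tendsto_one_div_add_atTop_nhds_zero_nat (𝕜 := ℝ))
    simpa using this.const_add z
  have hre : ∀ n : ℕ, 0 < (z + ((1 / ((n : ℝ) + 1) : ℝ) : ℂ)).re := fun n => by
    have : (0 : ℝ) < 1 / ((n : ℝ) + 1) := by positivity
    rw [Complex.add_re, Complex.ofReal_re]
    linarith
  have h1 := tendsto_laplaceExponent hα (fun n => (hre n).le) hlim
  have h2 : Tendsto (fun n : ℕ => G (z + ((1 / ((n : ℝ) + 1) : ℝ) : ℂ))) atTop (𝓝 (G z)) :=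
    ((hG.differentiableAt (Complex.isOpen_slitPlane.mem_nhds hslit)).continuousAt.tendsto).comp hlim
  refine tendsto_nhds_unique h1 (h2.congr fun n => ?_)
  exact (heq (hre n)).symm

end LaplaceExponent

/-! ### Evaluation of the Laplace exponent and the stable characteristic function -/

section LaplaceExponentValue

variable {α : ℝ}

theorem integrable_compensator_scale (hα : α ∈ Set.Ioo (0 : ℝ) 2) {r : ℝ} (hr : 0 < r) :
    Integrable (fun y => laplaceIntegrand α 1 (r * weight α y)) expIntensity ∧
    Integrable (fun y => r * compensator α (weight α y) - compensator α (r * weight α y))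
      expIntensity := by
  have h1 : Integrable (fun y => laplaceIntegrand α 1 (weight α y))
      (ENNReal.ofReal (Real.exp (α * Real.log r)) • expIntensity) :=
    (integrable_laplaceIntegrand hα (by simp)).smul_measure ENNReal.ofReal_ne_top
  have hm : Measurable fun y => laplaceIntegrand α 1 (weight α y) :=
    (measurable_laplaceIntegrand α 1).comp (measurable_weight α)
  rw [← expIntensity_map_add, integrable_map_measure hm.aestronglyMeasurable (by fun_prop)] at h1
  simp only [Function.comp_def, weight_add_mul_log hα.1 hr] at h1
  refine ⟨h1, ?_⟩
  have h2 := ((integrable_laplaceIntegrand hα (z := (r : ℂ)) (by simpa using hr.le)).sub h1).re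
  refine h2.congr (ae_of_all _ fun y => ?_)
  simp only [Pi.sub_apply, laplaceIntegrand]
  have : (Complex.exp (-(r * (weight α y : ℝ))) - 1 + r * (compensator α (weight α y) : ℝ)
      - (Complex.exp (-(1 * ((r * weight α y : ℝ) : ℂ))) - 1
        + 1 * (compensator α (r * weight α y) : ℝ)) : ℂ)
      = ((r * compensator α (weight α y) - compensator α (r * weight α y) : ℝ) : ℂ) := by
    push_cast
    ring_nf
  rw [this]
  simp

theorem laplaceExponent_ofReal (hα : α ∈ Set.Ioo (0 : ℝ) 2) {r : ℝ} (hr : 0 < r) :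
    laplaceExponent α r = (r ^ α : ℝ) * laplaceExponent α 1
      + (∫ y, (r * compensator α (weight α y) - compensator α (r * weight α y)) ∂expIntensity : ℝ) := by
  obtain ⟨h1, h2⟩ := integrable_compensator_scale hα hr
  have h3 : (r ^ α : ℝ) * laplaceExponent α 1
      = ∫ y, laplaceIntegrand α 1 (r * weight α y) ∂expIntensity := by
    have h := integral_map (μ := expIntensity) (φ := fun u => u + α * Real.log r) (by fun_prop)
      ((measurable_laplaceIntegrand α 1).comp (measurable_weight α)).aestronglyMeasurable
    rw [expIntensity_map_add, exp_mul_log hr, integral_smul_measure,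
      ENNReal.toReal_ofReal (by positivity)] at h
    simpa only [laplaceExponent, Function.comp_def, weight_add_mul_log hα.1 hr,
      Complex.real_smul] using h
  have h2' : Integrable (fun y => ((r * compensator α (weight α y)
      - compensator α (r * weight α y) : ℝ) : ℂ)) expIntensity := h2.ofReal
  rw [h3, ← integral_complex_ofReal, ← integral_add h1 h2', laplaceExponent]
  refine integral_congr_ae (ae_of_all _ fun y => ?_)
  simp only [laplaceIntegrand]
  push_cast
  ring_nf

/-- A Frullani integral: in the coordinate v = e^{-y}, the integral up to R equals r times that of
sin(1/v) over [R/r, R]. There sin(1/v) is 1/v up to O(R^{-2}), so the limit is r log r. This is the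
source of the logarithm at α = 1. -/
theorem integral_sin_scale {r : ℝ} (hr : 0 < r) :
    ∫ y, (r * compensator 1 (weight 1 y) - compensator 1 (r * weight 1 y)) ∂expIntensity
      = r * Real.log r := by
  have hint := (integrable_compensator_scale (α := 1) (by norm_num) hr).2
  set f : ℝ → ℝ := fun v => r * Real.sin (v⁻¹) - Real.sin (r * v⁻¹) with hf
  have hfy : (fun y => r * compensator 1 (weight 1 y) - compensator 1 (r * weight 1 y))
      = fun y => f (Real.exp (-y)) := by
    funext y
    simp only [compensator_one, weight, hf, div_one, Real.rpow_neg_one]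
  rw [hfy] at hint ⊢
  rw [← measurableEmbedding_exp_neg.integral_map (g := f), expIntensity_map_exp_neg]
  have hint' : IntegrableOn f (Set.Ioi 0) := by
    have := measurableEmbedding_exp_neg.integrable_map_iff (g := f) (μ := expIntensity)
    rw [expIntensity_map_exp_neg] at this
    exact this.mpr hint
  have hlim := intervalIntegral_tendsto_integral_Ioi 0 hint' tendsto_id
  refine tendsto_nhds_unique hlim ?_
  have hsin : ∀ a b : ℝ, IntervalIntegrable (fun v => Real.sin (v⁻¹)) volume a b := by
    intro a b
    refine (intervalIntegrable_const (c := (1 : ℝ))).mono_fun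
      (by fun_prop) (ae_of_all _ fun v => ?_)
    simpa using Real.abs_sin_le_one _
  have hsinr : ∀ a b : ℝ, IntervalIntegrable (fun v => Real.sin (r * v⁻¹)) volume a b := by
    intro a b
    refine (intervalIntegrable_const (c := (1 : ℝ))).mono_fun
      (by fun_prop) (ae_of_all _ fun v => ?_)
    simpa using Real.abs_sin_le_one _
  have hval : ∀ R : ℝ, ∫ v in (0 : ℝ)..R, f v = r * ∫ v in (R / r)..R, Real.sin (v⁻¹) := by
    intro R
    have h1 := intervalIntegral.integral_comp_div (a := 0) (b := R)
      (fun v => Real.sin (v⁻¹)) hr.ne'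
    simp only [inv_div, zero_div, smul_eq_mul] at h1
    simp only [hf]
    rw [intervalIntegral.integral_sub ((hsin 0 R).const_mul r) (hsinr 0 R),
      intervalIntegral.integral_const_mul]
    simp_rw [← div_eq_mul_inv]
    rw [h1, ← mul_sub, intervalIntegral.integral_interval_sub_left (hsin 0 R) (hsin 0 (R / r))]
  simp only [id, hval]
  refine Tendsto.const_mul r ?_
  -- The whole interval between R/r and R lies above cR, whichever endpoint is the smaller.
  set c := min (1 / r) 1 with hc
  have hc0 : 0 < c := by positivity
  refine tendsto_of_tendsto_of_dist (tendsto_const_nhds (x := Real.log r)) ?_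
  have hz : Tendsto (fun R : ℝ => (|1 - 1 / r| / c ^ 2) * R⁻¹) atTop (𝓝 0) := by
    simpa using tendsto_inv_atTop_zero.const_mul (|1 - 1 / r| / c ^ 2)
  refine squeeze_zero' (Eventually.of_forall fun _ => dist_nonneg) ?_ hz
  filter_upwards [eventually_gt_atTop 0] with R hR
  have hmem : ∀ v ∈ Set.uIoc (R / r) R, c * R ≤ v := by
    intro v hv
    have h1 := (Set.mem_uIoc.mp hv)
    have h2 : c * R ≤ R / r := by
      rw [div_eq_mul_one_div, mul_comm]
      gcongr
      exact min_le_left _ _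
    have h3 : c * R ≤ R := by
      have : c ≤ 1 := min_le_right _ _
      nlinarith
    rcases h1 with h | h <;> linarith [h.1]
  have hlog : ∫ v in (R / r)..R, v⁻¹ = Real.log r := by
    rw [integral_inv_of_pos (by positivity) hR]
    congr 1
    field_simp
  have hinv : IntervalIntegrable (fun v : ℝ => v⁻¹) volume (R / r) R := by
    refine intervalIntegral.intervalIntegrable_inv (fun v hv => ?_) continuousOn_id
    exact ne_of_gt ((Set.ordConnected_Ioi (a := (0:ℝ))).uIcc_subset
      (show (0:ℝ) < R / r by positivity) hR hv)
  rw [← hlog, dist_eq_norm, ← intervalIntegral.integral_sub hinv (hsin _ _)]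
  have := intervalIntegral.norm_integral_le_of_norm_le_const (a := R / r) (b := R)
    (f := fun v : ℝ => v⁻¹ - Real.sin (v⁻¹)) (C := ((c * R) ^ 2)⁻¹) (fun v hv => ?_)
  · refine this.trans (le_of_eq ?_)
    have : R - R / r = R * (1 - 1 / r) := by ring
    rw [this, abs_mul, abs_of_pos hR]
    field_simp
  · have h1 := hmem v hv
    have hv0 : 0 < v := lt_of_lt_of_le (by positivity) h1
    have hw : 0 < v⁻¹ := by positivity
    have h2 : v⁻¹ - Real.sin v⁻¹ ≤ (v⁻¹) ^ 2 := by
      rcases le_or_gt v⁻¹ 1 with h | h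
      · have := Real.sin_gt_sub_cube hw
        nlinarith [sq_nonneg v⁻¹, mul_le_mul_of_nonneg_right h (sq_nonneg v⁻¹)]
      · have h3 : 0 ≤ v⁻¹ ^ 2 - v⁻¹ := by nlinarith
        have h4 := Real.neg_one_le_sin v⁻¹
        rcases le_or_gt v⁻¹ 3 with h5 | h5
        · have := Real.sin_nonneg_of_nonneg_of_le_pi hw.le (h5.trans Real.pi_gt_three.le)
          linarith
        · nlinarith
    rw [Real.norm_eq_abs, abs_of_nonneg (sub_nonneg.mpr (Real.sin_le hw.le))]
    refine h2.trans ?_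
    rw [inv_pow]
    gcongr

/-- The compensator is zero or the identity, so it scales without defect. The resulting power law on
the positive half-line is then continued analytically. -/
theorem laplaceExponent_of_ne_one (hα : α ∈ Set.Ioo (0 : ℝ) 2) (h1 : α ≠ 1) {z : ℂ}
    (hz : 0 ≤ z.re) (hz0 : z ≠ 0) : laplaceExponent α z = z ^ (α : ℂ) * laplaceExponent α 1 := by
  refine laplaceExponent_eq_of_eq_pos hα (G := fun z => z ^ (α : ℂ) * laplaceExponent α 1)
    (fun z hz => ?_) (fun r hr => ?_) hz hz0
  · exact (((differentiableAt_id).cpow_const hz).mul_const _).differentiableWithinAt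
  · have h0 : ∀ y, r * compensator α (weight α y) - compensator α (r * weight α y) = 0 := by
      intro y
      rcases lt_or_gt_of_ne h1 with h | h
      · simp [compensator_eq_zero h]
      · simp [compensator_eq_id h]
    rw [laplaceExponent_ofReal hα hr, Complex.ofReal_cpow hr.le]
    simp [h0]

theorem laplaceExponent_one {z : ℂ} (hz : 0 ≤ z.re) (hz0 : z ≠ 0) :
    laplaceExponent 1 z = z * laplaceExponent 1 1 + z * Complex.log z := by
  refine laplaceExponent_eq_of_eq_pos (by norm_num)
    (G := fun z => z * laplaceExponent 1 1 + z * Complex.log z)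
    (fun z hz => ?_) (fun r hr => ?_) hz hz0
  · exact ((differentiableAt_id.mul_const _).add
      (differentiableAt_id.mul (differentiableAt_id.clog hz))).differentiableWithinAt
  · rw [laplaceExponent_ofReal (by norm_num) hr, integral_sin_scale hr, Real.rpow_one]
    push_cast
    rw [Complex.ofReal_log hr.le]

theorem laplaceExponent_one_eq_ofReal (α : ℝ) : laplaceExponent α 1
    = ((∫ y, (Real.exp (-weight α y) - 1 + compensator α (weight α y)) ∂expIntensity : ℝ) : ℂ) := by
  rw [laplaceExponent, ← integral_complex_ofReal]
  simp [laplaceIntegrand]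

/-- The real number `∫ (e^{-x} - 1 + h(x)) α x^{-α-1} dx`. -/
noncomputable def laplaceConstant (α : ℝ) : ℝ := (laplaceExponent α 1).re

theorem ofReal_laplaceConstant (α : ℝ) : (laplaceConstant α : ℂ) = laplaceExponent α 1 := by
  rw [laplaceConstant, laplaceExponent_one_eq_ofReal, Complex.ofReal_re]

/-- For α < 1 the constant integrates e^{-x} - 1 < 0 and the cosine is positive; for α > 1 it
integrates e^{-x} - 1 + x > 0 and the cosine is negative. The sign makes the scale parameter
positive. -/
theorem laplaceConstant_mul_cos_neg (hα : α ∈ Set.Ioo (0 : ℝ) 2) (h1 : α ≠ 1) :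
    laplaceConstant α * Real.cos (Real.pi * α / 2) < 0 := by
  have hi : Integrable (fun y => Real.exp (-weight α y) - 1 + compensator α (weight α y))
      expIntensity := by
    refine (integrable_laplaceIntegrand hα (z := 1) (by simp)).re.congr (ae_of_all _ fun y => ?_)
    simp [laplaceIntegrand, Complex.exp_re]
  have hv : laplaceConstant α
      = ∫ y, (Real.exp (-weight α y) - 1 + compensator α (weight α y)) ∂expIntensity := by
    rw [laplaceConstant, laplaceExponent_one_eq_ofReal, Complex.ofReal_re]
  have huniv : 0 < expIntensity Set.univ := by
    refine lt_of_lt_of_le ?_ (measure_mono (Set.subset_univ {u | Real.exp (-u) < 1}))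
    rw [expIntensity_setOf_exp_neg_lt]
    simp
  have hpi := Real.pi_pos
  have hexp : ∀ y, -weight α y + 1 < Real.exp (-weight α y) := fun y =>
    Real.add_one_lt_exp (neg_ne_zero.mpr (weight_pos α y).ne')
  rcases lt_or_gt_of_ne h1 with h | h
  · refine mul_neg_of_neg_of_pos ?_ (Real.cos_pos_of_mem_Ioo ⟨?_, ?_⟩)
    · rw [hv, ← neg_pos, ← integral_neg]
      have hpos : ∀ y, 0 < -(Real.exp (-weight α y) - 1 + compensator α (weight α y)) := by
        intro y
        have : Real.exp (-weight α y) < 1 := 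
              Real.exp_lt_one_iff.mpr (neg_neg_of_pos (weight_pos α y))
        rw [compensator_eq_zero h]
        linarith
      rw [integral_pos_iff_support_of_nonneg (fun y => (hpos y).le) hi.neg]
      rwa [show Function.support _ = Set.univ from Set.eq_univ_of_forall fun y => (hpos y).ne']
    · nlinarith [hα.1]
    · nlinarith
  · refine mul_neg_of_pos_of_neg ?_ (Real.cos_neg_of_pi_div_two_lt_of_lt ?_ ?_)
    · rw [hv]
      have hpos : ∀ y, 0 < Real.exp (-weight α y) - 1 + compensator α (weight α y) := by
        intro y
        rw [compensator_eq_id h]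
        linarith [hexp y]
      rw [integral_pos_iff_support_of_nonneg (fun y => (hpos y).le) hi]
      rwa [show Function.support _ = Set.univ from Set.eq_univ_of_forall fun y => (hpos y).ne']
    · nlinarith
    · nlinarith [hα.2]

theorem log_neg_mul_I {θ : ℝ} (hθ : θ ≠ 0) :
    Complex.log (-(θ * Complex.I)) = (Real.log |θ| : ℝ) - (Real.sign θ * (Real.pi / 2) : ℝ) * Complex.I := by
  rcases lt_or_gt_of_ne hθ with h | h
  · have : -(θ * Complex.I) = ((-θ : ℝ) : ℂ) * Complex.I := by push_cast; ring
    rw [this, Complex.log_ofReal_mul (by linarith) Complex.I_ne_zero, Complex.log_I,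
      Real.sign_of_neg h, abs_of_neg h]
    push_cast
    ring
  · have : -(θ * Complex.I) = (θ : ℂ) * (-Complex.I) := by ring
    rw [this, Complex.log_ofReal_mul h (neg_ne_zero.mpr Complex.I_ne_zero), Complex.log_neg_I,
      Real.sign_of_pos h, abs_of_pos h]
    push_cast
    ring

theorem abs_eq_sign_mul (θ : ℝ) : |θ| = Real.sign θ * θ := by
  rcases lt_trichotomy θ 0 with h | rfl | h
  · rw [abs_of_neg h, Real.sign_of_neg h]; ring
  · simp
  · rw [abs_of_pos h, Real.sign_of_pos h]; ring

/-- The exponential of a positive multiple of the Laplace exponent on the imaginary axis is the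
characteristic function of a totally skewed stable law. -/
theorem exists_exp_laplaceExponent_eq_stableCharFun (hα : α ∈ Set.Ioo (0 : ℝ) 2) {m : ℝ}
    (hm : 0 < m) (μ₀ : ℝ) : ∃ σ μ : ℝ, 0 < σ ∧ ∀ θ : ℝ,
      Complex.exp (m * laplaceExponent α (-(θ * Complex.I)) + (θ * μ₀ : ℝ) * Complex.I)
        = stableCharFun α σ 1 μ θ := by
  have hzero : laplaceExponent α 0 = 0 := by simp [laplaceExponent, laplaceIntegrand]
  have hne : ∀ θ : ℝ, θ ≠ 0 → -((θ : ℂ) * Complex.I) ≠ 0 := fun θ hθ =>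
    neg_ne_zero.mpr (mul_ne_zero (Complex.ofReal_ne_zero.mpr hθ) Complex.I_ne_zero)
  have hre : ∀ θ : ℝ, 0 ≤ (-((θ : ℂ) * Complex.I)).re := fun θ => by simp
  by_cases h1 : α = 1
  · subst h1
    -- With z = -iθ, the imaginary part -sign(θ) π/2 of log z turns m z log z into -m (π/2)|θ| plus
    -- a logarithmic phase; the term m z `laplaceConstant 1` is a drift.
    refine ⟨m * (Real.pi / 2), μ₀ - m * laplaceConstant 1, by positivity, fun θ => ?_⟩
    rcases eq_or_ne θ 0 with rfl | hθ
    · simp [stableCharFun, hzero]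
    rw [stableCharFun, if_pos rfl, laplaceExponent_one (hre θ) (hne θ hθ), log_neg_mul_I hθ,
      ← ofReal_laplaceConstant]
    congr 1
    have habs : ((|θ| : ℝ) : ℂ) = (Real.sign θ : ℝ) * θ := by rw [abs_eq_sign_mul]; push_cast; ring
    have hs2 : ((Real.sign θ : ℝ) : ℂ) * (Real.sign θ : ℝ) = 1 := by
      rcases lt_or_gt_of_ne hθ with h | h
      · simp [Real.sign_of_neg h]
      · simp [Real.sign_of_pos h]
    have hpi : (Real.pi : ℂ) ≠ 0 := Complex.ofReal_ne_zero.mpr Real.pi_ne_zero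
    push_cast
    rw [habs]
    generalize ((Real.sign θ : ℝ) : ℂ) = s at hs2 ⊢
    generalize ((Real.log |θ| : ℝ) : ℂ) = l
    have hI := Complex.I_mul_I
    field_simp
    linear_combination (2 * m * θ * Complex.I * l) * hs2 + (m * Real.pi * θ * s) * hI
  · have hneg := laplaceConstant_mul_cos_neg hα h1
    -- This is σ^α, the coefficient of -|θ|^α coming from the real part |θ|^α cos(πα/2) of (-iθ)^α.
    set d := -(m * (laplaceConstant α * Real.cos (Real.pi * α / 2))) with hd
    have hd0 : 0 < d := by
      rw [hd, neg_pos]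
      exact mul_neg_of_pos_of_neg hm hneg
    have hcos : Real.cos (Real.pi * α / 2) ≠ 0 := fun h => by simp [h] at hneg
    refine ⟨d ^ (1 / α), μ₀, by positivity, fun θ => ?_⟩
    have hdα : (d ^ (1 / α)) ^ α = d := by
      rw [← Real.rpow_mul hd0.le, one_div_mul_cancel hα.1.ne', Real.rpow_one]
    rcases eq_or_ne θ 0 with rfl | hθ
    · simp [stableCharFun, h1, hzero, Real.zero_rpow hα.1.ne']
    have habs : 0 < |θ| := abs_pos.mpr hθ
    have hpow : (-((θ : ℂ) * Complex.I)) ^ (α : ℂ) = (|θ| ^ α : ℝ)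
        * (Real.cos (Real.pi * α / 2) - Real.sign θ * Real.sin (Real.pi * α / 2) * Complex.I) := by
      rw [Complex.cpow_def_of_ne_zero (hne θ hθ), log_neg_mul_I hθ, sub_mul, Complex.exp_sub]
      have e1 : Complex.exp ((Real.log |θ| : ℝ) * α) = (|θ| ^ α : ℝ) := by
        rw [Real.rpow_def_of_pos habs]
        push_cast
        rfl
      have e2 : Complex.exp ((Real.sign θ * (Real.pi / 2) : ℝ) * Complex.I * α)
          = Real.cos (Real.pi * α / 2) + Real.sign θ * Real.sin (Real.pi * α / 2) * Complex.I := by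
        have : ((Real.sign θ * (Real.pi / 2) : ℝ) : ℂ) * Complex.I * α
            = ((Real.sign θ * (Real.pi * α / 2) : ℝ) : ℂ) * Complex.I := by push_cast; ring
        rw [this, Complex.exp_mul_I, ← Complex.ofReal_cos, ← Complex.ofReal_sin]
        rcases lt_or_gt_of_ne hθ with h | h
        · simp [Real.sign_of_neg h]
        · simp [Real.sign_of_pos h]
      have e3 : ((Real.cos (Real.pi * α / 2) : ℝ)
          + (Real.sign θ : ℝ) * (Real.sin (Real.pi * α / 2) : ℝ) * Complex.I : ℂ)
          * ((Real.cos (Real.pi * α / 2) : ℝ)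
          - (Real.sign θ : ℝ) * (Real.sin (Real.pi * α / 2) : ℝ) * Complex.I) = 1 := by
        have hs2 : Real.sign θ * Real.sign θ = 1 := by
          rcases lt_or_gt_of_ne hθ with h | h
          · simp [Real.sign_of_neg h]
          · simp [Real.sign_of_pos h]
        have hs2' : ((Real.sign θ : ℝ) : ℂ) * (Real.sign θ : ℝ) = 1 := by exact_mod_cast hs2
        have hsc : ((Real.cos (Real.pi * α / 2) : ℝ) : ℂ) ^ 2
            + ((Real.sin (Real.pi * α / 2) : ℝ) : ℂ) ^ 2 = 1 := by
          exact_mod_cast Real.cos_sq_add_sin_sq _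
        linear_combination hsc - (Real.sign θ : ℂ) ^ 2 * (Real.sin (Real.pi * α / 2) : ℂ) ^ 2
          * Complex.I_sq + (Real.sin (Real.pi * α / 2) : ℂ) ^ 2 * hs2'
      rw [e1, e2, div_eq_iff (left_ne_zero_of_mul_eq_one e3), mul_assoc, mul_comm _ (_ + _), e3,
        mul_one]
    rw [stableCharFun, if_neg h1, laplaceExponent_of_ne_one hα h1 (hre θ) (hne θ hθ), hpow, hdα,
      ← ofReal_laplaceConstant, hd, Real.tan_eq_sin_div_cos]
    congr 1
    have hcos' : ((Real.cos (Real.pi * α / 2) : ℝ) : ℂ) ≠ 0 := Complex.ofReal_ne_zero.mpr hcos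
    push_cast at hcos' ⊢
    field_simp

end LaplaceExponentValue

/-! ### Nonnegative linear combinations are totally skewed -/

section Skewness

theorem map_add_prod_eq_smul {E : Type*} [MeasurableSpace E] (ρ : Measure E) [SFinite ρ]
    {c : E → ℝ} (hc : Measurable c) :
    (expIntensity.prod ρ).map (fun p => p.1 + c p.2)
      = (∫⁻ v, ENNReal.ofReal (Real.exp (c v)) ∂ρ) • expIntensity := by
  have h : (fun p : ℝ × E => p.1 + c p.2) = Prod.fst ∘ fun p : ℝ × E => (p.1 + c p.2, p.2) := rfl
  rw [h, ← Measure.map_map (by fun_prop) (by fun_prop), map_shift_prod ρ hc, Measure.map_fst_prod,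
    withDensity_apply _ MeasurableSet.univ, Measure.restrict_univ]

theorem weight_add (α y c : ℝ) : weight α (y + c) = weight α y * weight α c := by
  rw [weight_eq_exp, weight_eq_exp, weight_eq_exp, add_div, Real.exp_add]

theorem weight_rpow {α : ℝ} (hα : 0 < α) (y : ℝ) : weight α y ^ α = Real.exp y := by
  rw [weight_eq_exp, ← Real.exp_mul, div_mul_cancel₀ _ hα.ne']

/-- The `α`-th power of a sum is controlled by the sum of the `α`-th powers. -/
theorem sum_rpow_le {ι : Type*} [Fintype ι] [Nonempty ι] {α : ℝ} (hα : 0 < α) {x : ι → ℝ}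
    (hx : ∀ j, 0 ≤ x j) :
    (∑ j, x j) ^ α ≤ (Fintype.card ι : ℝ) ^ α * ∑ j, x j ^ α := by
  obtain ⟨j, -, hj⟩ := Finset.exists_max_image Finset.univ x Finset.univ_nonempty
  have h1 : ∑ k, x k ≤ Fintype.card ι * x j := by
    have := Finset.sum_le_card_nsmul Finset.univ x (x j) hj
    simpa using this
  calc (∑ k, x k) ^ α ≤ (Fintype.card ι * x j) ^ α :=
        Real.rpow_le_rpow (Finset.sum_nonneg fun k _ => hx k) h1 hα.le
    _ = (Fintype.card ι : ℝ) ^ α * x j ^ α := Real.mul_rpow (by positivity) (hx j)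
    _ ≤ _ := by
        gcongr
        exact Finset.single_le_sum (f := fun k => x k ^ α)
          (fun k _ => Real.rpow_nonneg (hx k) α) (Finset.mem_univ j)

variable {T Ω : Type*} [MeasurableSpace Ω] {Γ : T → T → ℝ} {U : ℕ → Ω → ℝ} {W : ℕ → T → Ω → ℝ}
  {P : Measure Ω} {ι : Type*}

namespace IsGaussPoissonFamily

/-- Pulling out the weight of u, the combination of the weights of one point is weight(u) G(w) =
weight(u + α log G(w)). These new locations have intensity m e^{-u} du, where m is the mean of G^α.
The exponent is therefore m times the Laplace exponent at -iθ, corrected by a drift because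
compensating the sum differs from summing the compensators. -/
theorem isTotallySkewedRight (h : IsGaussPoissonFamily Γ U W P) {α : ℝ}
    (hα : α ∈ Set.Ioo (0 : ℝ) 2) {S : T → Ω → ℝ} (hS : IsCenteredSeries α U W P S) :
    IsTotallySkewedRight α S P := by
  classical
  intro I a ha hapos
  have := h.isProbabilityMeasure
  have := h.isProbabilityMeasure_markLaw
  have hSm := hS.measurable
  obtain ⟨t₀, ht₀, hat₀⟩ := hapos
  have : Nonempty I := ⟨⟨t₀, ht₀⟩⟩
  set ρ := P.map fun ω t => W 0 t ω with hρ
  set M := markedIntensity W P with hM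
  set c : I → (T → ℝ) → ℝ := fun j w => w j - variance (W 0 j) P / 2 with hcdef
  have hc : ∀ j, Measurable (c j) := fun j => by fun_prop
  have hwm := measurable_weight α
  have hcm := measurable_compensator α
  set G : (T → ℝ) → ℝ := fun w => ∑ j : I, a j * weight α (c j w) with hG
  have hGm : Measurable G := by fun_prop
  have haj : ∀ j : I, 0 ≤ a j := fun j => ha j j.2
  have hG0 : ∀ w, 0 < G w := fun w =>
    Finset.sum_pos' (fun j _ => mul_nonneg (haj j) (weight_pos _ _).le)
      ⟨⟨t₀, ht₀⟩, Finset.mem_univ _, mul_pos hat₀ (weight_pos _ _)⟩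
  set l : (T → ℝ) → ℝ := fun w => α * Real.log (G w) with hl
  have hlm : Measurable l := by fun_prop
  have hexpl : ∀ w, Real.exp (l w) = G w ^ α := fun w => exp_mul_log (hG0 w)
  set m : ℝ≥0∞ := ∫⁻ w, ENNReal.ofReal (Real.exp (l w)) ∂ρ with hm
  have hmap : M.map (fun p => p.1 + l p.2) = m • expIntensity := map_add_prod_eq_smul ρ hlm
  have hm0 : m ≠ 0 := by
    rw [hm, Ne, lintegral_eq_zero_iff (by fun_prop)]
    intro h0
    obtain ⟨w, hw⟩ := h0.exists
    have := Real.exp_pos (l w)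
    simp only [Pi.zero_apply, ENNReal.ofReal_eq_zero] at hw
    linarith
  -- G^α is bounded by a combination of the exponentials e^{c_j}, each of mean one.
  have hmtop : m ≠ ⊤ := by
    have hbound : ∀ w, ENNReal.ofReal (Real.exp (l w)) ≤ ∑ j : I,
        ENNReal.ofReal ((Fintype.card I : ℝ) ^ α * a j ^ α) * ENNReal.ofReal (Real.exp (c j w)) := by
      intro w
      have h1 : ∀ j : I, (a j * weight α (c j w)) ^ α = a j ^ α * Real.exp (c j w) := fun j => by
        rw [Real.mul_rpow (haj j) (weight_pos _ _).le, weight_rpow hα.1]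
      have h2 : ∀ j : I, 0 ≤ (Fintype.card I : ℝ) ^ α * a j ^ α := fun j =>
        mul_nonneg (by positivity) (Real.rpow_nonneg (haj j) α)
      simp_rw [← ENNReal.ofReal_mul (h2 _)]
      rw [← ENNReal.ofReal_sum_of_nonneg fun j _ => mul_nonneg (h2 j) (Real.exp_pos _).le, hexpl]
      refine ENNReal.ofReal_le_ofReal ((sum_rpow_le hα.1 fun j =>
        mul_nonneg (haj j) (weight_pos α (c j w)).le).trans_eq ?_)
      rw [Finset.mul_sum]
      simp_rw [h1, mul_assoc]
    refine ((lintegral_mono hbound).trans_lt ?_).ne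
    rw [lintegral_finsetSum _ fun j _ => by fun_prop]
    refine ENNReal.sum_lt_top.mpr fun j _ => ?_
    rw [lintegral_const_mul _ (by fun_prop), h.lintegral_exp_markLaw]
    exact ENNReal.mul_lt_top ENNReal.ofReal_lt_top ENNReal.one_lt_top
  have hY : ∀ p : ℝ × (T → ℝ), ∑ j : I, a j * weight α (logPoint W P j p)
      = weight α (p.1 + l p.2) := by
    intro p
    rw [hl, weight_add_mul_log hα.1 (hG0 _), hG, Finset.sum_mul]
    refine Finset.sum_congr rfl fun j _ => ?_
    rw [logPoint, weight_add]
    ring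
  have hsplit : ∀ (θ : ℝ) p, levyIntegrand α (fun j : I => θ * a j)
      (fun j => weight α (logPoint W P j p))
      = laplaceIntegrand α (-(θ * Complex.I)) (weight α (p.1 + l p.2))
        + (θ * (compensator α (weight α (p.1 + l p.2))
          - ∑ j : I, a j * compensator α (weight α (logPoint W P j p))) : ℝ) * Complex.I := by
    intro θ p
    simp only [levyIntegrand, laplaceIntegrand, mul_assoc, ← Finset.mul_sum, hY]
    push_cast
    ring_nf
  have hadd : Measurable fun p : ℝ × (T → ℝ) => p.1 + l p.2 := by fun_prop
  have hlapm : ∀ z, Measurable fun y => laplaceIntegrand α z (weight α y) := fun z =>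
    (measurable_laplaceIntegrand α z).comp hwm
  have hlap : ∀ θ : ℝ, Integrable (fun p : ℝ × (T → ℝ) =>
      laplaceIntegrand α (-(θ * Complex.I)) (weight α (p.1 + l p.2))) M := by
    intro θ
    have := (integrable_laplaceIntegrand hα (z := -(θ * Complex.I)) (by simp)).smul_measure hmtop
    rw [← hmap, integrable_map_measure (hlapm _).aestronglyMeasurable hadd.aemeasurable] at this
    exact this
  have hlevy : ∀ θ : ℝ, Integrable (fun p => levyIntegrand α (fun j : I => θ * a j)
      (fun j => weight α (logPoint W P j p))) M := by
    intro θ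
    have h1 := h.integrable_levyIntegrand hα (fun j : I => (j : T)) fun j => θ * a j
    have h2 : Measurable fun y : I → ℝ =>
        levyIntegrand α (fun j : I => θ * a j) fun j => weight α (y j) :=
      (measurable_levyIntegrand α _).comp (by fun_prop)
    rw [logIntensity, integrable_map_measure h2.aestronglyMeasurable
      (measurable_logPoint_pi _).aemeasurable] at h1
    exact h1
  set D : ℝ × (T → ℝ) → ℝ := fun p => compensator α (weight α (p.1 + l p.2))
          - ∑ j : I, a j * compensator α (weight α (logPoint W P j p)) with hD
  -- The drift density is the imaginary part of the difference of two integrable functions, taken at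
  -- θ = 1.
  have hDi : Integrable D M := by
    refine ((hlevy 1).sub (hlap 1)).im.congr (ae_of_all _ fun p => ?_)
    simp only [Pi.sub_apply, hsplit 1, add_sub_cancel_left]
    simp [hD]
  have hexponent : ∀ θ : ℝ, ∫ p, levyIntegrand α (fun j : I => θ * a j)
      (fun j => weight α (logPoint W P j p)) ∂M
      = (m.toReal : ℂ) * laplaceExponent α (-(θ * Complex.I))
        + (θ * ∫ p, D p ∂M : ℝ) * Complex.I := by
    intro θ
    have hDc : Integrable (fun p => ((θ * D p : ℝ) : ℂ) * Complex.I) M :=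
      ((hDi.const_mul θ).ofReal (𝕜 := ℂ)).mul_const Complex.I
    have h1 := integral_map (μ := M) hadd.aemeasurable
      (hlapm (-(θ * Complex.I))).aestronglyMeasurable
    rw [hmap, integral_smul_measure, Complex.real_smul] at h1
    simp_rw [hsplit θ]
    rw [integral_add (hlap θ) hDc, integral_mul_const, integral_complex_ofReal,
      integral_const_mul, laplaceExponent, h1]
  obtain ⟨σ, μ, hσ, hstable⟩ := exists_exp_laplaceExponent_eq_stableCharFun hα
    (ENNReal.toReal_pos hm0 hmtop) (∫ p, D p ∂M)
  refine ⟨σ, μ, hσ, fun θ => ?_⟩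
  rw [← hstable, ← hexponent, hM, ← h.integral_exp_centeredSeries hα hS (fun j : I => (j : T)),
    charFun_apply, integral_map (by fun_prop) (by fun_prop)]
  refine integral_congr_ae (ae_of_all _ fun ω => ?_)
  simp only [RCLike.inner_apply, conj_trivial, mul_assoc, ← Finset.mul_sum]
  rw [Finset.sum_coe_sort I fun t => a t * S t ω]

end IsGaussPoissonFamily

end Skewness

/-! ### Products of finitely many coordinates under a product measure -/

section InfiniteProduct

theorem integral_finset_prod_infinitePi {ι : Type*} {E : ι → Type*} [∀ i, MeasurableSpace (E i)]
    (μ : ∀ i, Measure (E i)) [∀ i, IsProbabilityMeasure (μ i)] {f : ∀ i, E i → ℂ}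
    (hf : ∀ i, Measurable (f i)) (s : Finset ι) :
    ∫ x, ∏ i ∈ s, f i (x i) ∂(Measure.infinitePi μ) = ∏ i ∈ s, ∫ y, f i y ∂(μ i) := by
  have h1 : ∀ x : (∀ i, E i), ∏ i ∈ s, f i (x i) = ∏ i : s, f i (s.restrict x i) := fun x =>
    (Finset.prod_coe_sort s fun i => f i (x i)).symm
  have hm : Measurable fun y : (∀ i : s, E i) => ∏ i : s, f i (y i) := by fun_prop
  simp_rw [h1]
  refine (integral_restrict_infinitePi (μ := μ) (f := fun y : (∀ i : s, E i) => ∏ i : s, f i (y i))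
    hm.aestronglyMeasurable).trans ?_
  rw [integral_fintype_prod_eq_prod (fun (i : s) y => f i y),
    Finset.prod_coe_sort s fun i => ∫ y, f i y ∂(μ i)]

end InfiniteProduct

/-! ### Poisson numbers of points in independent cells -/

section PoissonCells

/-- A Poisson number of independent points in the `n`-th cell, independently for different `n`. -/
noncomputable def cellLaw (ν : ℕ → Measure ℝ) : Measure (ℕ → ℕ × (ℕ → ℝ)) :=
  Measure.infinitePi fun n => (poissonMeasure 1).prod (Measure.infinitePi fun _ : ℕ => ν n)

/-- The labels of the points that lie in `B`. -/
def cellPoints (B : Set ℝ) (ω : ℕ → ℕ × (ℕ → ℝ)) : Set (ℕ × ℕ) :=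
  {p | p.2 < (ω p.1).1 ∧ (ω p.1).2 p.2 ∈ B}

open Classical in
/-- The number of points of the `n`-th cell that lie in `B`. -/
noncomputable def cellCount (B : Set ℝ) (n : ℕ) (ω : ℕ → ℕ × (ℕ → ℝ)) : ℕ :=
  ((Finset.range (ω n).1).filter fun k => (ω n).2 k ∈ B).card

theorem measurable_prod_range {φ : ℝ → ℂ} (hφ : Measurable φ) :
    Measurable fun q : ℕ × (ℕ → ℝ) => ∏ k ∈ Finset.range q.1, φ (q.2 k) :=
  measurable_from_prod_countable_right fun _ => by
    simp only
    fun_prop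

theorem measurable_cellCount {B : Set ℝ} (hB : MeasurableSet B) (n : ℕ) :
    Measurable (cellCount B n) := by
  classical
  have : Measurable fun q : ℕ × (ℕ → ℝ) => ((Finset.range q.1).filter fun k => q.2 k ∈ B).card := by
    refine measurable_from_prod_countable_right fun K => ?_
    simp only [Finset.card_filter]
    exact Finset.measurable_fun_sum _ fun k _ =>
      Measurable.ite (measurableSet_preimage (measurable_pi_apply k) hB) measurable_const
        measurable_const
  exact this.comp (measurable_pi_apply n)

theorem sum_cellCount_le_encard (B : Set ℝ) (ω : ℕ → ℕ × (ℕ → ℝ)) (L : ℕ) :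
    ((∑ n ∈ Finset.range L, cellCount B n ω : ℕ) : ℕ∞) ≤ (cellPoints B ω).encard ∧
      ((∀ n, L ≤ n → cellCount B n ω = 0) →
        (cellPoints B ω).encard = (∑ n ∈ Finset.range L, cellCount B n ω : ℕ)) := by
  classical
  set F : Finset (Σ _ : ℕ, ℕ) := (Finset.range L).sigma fun n =>
    (Finset.range (ω n).1).filter fun k => (ω n).2 k ∈ B with hF
  have hcard : ((F.map (Equiv.sigmaEquivProd ℕ ℕ).toEmbedding : Finset (ℕ × ℕ)) : Set (ℕ × ℕ)).encard
      = (∑ n ∈ Finset.range L, cellCount B n ω : ℕ) := by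
    rw [Set.encard_coe_eq_coe_finsetCard, Finset.card_map, hF, Finset.card_sigma]
    rfl
  have hmem : ∀ p : ℕ × ℕ, p ∈ F.map (Equiv.sigmaEquivProd ℕ ℕ).toEmbedding
      ↔ p.1 < L ∧ p ∈ cellPoints B ω := by
    intro p
    simp only [Finset.mem_map_equiv, hF, Finset.mem_sigma, Finset.mem_range, Finset.mem_filter]
    rfl
  rw [← hcard]
  refine ⟨Set.encard_le_encard fun p hp => ((hmem p).mp hp).2, fun h => ?_⟩
  congr 1
  ext p
  rw [Finset.mem_coe, hmem, iff_and_self]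
  intro hp
  by_contra hL
  have h0 := h p.1 (not_lt.mp hL)
  rw [cellCount, Finset.card_eq_zero] at h0
  have : p.2 ∈ (Finset.range (ω p.1).1).filter fun k => (ω p.1).2 k ∈ B :=
    Finset.mem_filter.mpr ⟨Finset.mem_range.mpr hp.1, hp.2⟩
  rw [h0] at this
  exact absurd this (Finset.notMem_empty _)

variable (ν : ℕ → Measure ℝ) [∀ n, IsProbabilityMeasure (ν n)]

instance : IsProbabilityMeasure (cellLaw ν) := by
  unfold cellLaw
  infer_instance

/-- Given the number of points the factors are independent with mean ∫ φ dμ; what remains is the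
generating function of Poisson(1) at this mean. -/
theorem integral_prod_range (μ : Measure ℝ) [IsProbabilityMeasure μ] {φ : ℝ → ℂ}
    (hφ : Measurable φ) (hφ1 : ∀ x, ‖φ x‖ ≤ 1) :
    ∫ q, ∏ k ∈ Finset.range q.1, φ (q.2 k)
      ∂((poissonMeasure 1).prod (Measure.infinitePi fun _ : ℕ => μ))
      = Complex.exp (∫ x, φ x ∂μ - 1) := by
  have hint : Integrable (fun q : ℕ × (ℕ → ℝ) => ∏ k ∈ Finset.range q.1, φ (q.2 k))
      ((poissonMeasure 1).prod (Measure.infinitePi fun _ : ℕ => μ)) := by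
    refine Integrable.of_bound (measurable_prod_range hφ).aestronglyMeasurable 1
      (ae_of_all _ fun q => ?_)
    rw [norm_prod]
    exact Finset.prod_le_one (fun _ _ => norm_nonneg _) fun _ _ => hφ1 _
  rw [integral_prod _ hint]
  simp_rw [integral_finset_prod_infinitePi (fun _ : ℕ => μ) (fun _ => hφ), Finset.prod_const,
    Finset.card_range, integral_pow_poissonMeasure]
  simp

/-- The joint probability generating function of the numbers of points in disjoint sets. -/
theorem integral_prod_pow_cellCount {ι : Type*} [Fintype ι] {B : ι → Set ℝ}
    (hB : ∀ j, MeasurableSet (B j)) (hd : Pairwise fun j k => Disjoint (B j) (B k))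
    {z : ι → ℂ} (hz : ∀ j, ‖z j‖ ≤ 1) (s : Finset ℕ) :
    ∫ ω, ∏ j, z j ^ (∑ n ∈ s, cellCount (B j) n ω) ∂(cellLaw ν)
      = Complex.exp (∑ j, (z j - 1) * (∑ n ∈ s, (ν n).real (B j) : ℝ)) := by
  classical
  -- One test function encodes all the counts: a point of B j contributes z j, and by disjointness
  -- at most one factor differs from 1.
  set φ : ℝ → ℂ := fun x => ∏ j, if x ∈ B j then z j else 1 with hφdef
  have hφ : Measurable φ := Finset.measurable_fun_prod _ fun j _ =>
    Measurable.ite (hB j) measurable_const measurable_const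
  have hφ1 : ∀ x, ‖φ x‖ ≤ 1 := fun x => by
    rw [hφdef, norm_prod]
    refine Finset.prod_le_one (fun _ _ => norm_nonneg _) fun j _ => ?_
    split_ifs
    · exact hz j
    · simp
  have hφ2 : ∀ x, φ x = 1 + ∑ j, (B j).indicator (fun _ => z j - 1) x := by
    intro x
    by_cases hx : ∃ j, x ∈ B j
    · obtain ⟨j, hj⟩ := hx
      have hne : ∀ k, k ≠ j → x ∉ B k := fun k hk hxk => Set.disjoint_left.mp (hd hk) hxk hj
      rw [hφdef]
      simp only
      rw [Finset.prod_eq_single j (fun k _ hk => if_neg (hne k hk)) (by simp),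
        Finset.sum_eq_single j (fun k _ hk => Set.indicator_of_notMem (hne k hk) _) (by simp),
        if_pos hj, Set.indicator_of_mem hj]
      ring
    · push Not at hx
      simp [hφdef, hx]
  have hint : ∀ n, ∫ x, φ x ∂(ν n) - 1 = ∑ j, (z j - 1) * ((ν n).real (B j) : ℝ) := by
    intro n
    have hi : ∀ j, Integrable ((B j).indicator fun _ => z j - 1) (ν n) := fun j =>
      (integrable_const _).indicator (hB j)
    simp_rw [hφ2]
    rw [integral_add (integrable_const _) (integrable_finsetSum _ fun j _ => hi j),
      integral_finsetSum _ fun j _ => hi j]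
    simp only [integral_const, probReal_univ, one_smul, add_sub_cancel_left]
    refine Finset.sum_congr rfl fun j _ => ?_
    rw [integral_indicator (hB j), setIntegral_const, Complex.real_smul, mul_comm]
  have hprod : ∀ ω : ℕ → ℕ × (ℕ → ℝ), ∏ j, z j ^ (∑ n ∈ s, cellCount (B j) n ω)
      = ∏ n ∈ s, ∏ k ∈ Finset.range (ω n).1, φ ((ω n).2 k) := by
    intro ω
    simp_rw [← Finset.prod_pow_eq_pow_sum]
    rw [Finset.prod_comm]
    refine Finset.prod_congr rfl fun n _ => ?_
    rw [hφdef, Finset.prod_comm]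
    refine Finset.prod_congr rfl fun j _ => ?_
    rw [Finset.prod_ite, Finset.prod_const, Finset.prod_const_one, mul_one, cellCount]
  simp_rw [hprod]
  rw [cellLaw, integral_finset_prod_infinitePi _ (fun _ => measurable_prod_range hφ)]
  simp_rw [integral_prod_range _ hφ hφ1, hint]
  rw [← Complex.exp_sum, Finset.sum_comm]
  congr 1
  refine Finset.sum_congr rfl fun j _ => ?_
  rw [← Finset.mul_sum]
  push_cast
  rfl

/-- Cell n meets B with probability 1 - e^{-ν_n(B)} ≤ ν_n(B), and Borel–Cantelli applies. -/
theorem ae_eventually_cellCount_eq_zero {B : Set ℝ} (hB : MeasurableSet B)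
    (hfin : Measure.sum ν B ≠ ⊤) :
    ∀ᵐ ω ∂(cellLaw ν), ∀ᶠ n in atTop, cellCount B n ω = 0 := by
  have hbound : ∀ n, cellLaw ν {ω | cellCount B n ω ≠ 0} ≤ ν n B := by
    intro n
    have hm : MeasurableSet {ω | cellCount B n ω = 0} :=
      measurable_cellCount hB n (measurableSet_singleton 0)
    -- At z = 0 the generating function is the probability of an empty cell, because 0^0 = 1.
    have h1 := integral_prod_pow_cellCount ν (ι := Unit) (B := fun _ => B) (fun _ => hB)
      (fun _ _ h => absurd rfl h) (z := fun _ => 0) (by simp) {n}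
    simp only [Finset.univ_unique, Finset.prod_singleton, Finset.sum_singleton, zero_sub, neg_mul,
      one_mul] at h1
    have h2 : ∀ ω, (0 : ℂ) ^ cellCount B n ω
        = (({ω | cellCount B n ω = 0}.indicator (fun _ => (1 : ℝ)) ω : ℝ) : ℂ) := by
      intro ω
      by_cases h : cellCount B n ω = 0
      · rw [Set.indicator_of_mem (by exact h), h]; simp
      · rw [Set.indicator_of_notMem (by exact h), zero_pow h]; simp
    simp_rw [h2] at h1
    rw [integral_complex_ofReal, integral_indicator_const _ hm, smul_eq_mul, mul_one,
      ← Complex.ofReal_neg, ← Complex.ofReal_exp, Complex.ofReal_inj] at h1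
    have h3 : (cellLaw ν).real {ω | cellCount B n ω ≠ 0} ≤ (ν n).real B := by
      have : {ω | cellCount B n ω ≠ 0} = {ω | cellCount B n ω = 0}ᶜ := rfl
      rw [this, measureReal_compl hm, h1, probReal_univ]
      have := Real.add_one_le_exp (-(ν n).real B)
      linarith
    rw [measureReal_def, measureReal_def] at h3
    exact (ENNReal.toReal_le_toReal (measure_ne_top _ _) (measure_ne_top _ _)).mp h3
  have hs : ∑' n, cellLaw ν {ω | cellCount B n ω ≠ 0} ≠ ⊤ := by
    rw [Measure.sum_apply _ hB] at hfin
    exact ne_top_of_le_ne_top hfin (ENNReal.tsum_le_tsum hbound)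
  filter_upwards [ae_eventually_notMem hs] with ω hω
  filter_upwards [hω] with n hn
  simpa using hn

/-- The mean of 2^{-N}, for the number N of points in the first L cells, is exp(-½ ∑ ν_n(B)) and
tends to 0 as L grows. Markov's inequality then excludes every finite bound on the number of points.
-/
theorem ae_encard_cellPoints_eq_top {B : Set ℝ} (hB : MeasurableSet B)
    (htop : Measure.sum ν B = ⊤) :
    ∀ᵐ ω ∂(cellLaw ν), (cellPoints B ω).encard = ⊤ := by
  have hlim : Tendsto (fun L => Real.exp (-(1 / 2) * ∑ n ∈ Finset.range L, (ν n).real B)) atTop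
      (𝓝 0) := by
    have hns : ¬ Summable fun n => (ν n).real B := by
      intro hs
      have := hs.tsum_ofReal_ne_top
      simp only [measureReal_def, ENNReal.ofReal_toReal (measure_ne_top _ _)] at this
      rw [← Measure.sum_apply _ hB] at this
      exact this htop
    have h1 := (not_summable_iff_tendsto_nat_atTop_of_nonneg fun n => measureReal_nonneg).mp hns
    exact Real.tendsto_exp_atBot.comp (h1.const_mul_atTop_of_neg (by norm_num))
  have hexp : ∀ L, ∫ ω, ((1 : ℝ) / 2) ^ (∑ n ∈ Finset.range L, cellCount B n ω) ∂(cellLaw ν)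
      = Real.exp (-(1 / 2) * ∑ n ∈ Finset.range L, (ν n).real B) := by
    intro L
    have h1 := integral_prod_pow_cellCount ν (ι := Unit) (B := fun _ => B) (fun _ => hB)
      (fun _ _ h => absurd rfl h) (z := fun _ => ((1 / 2 : ℝ) : ℂ)) (by norm_num) (Finset.range L)
    simp only [Finset.univ_unique, Finset.prod_singleton, Finset.sum_singleton,
      ← Complex.ofReal_pow, integral_complex_ofReal] at h1
    rw [← Complex.ofReal_one, ← Complex.ofReal_sub, ← Complex.ofReal_mul, ← Complex.ofReal_exp,
      Complex.ofReal_inj] at h1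
    rw [h1]
    norm_num
  have hzero : ∀ k : ℕ, cellLaw ν {ω | (cellPoints B ω).encard ≤ k} = 0 := by
    intro k
    have hle : ∀ L, (cellLaw ν).real {ω | (cellPoints B ω).encard ≤ k}
        ≤ 2 ^ k * Real.exp (-(1 / 2) * ∑ n ∈ Finset.range L, (ν n).real B) := by
      intro L
      set D : (ℕ → ℕ × (ℕ → ℝ)) → ℝ :=
        fun ω => ((1 : ℝ) / 2) ^ (∑ n ∈ Finset.range L, cellCount B n ω) with hD
      have hDm : Measurable D := by
        have := fun n => measurable_cellCount hB n
        fun_prop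
      have hDi : Integrable D (cellLaw ν) := by
        refine Integrable.of_bound hDm.aestronglyMeasurable 1 (ae_of_all _ fun ω => ?_)
        rw [Real.norm_of_nonneg (by positivity)]
        exact pow_le_one₀ (by norm_num) (by norm_num)
      have hmarkov := mul_meas_ge_le_integral_of_nonneg (μ := cellLaw ν) (f := D)
        (ae_of_all _ fun ω => by positivity) hDi ((1 / 2) ^ k)
      rw [hexp L] at hmarkov
      have hsub : {ω | (cellPoints B ω).encard ≤ k} ⊆ {ω | (1 / 2) ^ k ≤ D ω} := by
        intro ω hω
        have h1 : ∑ n ∈ Finset.range L, cellCount B n ω ≤ k := by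
          exact_mod_cast (sum_cellCount_le_encard B ω L).1.trans hω
        exact pow_le_pow_of_le_one (one_half_pos (α := ℝ)).le one_half_lt_one.le h1
      calc (cellLaw ν).real {ω | (cellPoints B ω).encard ≤ k}
          ≤ (cellLaw ν).real {ω | (1 / 2) ^ k ≤ D ω} := measureReal_mono hsub
        _ = 2 ^ k * ((1 / 2) ^ k * (cellLaw ν).real {ω | (1 / 2) ^ k ≤ D ω}) := by
            rw [← mul_assoc, ← mul_pow]; norm_num
        _ ≤ _ := by gcongr
    have h0 : (cellLaw ν).real {ω | (cellPoints B ω).encard ≤ k} ≤ 0 := by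
      refine ge_of_tendsto' (by simpa using hlim.const_mul ((2 : ℝ) ^ k)) hle
    have := le_antisymm h0 measureReal_nonneg
    rwa [measureReal_eq_zero_iff] at this
  have hall : ∀ᵐ ω ∂(cellLaw ν), ∀ k : ℕ, ¬ (cellPoints B ω).encard ≤ k :=
    ae_all_iff.mpr fun k => by
      rw [ae_iff]
      simpa using hzero k
  filter_upwards [hall] with ω hω
  by_contra h
  obtain ⟨k, hk⟩ := ENat.ne_top_iff_exists.mp h
  exact hω k hk.symm.le

end PoissonCells

/-! ### Measurable enumeration of a random infinite set of indices -/

section Enumeration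

theorem measurable_sInf_nat {Ω : Type*} [MeasurableSpace Ω] {Q : ℕ → Ω → Prop}
    (hQ : ∀ m, MeasurableSet {ω | Q m ω}) : Measurable fun ω => sInf {m | Q m ω} := by
  refine measurable_to_countable' fun n => ?_
  -- The second piece accounts for the convention that the empty set has infimum 0.
  have h : (fun ω => sInf {m | Q m ω}) ⁻¹' {n}
      = ({ω | Q n ω} ∩ ⋂ k ∈ Finset.range n, {ω | Q k ω}ᶜ)
        ∪ {ω | n = 0 ∧ ∀ m, ¬ Q m ω} := by
    ext ω
    simp only [Set.mem_preimage, Set.mem_singleton_iff, Set.mem_union, Set.mem_inter_iff,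
      Set.mem_iInter, Finset.mem_range, Set.mem_compl_iff, Set.mem_ofPred_eq]
    constructor
    · intro hn
      by_cases hne : {m | Q m ω}.Nonempty
      · left
        have h1 := Nat.sInf_mem hne
        rw [hn] at h1
        exact ⟨h1, fun k hk hQk => Nat.notMem_of_lt_sInf (hn.symm ▸ hk) hQk⟩
      · rw [Set.not_nonempty_iff_eq_empty] at hne
        right
        rw [hne, Nat.sInf_empty] at hn
        exact ⟨hn.symm, fun m hm => by
          have : m ∈ {m | Q m ω} := hm
          rw [hne] at this
          exact this⟩
    · rintro (⟨h1, h2⟩ | ⟨rfl, h2⟩)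
      · refine le_antisymm (Nat.sInf_le h1) ?_
        by_contra hlt
        have hne : {m | Q m ω}.Nonempty := ⟨n, h1⟩
        exact h2 _ (not_le.mp hlt) (Nat.sInf_mem hne)
      · have : {m | Q m ω} = ∅ := Set.eq_empty_of_forall_notMem h2
        rw [this, Nat.sInf_empty]
  rw [h]
  refine ((hQ n).inter (Finset.measurableSet_biInter _ fun k _ => (hQ k).compl)).union ?_
  have : {ω | n = 0 ∧ ∀ m, ¬ Q m ω} = {ω | n = 0} ∩ ⋂ m, {ω | Q m ω}ᶜ := by
    ext ω
    simp
  rw [this]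
  exact (MeasurableSet.const _).inter (MeasurableSet.iInter fun m => (hQ m).compl)

open Classical in
/-- The increasing enumeration of a set of natural numbers. -/
noncomputable def enumerate (A : Set ℕ) (i : ℕ) : ℕ :=
  sInf {m | m ∈ A ∧ Nat.count (· ∈ A) m = i}

/-- For infinite A exactly one element has i predecessors in A. The form as an infimum serves
`measurable_enumerate`, where A is random. -/
theorem enumerate_eq_nth {A : Set ℕ} (hA : A.Infinite) (i : ℕ) :
    enumerate A i = Nat.nth (· ∈ A) i := by
  classical
  have : {m | m ∈ A ∧ Nat.count (· ∈ A) m = i} = {Nat.nth (· ∈ A) i} := by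
    ext m
    simp only [Set.mem_ofPred_eq, Set.mem_singleton_iff]
    constructor
    · rintro ⟨h1, rfl⟩
      exact (Nat.nth_count (p := (· ∈ A)) h1).symm
    · rintro rfl
      exact ⟨Nat.nth_mem_of_infinite (p := (· ∈ A)) hA i,
        Nat.count_nth_of_infinite (p := (· ∈ A)) hA i⟩
  rw [enumerate]
  convert (congrArg sInf this).trans (csInf_singleton (Nat.nth (· ∈ A) i)) using 4

theorem encard_enumerate {A : Set ℕ} (hA : A.Infinite) (p : ℕ → Prop) :
    {i | p (enumerate A i)}.encard = {m | m ∈ A ∧ p m}.encard := by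
  classical
  have hinj : Function.Injective (enumerate A) := by
    intro i j hij
    rw [enumerate_eq_nth hA, enumerate_eq_nth hA] at hij
    exact Nat.nth_injective (p := (· ∈ A)) hA hij
  rw [← hinj.encard_image]
  congr 1
  ext m
  constructor
  · rintro ⟨i, hi, rfl⟩
    refine ⟨?_, hi⟩
    rw [enumerate_eq_nth hA]
    exact Nat.nth_mem_of_infinite (p := (· ∈ A)) hA i
  · rintro ⟨h1, h2⟩
    have h3 : enumerate A (Nat.count (· ∈ A) m) = m := by
      rw [enumerate_eq_nth hA]
      exact Nat.nth_count (p := (· ∈ A)) h1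
    exact ⟨_, by rw [Set.mem_ofPred_eq, h3]; exact h2, h3⟩

theorem measurable_enumerate {Ω : Type*} [MeasurableSpace Ω] {A : Ω → Set ℕ}
    (hA : ∀ m, MeasurableSet {ω | m ∈ A ω}) (i : ℕ) :
    Measurable fun ω => enumerate (A ω) i := by
  classical
  have hc : ∀ m, Measurable fun ω => Nat.count (· ∈ A ω) m := by
    intro m
    simp only [Nat.count_eq_card_filter_range, Finset.card_filter]
    exact Finset.measurable_fun_sum _ fun k _ =>
      Measurable.ite (hA k) measurable_const measurable_const
  have := measurable_sInf_nat (Q := fun m ω => m ∈ A ω ∧ Nat.count (· ∈ A ω) m = i)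
    fun m => (hA m).inter (hc m (measurableSet_singleton i))
  refine (funext fun ω => ?_ : (fun ω => enumerate (A ω) i) = _) ▸ this
  rw [enumerate]

end Enumeration

/-! ### Existence of the Poisson process with intensity e^{-u} du -/

section PoissonExistence

variable (ν : ℕ → Measure ℝ)

theorem hasSum_real_of_sum_ne_top [∀ n, IsProbabilityMeasure (ν n)] {B : Set ℝ}
    (hB : MeasurableSet B) (hfin : Measure.sum ν B ≠ ⊤) :
    HasSum (fun n => (ν n).real B) (Measure.sum ν B).toReal := by
  rw [Measure.sum_apply _ hB] at hfin ⊢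
  rw [ENNReal.tsum_toReal_eq fun n => measure_ne_top _ _]
  exact ENNReal.hasSum_toReal hfin

theorem ae_toNat_encard_cellPoints [∀ n, IsProbabilityMeasure (ν n)] {B : Set ℝ}
    (hB : MeasurableSet B) (hfin : Measure.sum ν B ≠ ⊤) :
    ∀ᵐ ω ∂(cellLaw ν), (cellPoints B ω).encard = ((cellPoints B ω).encard.toNat : ℕ∞) ∧
      ∀ᶠ L in atTop, ∑ n ∈ Finset.range L, cellCount B n ω = (cellPoints B ω).encard.toNat := by
  filter_upwards [ae_eventually_cellCount_eq_zero ν hB hfin] with ω hω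
  obtain ⟨L₀, hL₀⟩ := eventually_atTop.mp hω
  have h : ∀ L, L₀ ≤ L → (cellPoints B ω).encard = (∑ n ∈ Finset.range L, cellCount B n ω : ℕ) :=
    fun L hL => (sum_cellCount_le_encard B ω L).2 fun n hn => hL₀ n (hL.trans hn)
  constructor
  · rw [h L₀ le_rfl, ENat.toNat_natCast]
  · filter_upwards [eventually_ge_atTop L₀] with L hL
    rw [h L hL, ENat.toNat_natCast]

theorem aemeasurable_toNat_encard_cellPoints [∀ n, IsProbabilityMeasure (ν n)] {B : Set ℝ}
    (hB : MeasurableSet B) (hfin : Measure.sum ν B ≠ ⊤) :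
    AEMeasurable (fun ω => ((cellPoints B ω).encard.toNat : ℝ)) (cellLaw ν) := by
  have hm := measurable_cellCount hB
  refine aemeasurable_of_tendsto_metrizable_ae atTop
    (f := fun L ω => ((∑ n ∈ Finset.range L, cellCount B n ω : ℕ) : ℝ)) (fun L => by fun_prop) ?_
  filter_upwards [ae_toNat_encard_cellPoints ν hB hfin] with ω hω
  refine tendsto_const_nhds.congr' ?_
  filter_upwards [hω.2] with L hL
  rw [hL]

/-- The joint characteristic function of the numbers of points in disjoint sets. -/
theorem integral_exp_encard_cellPoints [∀ n, IsProbabilityMeasure (ν n)] {ι : Type*} [Fintype ι]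
    {B : ι → Set ℝ} (hB : ∀ j, MeasurableSet (B j)) (hd : Pairwise fun j k => Disjoint (B j) (B k))
    (hfin : ∀ j, Measure.sum ν (B j) ≠ ⊤) (ξ : ι → ℝ) :
    ∫ ω, Complex.exp ((∑ j, ξ j * ((cellPoints (B j) ω).encard.toNat : ℝ) : ℝ) * Complex.I)
      ∂(cellLaw ν)
      = ∏ j, Complex.exp ((Measure.sum ν (B j)).toReal * (Complex.exp (ξ j * Complex.I) - 1)) := by
  set z : ι → ℂ := fun j => Complex.exp (ξ j * Complex.I) with hz
  have hz1 : ∀ j, ‖z j‖ ≤ 1 := fun j => (Complex.norm_exp_ofReal_mul_I _).le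
  have h1 := fun L => integral_prod_pow_cellCount ν hB hd hz1 (Finset.range L)
  have hR : Tendsto (fun L => ∫ ω, ∏ j, z j ^ (∑ n ∈ Finset.range L, cellCount (B j) n ω)
      ∂(cellLaw ν)) atTop (𝓝 (∏ j, Complex.exp ((Measure.sum ν (B j)).toReal * (z j - 1)))) := by
    simp_rw [h1]
    rw [← Complex.exp_sum]
    refine (Complex.continuous_exp.tendsto _).comp (tendsto_finsetSum _ fun j _ => ?_)
    rw [mul_comm]
    exact ((Complex.continuous_ofReal.tendsto _).comp
      (hasSum_real_of_sum_ne_top ν (hB j) (hfin j)).tendsto_sum_nat).const_mul _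
  have hm := fun j n => measurable_cellCount (hB j) n
  refine tendsto_nhds_unique ?_ hR
  refine tendsto_integral_of_dominated_convergence (fun _ => 1) (fun L => ?_) (by simp)
    (fun L => ae_of_all _ fun ω => ?_) ?_
  · have : Measurable fun ω => ∏ j, z j ^ (∑ n ∈ Finset.range L, cellCount (B j) n ω) :=
      Finset.measurable_fun_prod _ fun j _ => (measurable_from_nat (f := fun k => z j ^ k)).comp
        (Finset.measurable_fun_sum _ fun n _ => hm j n)
    exact this.aestronglyMeasurable
  · rw [norm_prod]
    refine Finset.prod_le_one (fun _ _ => norm_nonneg _) fun j _ => ?_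
    rw [norm_pow]
    exact pow_le_one₀ (norm_nonneg _) (hz1 j)
  · have hae : ∀ᵐ ω ∂(cellLaw ν), ∀ j, ∀ᶠ L in atTop,
        ∑ n ∈ Finset.range L, cellCount (B j) n ω = (cellPoints (B j) ω).encard.toNat :=
      eventually_all.mpr fun j => (ae_toNat_encard_cellPoints ν (hB j) (hfin j)).mono fun _ h => h.2
    filter_upwards [hae] with ω hω
    refine tendsto_const_nhds.congr' ?_
    filter_upwards [eventually_all.mpr hω] with L hL
    simp_rw [hL, hz, ← Complex.exp_nat_mul]
    rw [← Complex.exp_sum]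
    congr 1
    push_cast
    rw [Finset.sum_mul]
    exact Finset.sum_congr rfl fun j _ => by ring

theorem iIndepFun_toNat_encard_cellPoints [∀ n, IsProbabilityMeasure (ν n)] {ι : Type*} [Fintype ι]
    {B : ι → Set ℝ} (hB : ∀ j, MeasurableSet (B j)) (hd : Pairwise fun j k => Disjoint (B j) (B k))
    (hfin : ∀ j, Measure.sum ν (B j) ≠ ⊤) :
    iIndepFun (fun j ω => ((cellPoints (B j) ω).encard.toNat : ℝ)) (cellLaw ν) := by
  classical
  have hm := fun j => aemeasurable_toNat_encard_cellPoints ν (hB j) (hfin j)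
  refine (iIndepFun_iff_charFunDual_pi hm).mpr fun L => ?_
  rw [charFunDual_apply, integral_map (aemeasurable_pi_lambda _ hm) (by fun_prop)]
  have h1 := integral_exp_encard_cellPoints ν hB hd hfin fun j => L (Pi.single j 1)
  refine Eq.trans (integral_congr_ae (ae_of_all _ fun ω => ?_)) (h1.trans ?_)
  · simp only
    rw [dual_apply_eq_sum]
  · refine Finset.prod_congr rfl fun j _ => ?_
    have h2 := integral_exp_encard_cellPoints ν (ι := Unit) (B := fun _ => B j) (fun _ => hB j)
      (fun _ _ h => absurd rfl h) (fun _ => hfin j) fun _ => L (Pi.single j 1)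
    simp only [Finset.univ_unique, Finset.prod_singleton, Finset.sum_singleton] at h2
    rw [← h2, charFunDual_apply, integral_map (hm j) (by fun_prop)]
    refine integral_congr_ae (ae_of_all _ fun ω => ?_)
    have : ∀ x : ℝ, (L.comp (.single ℝ (fun _ => ℝ) j)) x = L (Pi.single j 1) * x := by
      intro x
      have : (Pi.single j x : ι → ℝ) = x • Pi.single j 1 := by
        rw [← Pi.single_smul, smul_eq_mul, mul_one]
      simp [this, mul_comm]
    simp only [this]

theorem measure_encard_cellPoints_eq [∀ n, IsProbabilityMeasure (ν n)] {B : Set ℝ}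
    (hB : MeasurableSet B) (hfin : Measure.sum ν B ≠ ⊤) (k : ℕ) :
    cellLaw ν {ω | (cellPoints B ω).encard = k}
      = poissonMeasure (Measure.sum ν B).toNNReal {k} := by
  have hm := aemeasurable_toNat_encard_cellPoints ν hB hfin
  have := Measure.isProbabilityMeasure_map hm
  have hlaw : (cellLaw ν).map (fun ω => ((cellPoints B ω).encard.toNat : ℝ))
      = (poissonMeasure (Measure.sum ν B).toNNReal).map ((↑) : ℕ → ℝ) := by
    have := Measure.isProbabilityMeasure_map (μ := poissonMeasure (Measure.sum ν B).toNNReal)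
      (f := ((↑) : ℕ → ℝ)) .of_discrete
    refine Measure.ext_of_charFun (funext fun t => ?_)
    rw [charFun_map_cast_poissonMeasure, charFun_apply, integral_map hm (by fun_prop)]
    have h2 := integral_exp_encard_cellPoints ν (ι := Unit) (B := fun _ => B) (fun _ => hB)
      (fun _ _ h => absurd rfl h) (fun _ => hfin) fun _ => t
    simp only [Finset.univ_unique, Finset.prod_singleton, Finset.sum_singleton] at h2
    refine Eq.trans (integral_congr_ae (ae_of_all _ fun ω => ?_)) h2
    simp only [RCLike.inner_apply, conj_trivial]
  have h1 : cellLaw ν {ω | (cellPoints B ω).encard = k}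
      = cellLaw ν ((fun ω => ((cellPoints B ω).encard.toNat : ℝ)) ⁻¹' {(k : ℝ)}) := by
    refine measure_congr ?_
    filter_upwards [ae_toNat_encard_cellPoints ν hB hfin] with ω hω
    refine propext ?_
    change (cellPoints B ω).encard = k ↔ ((cellPoints B ω).encard.toNat : ℝ) = k
    rw [Nat.cast_inj]
    nth_rewrite 1 [hω.1]
    exact Nat.cast_inj
  rw [h1, ← Measure.map_apply_of_aemeasurable hm (measurableSet_singleton _), hlaw,
    Measure.map_apply .of_discrete (measurableSet_singleton _)]
  congr 1
  ext
  simp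

/-- The points of all cells, enumerated. -/
noncomputable def cellEnumeration (i : ℕ) (ω : ℕ → ℕ × (ℕ → ℝ)) : ℝ :=
  (fun m : ℕ => (ω (Nat.unpair m).1).2 (Nat.unpair m).2)
    (enumerate {m | (Nat.unpair m).2 < (ω (Nat.unpair m).1).1} i)

theorem measurable_cellEnumeration (i : ℕ) : Measurable (cellEnumeration i) := by
  have h1 : Measurable fun q : (ℕ → ℕ × (ℕ → ℝ)) × ℕ =>
      (q.1 (Nat.unpair q.2).1).2 (Nat.unpair q.2).2 :=
    measurable_from_prod_countable_left fun m => by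
      simp only
      fun_prop
  refine h1.comp (measurable_id.prodMk (measurable_enumerate (fun m => ?_) i))
  have : Measurable fun ω : ℕ → ℕ × (ℕ → ℝ) => (ω (Nat.unpair m).1).1 := by fun_prop
  exact measurableSet_lt measurable_const this

/-- Infinitely many cells of mass one give infinite total intensity, so almost surely there are
infinitely many points and every index of the enumeration is genuinely used. The exceptional null
set serves all `B` at once. -/
theorem ae_pointCount_cellEnumeration [∀ n, IsProbabilityMeasure (ν n)] :
    ∀ᵐ ω ∂(cellLaw ν), ∀ B : Set ℝ, pointCount cellEnumeration B ω = (cellPoints B ω).encard := by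
  have hcell : ∀ (B : Set ℝ) (ω : ℕ → ℕ × (ℕ → ℝ)),
      {m | m ∈ {m | (Nat.unpair m).2 < (ω (Nat.unpair m).1).1} ∧
        (ω (Nat.unpair m).1).2 (Nat.unpair m).2 ∈ B}.encard = (cellPoints B ω).encard := by
    intro B ω
    rw [← Nat.pairEquiv.symm.injective.encard_image]
    congr 1
    ext p
    simp only [Equiv.image_symm_eq_preimage, Set.mem_preimage, Set.mem_ofPred_eq, cellPoints]
    change (Nat.unpair (Nat.pair p.1 p.2)).2 < (ω (Nat.unpair (Nat.pair p.1 p.2)).1).1 ∧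
      (ω (Nat.unpair (Nat.pair p.1 p.2)).1).2 (Nat.unpair (Nat.pair p.1 p.2)).2 ∈ B ↔ _
    rw [Nat.unpair_pair]
  have htop : Measure.sum ν Set.univ = ⊤ := by
    rw [Measure.sum_apply _ MeasurableSet.univ]
    simp
  filter_upwards [ae_encard_cellPoints_eq_top ν MeasurableSet.univ htop] with ω hω B
  have hinf : {m | (Nat.unpair m).2 < (ω (Nat.unpair m).1).1}.Infinite := by
    rw [← hcell, Set.encard_eq_top_iff] at hω
    exact hω.mono fun m hm => hm.1
  rw [← hcell]
  exact encard_enumerate hinf fun m => (ω (Nat.unpair m).1).2 (Nat.unpair m).2 ∈ B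

theorem isPoissonPointProcess_cellEnumeration [∀ n, IsProbabilityMeasure (ν n)] :
    IsPoissonPointProcess cellEnumeration (Measure.sum ν) (cellLaw ν) where
  measurable := measurable_cellEnumeration
  law_count B hB hfin k := by
    rw [← measure_encard_cellPoints_eq ν hB hfin]
    refine measure_congr ?_
    filter_upwards [ae_pointCount_cellEnumeration ν] with ω hω
    refine propext ?_
    change pointCount cellEnumeration B ω = k ↔ (cellPoints B ω).encard = k
    rw [hω B]
  indep_count n B hB hd := by
    classical
    -- A set of infinite intensity has almost surely the constant count `⊤`. It is replaced by the
    -- empty set for the independence argument, and `ψ` restores the constant afterwards.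
    set B' : Fin n → Set ℝ := fun j => if Measure.sum ν (B j) = ⊤ then ∅ else B j with hB'def
    have hB' : ∀ j, MeasurableSet (B' j) := fun j => by
      simp only [hB'def]
      split_ifs
      · exact MeasurableSet.empty
      · exact hB j
    have hsub : ∀ j, B' j ⊆ B j := fun j => by
      simp only [hB'def]
      split_ifs
      · exact Set.empty_subset _
      · exact subset_rfl
    have hfin : ∀ j, Measure.sum ν (B' j) ≠ ⊤ := fun j => by
      simp only [hB'def]
      split_ifs with h
      · simp
      · exact h
    have hind := iIndepFun_toNat_encard_cellPoints ν hB'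
      (fun j k hjk => (hd hjk).mono (hsub j) (hsub k)) hfin
    set ψ : Fin n → ℝ → ℕ∞ := fun j x =>
      if Measure.sum ν (B j) = ⊤ then ⊤ else ((⌊x⌋₊ : ℕ) : ℕ∞) with hψ
    have hψm : ∀ j, Measurable (ψ j) := fun j => by
      simp only [hψ]
      split_ifs
      · exact measurable_const
      · exact (measurable_from_nat (f := fun k : ℕ => (k : ℕ∞))).comp Nat.measurable_floor
    refine (hind.comp ψ hψm).congr fun j => ?_
    by_cases htop : Measure.sum ν (B j) = ⊤
    · filter_upwards [ae_pointCount_cellEnumeration ν,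
        ae_encard_cellPoints_eq_top ν (hB j) htop] with ω h1 h2
      simp only [Function.comp_apply, hψ, if_pos htop]
      rw [h1, h2]
    · filter_upwards [ae_pointCount_cellEnumeration ν,
        ae_toNat_encard_cellPoints ν (hB j) htop] with ω h1 h2
      simp only [Function.comp_apply, hψ, hB'def, if_neg htop, Nat.floor_natCast]
      rw [h1, ← h2.1]

/-- The cells n ≤ e^{-u} < n + 1 partition the line and each has intensity one. -/
theorem exists_sum_eq_expIntensity :
    ∃ ν : ℕ → Measure ℝ, (∀ n, IsProbabilityMeasure (ν n)) ∧ Measure.sum ν = expIntensity := by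
  set C : ℕ → Set ℝ := fun n => {u | Real.exp (-u) < ((n + 1 : ℕ) : ℝ)} \ {u | Real.exp (-u) < (n : ℝ)}
    with hC
  have hm : ∀ c : ℝ, MeasurableSet {u : ℝ | Real.exp (-u) < c} := fun c =>
    measurableSet_lt (by fun_prop) (by fun_prop)
  have hmono : Monotone fun n : ℕ => {u : ℝ | Real.exp (-u) < (n : ℝ)} := by
    intro a b hab u (hu : Real.exp (-u) < a)
    exact hu.trans_le (by exact_mod_cast hab)
  refine ⟨fun n => expIntensity.restrict (C n), fun n => ⟨?_⟩, ?_⟩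
  · rw [Measure.restrict_apply_univ, hC, measure_sdiff (hmono n.le_succ) (hm _).nullMeasurableSet,
      expIntensity_setOf_exp_neg_lt, expIntensity_setOf_exp_neg_lt,
      ← ENNReal.ofReal_sub _ (Nat.cast_nonneg n)]
    · simp
    · rw [expIntensity_setOf_exp_neg_lt]
      exact ENNReal.ofReal_ne_top
  · have hdisj : Pairwise (Function.onFun Disjoint C) := by
      intro a b hab
      rcases lt_or_gt_of_ne hab with h | h
      · exact Set.disjoint_left.mpr fun u hu hv => hv.2 (hmono (Nat.succ_le_of_lt h) hu.1)
      · exact Set.disjoint_left.mpr fun u hu hv => hu.2 (hmono (Nat.succ_le_of_lt h) hv.1)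
    have hU : ⋃ n, C n = Set.univ := by
      refine Set.eq_univ_of_forall fun u => Set.mem_iUnion.mpr ⟨⌊Real.exp (-u)⌋₊, ?_, ?_⟩
      · change Real.exp (-u) < ((⌊Real.exp (-u)⌋₊ + 1 : ℕ) : ℝ)
        push_cast
        exact Nat.lt_floor_add_one _
      · exact not_lt.mpr (Nat.floor_le (Real.exp_pos _).le)
    rw [← Measure.restrict_iUnion hdisj fun n => (hm _).diff (hm _), hU, Measure.restrict_univ]

theorem exists_isPoissonPointProcess_expIntensity :
    ∃ (μ : Measure (ℕ → ℕ × (ℕ → ℝ))) (U : ℕ → (ℕ → ℕ × (ℕ → ℝ)) → ℝ),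
      IsProbabilityMeasure μ ∧ IsPoissonPointProcess U expIntensity μ := by
  obtain ⟨ν, hν, hsum⟩ := exists_sum_eq_expIntensity
  exact ⟨cellLaw ν, cellEnumeration, inferInstance,
    hsum ▸ isPoissonPointProcess_cellEnumeration ν⟩

end PoissonExistence

/-! ### Gaussian processes from Hilbert space maps -/

section IsonormalProcess

theorem norm_exp_mul_I_sub_le (a b : ℝ) :
    ‖Complex.exp (a * Complex.I) - Complex.exp (b * Complex.I)‖ ≤ |a - b| := by
  have : Complex.exp (a * Complex.I) - Complex.exp (b * Complex.I)
      = Complex.exp (b * Complex.I) * (Complex.exp ((a - b : ℝ) * Complex.I) - 1) := by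
    rw [mul_sub, ← Complex.exp_add]
    push_cast
    ring_nf
  rw [this, norm_mul, Complex.norm_exp_ofReal_mul_I, one_mul]
  exact norm_exp_mul_I_sub_one_le _

/-- The map x ↦ e^{ix} is 1-Lipschitz and the L¹ norm is at most the L² norm on a probability space.
Hence characteristic functions pass to L² limits. -/
theorem norm_integral_exp_sub_le {Ω : Type*} [MeasurableSpace Ω] {μ : Measure Ω}
    [IsProbabilityMeasure μ] (F G : Lp ℝ 2 μ) :
    ‖∫ x, Complex.exp ((F x : ℝ) * Complex.I) ∂μ - ∫ x, Complex.exp ((G x : ℝ) * Complex.I) ∂μ‖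
      ≤ ‖F - G‖ := by
  have hint : ∀ F : Lp ℝ 2 μ, Integrable (fun x => Complex.exp ((F x : ℝ) * Complex.I)) μ := by
    intro F
    have hF := Lp.aestronglyMeasurable F
    refine Integrable.of_bound ?_ 1 (ae_of_all _ fun x => (Complex.norm_exp_ofReal_mul_I _).le)
    exact (Complex.continuous_exp.comp (Complex.continuous_ofReal.mul
      continuous_const)).comp_aestronglyMeasurable hF
  have hi : Integrable (F - G : Lp ℝ 2 μ) μ := (Lp.memLp (F - G)).integrable one_le_two
  rw [← integral_sub (hint F) (hint G)]
  calc ‖∫ x, (Complex.exp ((F x : ℝ) * Complex.I) - Complex.exp ((G x : ℝ) * Complex.I)) ∂μ‖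
      ≤ ∫ x, ‖(F - G : Lp ℝ 2 μ) x‖ ∂μ := by
        refine norm_integral_le_of_norm_le hi.norm ?_
        filter_upwards [Lp.coeFn_sub F G] with x hx
        rw [hx]
        exact norm_exp_mul_I_sub_le _ _
    _ = (eLpNorm (F - G : Lp ℝ 2 μ) 1 μ).toReal := by
        rw [integral_norm_eq_lintegral_enorm hi.1, eLpNorm_one_eq_lintegral_enorm]
    _ ≤ (eLpNorm (F - G : Lp ℝ 2 μ) 2 μ).toReal :=
        ENNReal.toReal_mono (Lp.eLpNorm_ne_top _)
          (eLpNorm_le_eLpNorm_of_exponent_le one_le_two hi.1)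
    _ = ‖F - G‖ := (Lp.norm_def _).symm

variable {ι : Type*}

/-- The law of a family of independent standard Gaussian variables. -/
noncomputable def gaussianSequence (ι : Type*) : Measure (ι → ℝ) :=
  Measure.infinitePi fun _ => gaussianReal 0 1

instance : IsProbabilityMeasure (gaussianSequence ι) := by
  unfold gaussianSequence
  infer_instance

theorem map_eval_gaussianSequence (i : ι) :
    (gaussianSequence ι).map (fun x => x i) = gaussianReal 0 1 :=
  Measure.infinitePi_map_eval _ i

theorem hasGaussianLaw_eval_gaussianSequence (i : ι) :
    HasGaussianLaw (fun x : ι → ℝ => x i) (gaussianSequence ι) :=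
  ⟨by rw [map_eval_gaussianSequence]; infer_instance⟩

/-- The `i`-th coordinate as a square integrable function. -/
noncomputable def gaussianCoordinate (i : ι) : Lp ℝ 2 (gaussianSequence ι) :=
  (hasGaussianLaw_eval_gaussianSequence i).memLp_two.toLp (fun x => x i)

theorem orthonormal_gaussianCoordinate :
    Orthonormal ℝ (gaussianCoordinate : ι → Lp ℝ 2 (gaussianSequence ι)) := by
  classical
  have hinner : ∀ i j : ι, inner ℝ (gaussianCoordinate i) (gaussianCoordinate j)
      = ∫ x, x i * x j ∂(gaussianSequence ι) := by
    intro i j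
    rw [L2.inner_def]
    refine integral_congr_ae ?_
    filter_upwards [(hasGaussianLaw_eval_gaussianSequence i).memLp_two.coeFn_toLp,
      (hasGaussianLaw_eval_gaussianSequence j).memLp_two.coeFn_toLp] with x hx hy
    rw [gaussianCoordinate, gaussianCoordinate, hx, hy]
    simp [mul_comm]
  have hmean : ∀ i : ι, ∫ x, x i ∂(gaussianSequence ι) = 0 := by
    intro i
    have := integral_map (μ := gaussianSequence ι) (φ := fun x => x i) (measurable_pi_apply i).aemeasurable
      (f := fun y : ℝ => y) (by fun_prop)
    rw [← this, map_eval_gaussianSequence, integral_id_gaussianReal]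
  rw [orthonormal_iff_ite]
  intro i j
  rw [hinner]
  split_ifs with hij
  · subst hij
    have h1 := integral_map (μ := gaussianSequence ι) (φ := fun x => x i) (measurable_pi_apply i).aemeasurable
      (f := fun y : ℝ => y * y) (by fun_prop)
    have h2 := variance_of_integral_eq_zero (μ := gaussianReal 0 1) (X := fun y : ℝ => y)
      (by fun_prop) integral_id_gaussianReal
    rw [variance_fun_id_gaussianReal] at h2
    rw [← h1, map_eval_gaussianSequence]
    simp_rw [← sq]
    simpa using h2.symm
  · have hind : iIndepFun (fun (i : ι) (x : ι → ℝ) => x i) (gaussianSequence ι) :=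
      iIndepFun_infinitePi (X := fun _ y => y) fun _ => measurable_id
    have := (hind.indepFun hij).integral_fun_mul_eq_mul_integral
      (measurable_pi_apply i).aestronglyMeasurable (measurable_pi_apply j).aestronglyMeasurable
    rw [this, hmean, zero_mul]

theorem integral_exp_sum_gaussianCoordinate (s : Finset ι) (a : ι → ℝ) :
    ∫ x, Complex.exp ((((∑ i ∈ s, a i • gaussianCoordinate i : Lp ℝ 2 (gaussianSequence ι)) x : ℝ) : ℂ)
      * Complex.I) ∂(gaussianSequence ι) = Complex.exp (-(∑ i ∈ s, a i ^ 2 : ℝ) / 2) := by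
  classical
  have hcoe : ⇑(∑ i ∈ s, a i • gaussianCoordinate i : Lp ℝ 2 (gaussianSequence ι))
      =ᵐ[gaussianSequence ι] fun x => ∑ i ∈ s, a i * x i := by
    induction s using Finset.induction_on with
    | empty =>
      simp only [Finset.sum_empty]
      exact Lp.coeFn_zero ℝ 2 _
    | insert j s hj ih =>
      rw [Finset.sum_insert hj]
      filter_upwards [ih, Lp.coeFn_add (a j • gaussianCoordinate j)
        (∑ i ∈ s, a i • gaussianCoordinate i), Lp.coeFn_smul (a j) (gaussianCoordinate j),
        (hasGaussianLaw_eval_gaussianSequence j).memLp_two.coeFn_toLp] with x h1 h2 h3 h4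
      rw [h2, Pi.add_apply, h1, h3, Pi.smul_apply, gaussianCoordinate, h4,
        Finset.sum_insert hj, smul_eq_mul]
  have h1 : ∫ x, Complex.exp ((((∑ i ∈ s, a i • gaussianCoordinate i :
      Lp ℝ 2 (gaussianSequence ι)) x : ℝ) : ℂ) * Complex.I) ∂(gaussianSequence ι)
      = ∫ x, ∏ i ∈ s, Complex.exp ((a i * x i : ℝ) * Complex.I) ∂(gaussianSequence ι) := by
    refine integral_congr_ae ?_
    filter_upwards [hcoe] with x hx
    rw [hx, ← Complex.exp_sum]
    push_cast
    rw [Finset.sum_mul]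
  rw [h1, gaussianSequence, integral_finset_prod_infinitePi
    (f := fun i y => Complex.exp ((a i * y : ℝ) * Complex.I)) _ (fun i => by fun_prop)]
  have h2 : ∀ i, ∫ y, Complex.exp ((a i * y : ℝ) * Complex.I) ∂(gaussianReal 0 1)
      = Complex.exp (-(a i ^ 2 : ℝ) / 2) := by
    intro i
    have := charFun_gaussianReal (μ := 0) (v := 1) (a i)
    rw [charFun_apply] at this
    simp only [RCLike.inner_apply, conj_trivial] at this
    rw [this]
    push_cast
    ring_nf
  simp_rw [h2]
  rw [← Complex.exp_sum]
  congr 1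
  push_cast
  rw [← Finset.sum_div, Finset.sum_neg_distrib]

/-- Every Hilbert space embeds isometrically into a Gaussian space. -/
theorem exists_isonormal.{q} (H : Type q) [NormedAddCommGroup H] [InnerProductSpace ℝ H]
    [CompleteSpace H] : ∃ (ι : Type q) (J : H →ₗᵢ[ℝ] Lp ℝ 2 (gaussianSequence ι)),
      ∀ h, (gaussianSequence ι).map (J h) = gaussianReal 0 (‖h‖₊ ^ 2) := by
  obtain ⟨w, b, -⟩ := exists_hilbertBasis ℝ H
  -- The isometry sends a Hilbert basis to independent standard Gaussian coordinates.
  set V := (orthonormal_gaussianCoordinate (ι := w)).orthogonalFamily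
  set J : H →ₗᵢ[ℝ] Lp ℝ 2 (gaussianSequence w) :=
    V.linearIsometry.comp b.repr.toLinearIsometry with hJ
  have hexp : ∀ h, ∫ x, Complex.exp ((J h x : ℝ) * Complex.I) ∂(gaussianSequence w)
      = Complex.exp (-(‖h‖ ^ 2 : ℝ) / 2) := by
    intro h
    have hsum : Tendsto (fun s : Finset w => ∑ i ∈ s, b.repr h i • gaussianCoordinate i) atTop
        (𝓝 (J h)) := V.hasSum_linearIsometry (b.repr h)
    have hsq : ∀ s : Finset w, ∑ i ∈ s, (b.repr h i) ^ 2
        = ‖∑ i ∈ s, b.repr h i • gaussianCoordinate i‖ ^ 2 := by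
      intro s
      have := (orthonormal_gaussianCoordinate (ι := w)).inner_sum (b.repr h) (b.repr h) s
      rw [real_inner_self_eq_norm_sq] at this
      rw [this]
      exact Finset.sum_congr rfl fun i _ => by simp [sq]
    have hlim : Tendsto (fun s : Finset w => Complex.exp (-(∑ i ∈ s, (b.repr h i) ^ 2 : ℝ) / 2))
        atTop (𝓝 (Complex.exp (-(‖h‖ ^ 2 : ℝ) / 2))) := by
      have hc : Continuous fun r : ℝ => Complex.exp (-(r : ℂ) / 2) := by fun_prop
      refine (hc.tendsto _).comp ?_
      simp_rw [hsq]
      rw [← J.norm_map h]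
      exact hsum.norm.pow 2
    refine tendsto_nhds_unique ?_ hlim
    simp_rw [← integral_exp_sum_gaussianCoordinate]
    rw [tendsto_iff_norm_sub_tendsto_zero]
    exact squeeze_zero (fun _ => norm_nonneg _) (fun s => norm_integral_exp_sub_le _ _)
      (tendsto_iff_norm_sub_tendsto_zero.mp hsum)
  refine ⟨w, J, fun h => ?_⟩
  have hm := (Lp.aestronglyMeasurable (J h)).aemeasurable
  have := Measure.isProbabilityMeasure_map hm
  refine Measure.ext_of_charFun (funext fun θ => ?_)
  rw [charFun_apply, charFun_gaussianReal, integral_map hm (by fun_prop)]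
  -- By linearity of J, the value of the characteristic function at θ is the value at 1 for the
  -- vector θ • h.
  have h1 := hexp (θ • h)
  have h2 : ∫ x, Complex.exp ((inner ℝ (J h x) θ : ℝ) * Complex.I) ∂(gaussianSequence w)
      = ∫ x, Complex.exp ((J (θ • h) x : ℝ) * Complex.I) ∂(gaussianSequence w) := by
    refine integral_congr_ae ?_
    rw [map_smul]
    filter_upwards [Lp.coeFn_smul θ (J h)] with x hx
    rw [hx]
    simp
  rw [h2, h1]
  congr 1
  rw [norm_smul, Real.norm_eq_abs, mul_pow, sq_abs]
  push_cast
  ring_nf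

/-- For every map into a Hilbert space there is a centred Gaussian process with the corresponding
incremental variance. -/
theorem exists_gaussianProcess {T : Type*} {H : Type*} [NormedAddCommGroup H]
    [InnerProductSpace ℝ H] [CompleteSpace H] (f : T → H) :
    ∃ ρ : Measure (T → ℝ), IsProbabilityMeasure ρ ∧ IsGaussianProcess (fun t (x : T → ℝ) => x t) ρ ∧
      (∀ t, ∫ x, x t ∂ρ = 0) ∧
      ∀ s t, variance (fun x : T → ℝ => x s - x t) ρ = ‖f s - f t‖ ^ 2 := by
  obtain ⟨ι, J, hJ⟩ := exists_isonormal H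
  let μ := gaussianSequence ι
  have hmeas : ∀ t, AEMeasurable (J (f t)) μ := fun t =>
    (Lp.aestronglyMeasurable (J (f t))).aemeasurable
  -- The elements of L² are only classes of functions; a process requires a measurable
  -- representative at each site.
  set X : T → (ι → ℝ) → ℝ := fun t => (hmeas t).mk _ with hX
  have hXm : ∀ t, Measurable (X t) := fun t => (hmeas t).measurable_mk
  have hXae : ∀ t, X t =ᵐ[μ] J (f t) := fun t => (hmeas t).ae_eq_mk.symm
  have hpath : Measurable fun ω t => X t ω := measurable_pi_lambda _ hXm
  set ρ := μ.map fun ω t => X t ω with hρ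
  have hlin : ∀ (I : Finset T) (c : I → ℝ),
      μ.map (fun ω => ∑ t, c t * X t ω) = gaussianReal 0 (‖∑ t, c t • f t‖₊ ^ 2) := by
    classical
    intro I c
    rw [← hJ]
    refine Measure.map_congr ?_
    have hs : ∀ s : Finset I, (fun ω => ∑ t ∈ s, c t * X t ω) =ᵐ[μ] J (∑ t ∈ s, c t • f t) := by
      intro s
      induction s using Finset.induction_on with
      | empty =>
        simp only [Finset.sum_empty, map_zero]
        exact (Lp.coeFn_zero ℝ 2 μ).symm
      | insert j s hj ih =>
        rw [Finset.sum_insert hj, map_add, map_smul]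
        filter_upwards [ih, Lp.coeFn_add (c j • J (f j)) (J (∑ t ∈ s, c t • f t)),
          Lp.coeFn_smul (c j) (J (f j)), hXae j] with x h1 h2 h3 h4
        rw [h2, Pi.add_apply, h3, Pi.smul_apply, ← h1, ← h4, Finset.sum_insert hj, smul_eq_mul]
    exact hs Finset.univ
  refine ⟨ρ, Measure.isProbabilityMeasure_map hpath.aemeasurable, ⟨fun I => ⟨?_⟩⟩,
    fun t => ?_, fun s t => ?_⟩
  · classical
    refine isGaussian_of_map_eq_gaussianReal fun L =>
      ⟨0, ‖∑ t : I, L (Pi.single t 1) • f t‖₊ ^ 2, ?_⟩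
    rw [hρ, Measure.map_map (by fun_prop) hpath, Measure.map_map (by fun_prop) (by fun_prop)]
    refine Eq.trans ?_ (hlin I fun t => L (Pi.single t 1))
    congr 1
    funext ω
    simp only [Function.comp_apply]
    exact dual_apply_eq_sum L (I.restrict fun t => X t ω)
  · rw [hρ, integral_map hpath.aemeasurable (measurable_pi_apply t).aestronglyMeasurable]
    have h1 := hJ (f t)
    rw [← Measure.map_congr (hXae t)] at h1
    have h2 := integral_map (μ := μ) (hXm t).aemeasurable (f := fun y : ℝ => y) (by fun_prop)
    rw [← h2, h1, integral_id_gaussianReal]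
  · have h1 : (fun ω => X s ω - X t ω) =ᵐ[μ] J (f s - f t) := by
      rw [map_sub]
      filter_upwards [hXae s, hXae t, Lp.coeFn_sub (J (f s)) (J (f t))] with ω h1 h2 h3
      rw [h3, Pi.sub_apply, h1, h2]
    have h2 := hJ (f s - f t)
    rw [← Measure.map_congr h1] at h2
    have hm : Measurable fun ω => X s ω - X t ω := (hXm s).sub (hXm t)
    rw [hρ, variance_map (by fun_prop) hpath.aemeasurable]
    have h3 := variance_map (μ := μ) (X := fun y : ℝ => y) (by fun_prop) hm.aemeasurable
    rw [h2, variance_fun_id_gaussianReal] at h3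
    simpa [Function.comp_def] using h3.symm

end IsonormalProcess

/-! ### Existence of Gauss–Poisson families and the theorem -/

section Existence

theorem iIndepFun_comp_measurePreserving {Ω Ω' ι : Type*} {E : ι → Type*} [MeasurableSpace Ω]
    [MeasurableSpace Ω'] [∀ i, MeasurableSpace (E i)] {P : Measure Ω} {μ : Measure Ω'} {π : Ω → Ω'}
    (hπ : MeasurePreserving π P μ) {X : ∀ i, Ω' → E i} (hm : ∀ i, Measurable (X i))
    (hX : iIndepFun X μ) : iIndepFun (fun i ω => X i (π ω)) P := by
  rw [iIndepFun_iff_measure_inter_preimage_eq_mul] at hX ⊢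
  intro S sets hsets
  have hpre : ∀ i ∈ S, P ((fun ω => X i (π ω)) ⁻¹' sets i) = μ (X i ⁻¹' sets i) := fun i hi => by
    rw [← hπ.measure_preimage (hm i (hsets i hi)).nullMeasurableSet]
    rfl
  rw [Finset.prod_congr rfl hpre, ← hX S hsets, ← hπ.measure_preimage
    (Finset.measurableSet_biInter _ fun i hi => hm i (hsets i hi)).nullMeasurableSet]
  congr 1
  ext ω
  simp

/-- Gauss–Poisson families exist for the incremental variance of every Hilbert space valued map. -/
theorem exists_isGaussPoissonFamily.{p, q} {T : Type p} {H : Type q} [NormedAddCommGroup H]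
    [InnerProductSpace ℝ H] [CompleteSpace H] (f : T → H) :
    ∃ (Ω : Type p) (_ : MeasurableSpace Ω) (P : Measure Ω) (U : ℕ → Ω → ℝ) (W : ℕ → T → Ω → ℝ),
      IsGaussPoissonFamily (fun s t : T => ‖f s - f t‖ ^ 2) U W P := by
  obtain ⟨μ, U, hμ, hU⟩ := exists_isPoissonPointProcess_expIntensity
  obtain ⟨ρ, hρ, hg, h0, hv⟩ := exists_gaussianProcess f
  set κ : Measure (ℕ → T → ℝ) := Measure.infinitePi fun _ => ρ
  set P := μ.prod κ with hP
  have hfst : MeasurePreserving Prod.fst P μ := measurePreserving_fst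
  have hsnd : MeasurePreserving Prod.snd P κ := measurePreserving_snd
  have heval : ∀ i, MeasurePreserving (fun ω : (ℕ → ℕ × (ℕ → ℝ)) × (ℕ → T → ℝ) => ω.2 i) P ρ :=
    fun i => (measurePreserving_eval_infinitePi (fun _ : ℕ => ρ) i).comp hsnd
  refine ⟨(ℕ → ℕ × (ℕ → ℝ)) × (ℕ → T → ℝ), inferInstance, P, fun i ω => U i ω.1,
    fun i t ω => ω.2 i t, ?_⟩
  refine
    { isProbabilityMeasure := inferInstance
      poisson := ?_
      measurable := fun i t => by fun_prop
      gaussian := fun i => ⟨fun I => ⟨?_⟩⟩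
      mean_zero := fun i t => ?_
      incrementalVariance := fun i s t => ?_
      identDistrib := fun i => ⟨(heval i).aemeasurable, (heval 0).aemeasurable, ?_⟩
      indep_copies := ?_
      indep_points := ?_ }
  · have hcount : ∀ B, pointCount (fun i (ω : (ℕ → ℕ × (ℕ → ℝ)) × (ℕ → T → ℝ)) => U i ω.1) B
        = fun ω => pointCount U B ω.1 := fun B => rfl
    refine ⟨fun i => (hU.measurable i).comp measurable_fst, fun B hB hfin k => ?_,
      fun n B hB hd => ?_⟩
    · rw [← hU.law_count B hB hfin k, hcount]
      exact hfst.measure_preimage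
        (measurable_pointCount hU.measurable hB (measurableSet_singleton _)).nullMeasurableSet
    · simp only [hcount]
      exact iIndepFun_comp_measurePreserving hfst
        (fun j => measurable_pointCount hU.measurable (hB j)) (hU.indep_count n B hB hd)
  · have h1 := (hg.hasGaussianLaw I).isGaussian_map
    rw [← (heval i).map_eq, Measure.map_map (by fun_prop) (heval i).measurable] at h1
    exact h1
  · rw [← h0 t, ← (heval i).map_eq, integral_map (heval i).aemeasurable
      (measurable_pi_apply t).aestronglyMeasurable]
  · rw [← hv s t, ← (heval i).map_eq, variance_map (by fun_prop) (heval i).aemeasurable]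
    rfl
  · exact (heval i).map_eq.trans (heval 0).map_eq.symm
  · exact iIndepFun_comp_measurePreserving hsnd (X := fun i x => x i)
      (fun i => measurable_pi_apply i)
      (iIndepFun_infinitePi (X := fun _ y => y) fun _ => measurable_id)
  · exact indepFun_prod (X := fun ω i => U i ω) (Y := fun x => x)
      (measurable_pi_lambda _ hU.measurable) measurable_id

end Existence

theorem theorem5p3 {T : Type u} [PseudoMetricSpace T]
    {H : Type v} [NormedAddCommGroup H] [InnerProductSpace ℝ H] [CompleteSpace H]
    (f : T → H) (hf : Isometry f) (α : ℝ) (hα : α ∈ Set.Ioo (0 : ℝ) 2) :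
    -- Gauss--Poisson families with incremental variance `Γ = d²` exist
    (∃ (Ω : Type u) (_ : MeasurableSpace Ω) (P : Measure Ω) (U : ℕ → Ω → ℝ) (W : ℕ → T → Ω → ℝ),
      IsGaussPoissonFamily (fun s t : T => dist s t ^ 2) U W P) ∧
    -- for each of them the series converges and is `α`-stable, totally skewed to the right
    (∀ (Ω : Type w) [MeasurableSpace Ω] (P : Measure Ω) (U : ℕ → Ω → ℝ) (W : ℕ → T → Ω → ℝ),
      IsGaussPoissonFamily (fun s t : T => dist s t ^ 2) U W P →
      (∃ S : T → Ω → ℝ, IsCenteredSeries α U W P S) ∧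
      ∀ S : T → Ω → ℝ, IsCenteredSeries α U W P S →
        IsStableProcess α S P ∧ IsTotallySkewedRight α S P) ∧
    -- the law of the process is the same for any two of them
    (∀ (Ω : Type w) [MeasurableSpace Ω] (P : Measure Ω) (U : ℕ → Ω → ℝ) (W : ℕ → T → Ω → ℝ)
      (S : T → Ω → ℝ) (Ω' : Type z) [MeasurableSpace Ω'] (P' : Measure Ω') (U' : ℕ → Ω' → ℝ)
      (W' : ℕ → T → Ω' → ℝ) (S' : T → Ω' → ℝ),
      IsGaussPoissonFamily (fun s t : T => dist s t ^ 2) U W P →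
      IsCenteredSeries α U W P S →
      IsGaussPoissonFamily (fun s t : T => dist s t ^ 2) U' W' P' →
      IsCenteredSeries α U' W' P' S' →
      P.map (fun ω t => S t ω) = P'.map (fun ω t => S' t ω)) := by
  refine ⟨?_, fun Ω _ P U W h => ⟨h.exists_isCenteredSeries hα, fun S hS =>
    ⟨h.isStableProcess_centeredSeries hα hS, h.isTotallySkewedRight hα hS⟩⟩,
    fun Ω _ P U W S Ω' _ P' U' W' S' h hS h' hS' => h.map_centeredSeries_eq h' hα hS hS'⟩
  have : (fun s t : T => dist s t ^ 2) = fun s t => ‖f s - f t‖ ^ 2 := by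
    funext s t
    rw [← dist_eq_norm, hf.dist_eq]
  rw [this]
  exact exists_isGaussPoissonFamily f
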